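/- Let $T=S^1\times\cdots\times S^1$ be a compact torus with $r$ factors and Lie algebra $\mathfrak t$; identify the integer lattice in $\mathfrak t^*$, i.e. the characters of $T$, with $\mathbb Z^r$. A $T$-action on a compact connected manifold $M$ is called GKM if $M$ is orientable, its odd Betti numbers vanish, the fixed point set $M^T$ is finite, and at each fixed point any two weights (elements of $\mathbb Z^r/\pm1$) of the isotropy representation are linearly independent. Its GKM graph has vertex set $M^T$; its edges are the $T$-invariant $2$-spheres in the one-skeleton $M_1=\{p\in M\mid \dim T\cdot p\le 1\}$ (the closures of the connected components of $M_1\setminus M^T$), each joining the two fixed points that it contains and labelled with the weight, in $\mathbb Z^r/\pm 1$, of the isotropy representation on its tangent plane at either end point. Let $Q\subset\mathrm{End}(TM)$ denote the quaternion-Kähler structure of $M=\mathbb HP^n=\mathrm{Sp}(n+1)/\mathrm{Sp}(1)\times\mathrm{Sp}(n)$ or $M=\mathrm{Gr}_2(\mathbb C^n)=\mathrm U(n)/\mathrm U(2)\times\mathrm U(n-2)$, i.e. the equivariant rank $3$ bundle which at the origin is $\{\mathrm{ad}_X\mid X\in\mathfrak{sp}(1)\}$, where $\mathfrak{sp}(1)$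 is the Lie algebra of the factor $\mathrm{Sp}(1)$, respectively of $\mathrm{SU}(2)\subset\mathrm U(2)$. The quaternionic weight at a fixed point $v$ is the weight, up to sign, of the induced $T$-representation on $Q_v$ (the sum of a trivial line and a weight plane). **(A) $\mathbb HP^n$, $n\ge1$.** Let $v_0=[1:0:\cdots:0],\ldots,v_n=[0:\cdots:0:1]$. Consider a GKM action of $T$ on $\mathbb HP^n$ given by a continuous homomorphism from $T$ to $\mathrm{Sp}(n+1)/\mathbb Z_2$, $\mathbb Z_2=\{\pm1\}$, with values in the image of the standard diagonal torus. Then the fixed points are $v_0,\dots,v_n$, there is a quaternionic weight $\pm\lambda$ at $v_0$ with $\lambda\in\mathbb Z^r$, and for either choice of the sign of $\lambda$ there are $\alpha_1,\ldots,\alpha_n\in\mathbb Z^r$ such that the edges of the GKM graph are exactly the following: 1. for $k=1,\ldots,n$, two edges between $v_0$ and $v_k$, with labels $\pm\alpha_k$ and $\pm(\lambda-\alpha_k)$; 2. for $1\le k<l\le n$, two edges between $v_k$ and $v_l$, with labels $\pm(\alpha_k-\alpha_l)$ and $\pm(\lambda-\alpha_k-\alpha_l)$; and the quaternionic weight is $\pm\lambda$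 at $v_0$ and $\pm(\lambda-2\alpha_k)$ at $v_k$, $k=1,\ldots,n$. Conversely, let $\lambda,\alpha_1,\ldots,\alpha_n\in\mathbb Z^r$ be such that in the labelled graph with vertices $v_0,\dots,v_n$ and the edges and labels above, the labels of any two distinct edges at any vertex are linearly independent. Then there is a continuous homomorphism from $T$ to the $\mathbb Z_2$-quotient of the diagonal torus of $\mathrm{Sp}(n+1)$ such that the induced action on $\mathbb HP^n$ is GKM and has this GKM graph, with the quaternionic weights above. **(B) $\mathrm{Gr}_2(\mathbb C^n)$, $n\ge3$.** Let $v_{ij}=v_{ji}=\mathbb C_i\oplus\mathbb C_j$ for $1\le i\neq j\le n$. Consider a GKM action of $T$ on $\mathrm{Gr}_2(\mathbb C^n)$ given by a continuous homomorphism from $T$ to the standard diagonal torus of $\mathrm U(n)$. Then the fixed points are the $v_{ij}$, there is a quaternionic weight $\pm\lambda$ at $v_{12}$ with $\lambda\in\mathbb Z^r$, and for either choice of the sign of $\lambda$ there are $\alpha_3,\ldots,\alpha_n\in\mathbb Z^r$ such that the edges of the GKM graph are exactly the following: 1. for $k\ge3$, an edge between $v_{12}$ and $v_{1k}$ labelled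 $\pm\alpha_k$, and an edge between $v_{12}$ and $v_{2k}$ labelled $\pm(\lambda-\alpha_k)$; 2. for $k\ge3$, an edge between $v_{1k}$ and $v_{2k}$ labelled $\pm\lambda$; 3. for $1\le k\le n$ and $3\le l<m\le n$ with $k\ne l,m$, an edge between $v_{kl}$ and $v_{km}$ labelled $\pm(\alpha_l-\alpha_m)$; 4. for $k,l\ge3$, $k\neq l$, an edge between $v_{1k}$ and $v_{kl}$ labelled $\pm(\lambda-\alpha_l)$, and an edge between $v_{2k}$ and $v_{kl}$ labelled $\pm\alpha_l$; and the quaternionic weights are $\pm\lambda$ at $v_{12}$, $\pm(\lambda-\alpha_k)$ at $v_{1k}$, $\pm\alpha_k$ at $v_{2k}$, and $\pm(\alpha_k-\alpha_l)$ at $v_{kl}$ ($k,l\ge3$, $k\ne l$). Conversely, let $\lambda,\alpha_3,\ldots,\alpha_n\in\mathbb Z^r$ be such that in the labelled graph with vertices $v_{ij}$ and the edges and labels above, the labels of any two distinct edges at any vertex are linearly independent. Then there is a continuous homomorphism from $T$ to the diagonal torus of $\mathrm U(n)$ such that the induced action on $\mathrm{Gr}_2(\mathbb C^n)$ is GKM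 and has this GKM graph, with the quaternionic weights above. -/

import Mathlib

open scoped Matrix.Norms.Operator Quaternion ContDiff

noncomputable section

/-! ## Tori, characters, weight planes -/

/-- The compact torus `T = S¹ × ⋯ × S¹` (`r` factors).  Its Lie algebra is `ℝʳ`, and the integer
lattice in the dual of the Lie algebra is `ℤʳ = Fin r → ℤ`. -/
abbrev Torus (r : ℕ) : Type := Fin r → Circle

/-- The character of `T` belonging to the element `m` of the integer lattice. -/
def weightChar {r : ℕ} (m : Fin r → ℤ) (t : Torus r) : Circle := ∏ i, t i ^ m i

/-- `L` is a (real) weight plane of weight `± m` of a real representation of `T`: it has a basis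
`u, w` in which `t` acts as the rotation by the argument of the character `m` at `t`.  Exchanging
`u` and `w` shows that `m` and `-m` have the same weight planes; so `m` stands for its class
modulo sign. -/
def IsWeightPlane {r : ℕ} {W : Type*} [AddCommGroup W] [Module ℝ W]
    (σ : Representation ℝ (Torus r) W) (m : Fin r → ℤ) (L : Submodule ℝ W) : Prop :=
  ∃ u w : W, LinearIndependent ℝ ![u, w] ∧ Submodule.span ℝ {u, w} = L ∧
    ∀ t : Torus r,
      σ t u = (weightChar m t : ℂ).re • u + (weightChar m t : ℂ).im • w ∧
      σ t w = -(weightChar m t : ℂ).im • u + (weightChar m t : ℂ).re • w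

/-! ## Submanifolds of a vector space -/

section Submanifold

variable {V : Type*} [NormedAddCommGroup V] [NormedSpace ℝ V]

/-- The tangent space at `p` of a submanifold `M ⊆ V`: spanned by (in fact, for a submanifold,
equal to) the velocities at `p` of smooth curves that run in `M`. -/
def tangentSpaceAt (M : Set V) (p : V) : Submodule ℝ V :=
  Submodule.span ℝ {v | ∃ γ : ℝ → V, ContDiff ℝ ∞ γ ∧ (∀ s, γ s ∈ M) ∧ γ 0 = p ∧
    HasDerivAt γ v 0}

/-- `M` is orientable: it carries a continuous nowhere vanishing form of top degree. -/
def IsOrientableSubmanifold (M : Set V) : Prop :=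
  ∃ (d : ℕ) (τ : V → V [⋀^Fin d]→L[ℝ] ℝ), ContinuousOn τ M ∧
    ∀ p ∈ M, Module.finrank ℝ (tangentSpaceAt M p) = d ∧
      ∃ v : Fin d → V, (∀ i, v i ∈ tangentSpaceAt M p) ∧ τ p v ≠ 0

/-- The odd Betti numbers of a compact submanifold `M ⊆ V` vanish, expressed in de Rham
cohomology (whose dimensions are the rational Betti numbers): every form of odd degree on `M`
that is closed on `M` is exact on `M`.  As `M` is a closed submanifold, its smooth differential
forms are the restrictions of the smooth forms on `V`, and restriction commutes with the exterior
derivative. -/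
def OddBettiNumbersVanish (M : Set V) : Prop :=
  ∀ (j : ℕ) (τ : V → V [⋀^Fin (2 * j + 1)]→L[ℝ] ℝ), ContDiff ℝ ∞ τ →
    (∀ p ∈ M, ∀ v : Fin (2 * j + 1 + 1) → V, (∀ i, v i ∈ tangentSpaceAt M p) →
      extDeriv τ p v = 0) →
    ∃ η : V → V [⋀^Fin (2 * j)]→L[ℝ] ℝ, ContDiff ℝ ∞ η ∧
      ∀ p ∈ M, ∀ v : Fin (2 * j + 1) → V, (∀ i, v i ∈ tangentSpaceAt M p) →
        τ p v = extDeriv η p v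

end Submanifold

/-! ## Torus actions, GKM actions and their graphs -/

/-- An action of the torus `T` on a subset `carrier` of `V` (for us always a compact submanifold)
that is the restriction of a continuous linear representation of `T` on `V`. -/
structure TorusAction (r : ℕ) (V : Type*) [NormedAddCommGroup V] [NormedSpace ℝ V] where
  carrier : Set V
  rep : Torus r →* (V →L[ℝ] V)
  continuous_rep : ∀ x, Continuous fun t => rep t x
  mapsTo : ∀ t, ∀ x ∈ carrier, rep t x ∈ carrier

/-- An unsigned labelled multigraph.  The two end points of an edge form an unordered pair, and
several edges may have the same end points.  Labels are elements of `ℤʳ` that stand for their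
classes modulo sign. -/
structure LabelledGraph (r : ℕ) where
  Vertex : Type
  Edge : Type
  ends : Edge → Sym2 Vertex
  label : Edge → Fin r → ℤ

/-- At every vertex, the labels of any two edges are linearly independent. -/
def LabelledGraph.PairwiseIndependent {r : ℕ} (Γ : LabelledGraph r) : Prop :=
  ∀ (v : Γ.Vertex) (e f : Γ.Edge), v ∈ Γ.ends e → v ∈ Γ.ends f → e ≠ f →
    LinearIndependent ℤ ![Γ.label e, Γ.label f]

namespace TorusAction

variable {r : ℕ} {V : Type*} [NormedAddCommGroup V] [NormedSpace ℝ V] (𝒜 : TorusAction r V)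

def fixedPoints : Set V := {p | p ∈ 𝒜.carrier ∧ ∀ t, 𝒜.rep t p = p}

/-- The tangent space at `x` of the `T`-orbit of `x`, i.e. the values at `x` of the fundamental
vector fields. -/
def orbitTangent (x : V) : Submodule ℝ V :=
  Submodule.span ℝ {v | ∃ X : Fin r → ℝ,
    HasDerivAt (fun s : ℝ => 𝒜.rep (fun i => Circle.exp (s * X i)) x) v 0}

/-- `M₁`: the union of the orbits of dimension at most one. -/
def oneSkeleton : Set V :=
  {x | x ∈ 𝒜.carrier ∧ Module.finrank ℝ (𝒜.orbitTangent x) ≤ 1}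

/-- The edges of the orbit space `M₁/T`, as subsets of `M`: the closures of the connected
components of `M₁ ∖ Mᵀ`. -/
def edges : Set (Set V) :=
  {S | ∃ x ∈ 𝒜.oneSkeleton \ 𝒜.fixedPoints,
    S = closure (connectedComponentIn (𝒜.oneSkeleton \ 𝒜.fixedPoints) x)}

theorem rep_mem_tangentSpaceAt {p : V} (hp : p ∈ 𝒜.fixedPoints) (t : Torus r) :
    ∀ v ∈ tangentSpaceAt 𝒜.carrier p, 𝒜.rep t v ∈ tangentSpaceAt 𝒜.carrier p := by
  intro v hv
  have h : tangentSpaceAt 𝒜.carrier p ≤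
      (tangentSpaceAt 𝒜.carrier p).comap (𝒜.rep t : V →ₗ[ℝ] V) := by
    refine Submodule.span_le.2 ?_
    rintro w ⟨γ, hγ, hM, h0, hd⟩
    refine Submodule.subset_span ⟨fun s => 𝒜.rep t (γ s), ?_, fun s => 𝒜.mapsTo t _ (hM s), ?_, ?_⟩
    · exact (𝒜.rep t).contDiff.comp hγ
    · simp only [h0]
      exact hp.2 t
    · exact (𝒜.rep t).hasFDerivAt.comp_hasDerivAt 0 hd
  exact h hv

/-- The isotropy representation of `T` on the tangent space at a fixed point: as the action is the
restriction of a linear one, the differential of `t` is the restriction of `rep t`. -/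
def isotropyRep {p : V} (hp : p ∈ 𝒜.fixedPoints) :
    Representation ℝ (Torus r) (tangentSpaceAt 𝒜.carrier p) where
  toFun t := (𝒜.rep t : V →ₗ[ℝ] V).restrict (𝒜.rep_mem_tangentSpaceAt hp t)
  map_one' := by ext v; simp
  map_mul' s t := by ext v; simp

/-- The action is of GKM type: `M` is orientable, its odd Betti numbers vanish, the fixed point
set is finite, and at each fixed point any two weights of the isotropy representation are linearly
independent (in particular, all weights have multiplicity one). -/
structure IsGKM : Prop where
  orientable : IsOrientableSubmanifold 𝒜.carrier
  oddBetti : OddBettiNumbersVanish 𝒜.carrier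
  finite_fixedPoints : 𝒜.fixedPoints.Finite
  independent : ∀ (p : V) (hp : p ∈ 𝒜.fixedPoints)
    (L₁ L₂ : Submodule ℝ (tangentSpaceAt 𝒜.carrier p)) (m₁ m₂ : Fin r → ℤ),
    IsWeightPlane (𝒜.isotropyRep hp) m₁ L₁ → IsWeightPlane (𝒜.isotropyRep hp) m₂ L₂ →
    L₁ ≠ L₂ → LinearIndependent ℤ ![m₁, m₂]

/-- The labelled graph `Γ` is the GKM graph of the action, where the vertex `x` of `Γ` is the fixed
point `v x`.  The edges of `Γ` are in bijection with the edges of `M₁/T`, each of which is an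
embedded 2-sphere through exactly those fixed points that are its end points, and the label of an
edge is the weight of the isotropy representation, at any end point, on the weight plane that is
tangent to the sphere. -/
def HasGKMGraph (Γ : LabelledGraph r) (v : Γ.Vertex → V) : Prop :=
  Function.Injective v ∧ Set.range v = 𝒜.fixedPoints ∧
  ∃ c : Γ.Edge ≃ 𝒜.edges, ∀ e : Γ.Edge,
    Nonempty ((c e : Set V) ≃ₜ Metric.sphere (0 : EuclideanSpace ℝ (Fin 3)) 1) ∧
    (c e : Set V) ∩ 𝒜.fixedPoints = v '' {x | x ∈ Γ.ends e} ∧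
    ∀ (p : V) (hp : p ∈ 𝒜.fixedPoints), p ∈ (c e : Set V) →
      tangentSpaceAt (c e : Set V) p ≤ tangentSpaceAt 𝒜.carrier p ∧
      IsWeightPlane (𝒜.isotropyRep hp) (Γ.label e)
        ((tangentSpaceAt (c e : Set V) p).submoduleOf (tangentSpaceAt 𝒜.carrier p))

/-- `± m` is the weight of the representation of `T`, by conjugation, on a three-dimensional
invariant space `Q` of endomorphisms of the tangent space at the fixed point `p`: `Q` is the direct
sum of a trivial line and a weight plane of weight `± m`. -/
def IsQuatWeight (p : V)
    (Q : Submodule ℝ (tangentSpaceAt 𝒜.carrier p →ₗ[ℝ] tangentSpaceAt 𝒜.carrier p))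
    (m : Fin r → ℤ) : Prop :=
  ∃ (hp : p ∈ 𝒜.fixedPoints)
    (Q₀ Q' : Submodule ℝ (tangentSpaceAt 𝒜.carrier p →ₗ[ℝ] tangentSpaceAt 𝒜.carrier p)),
    Q₀ ⊔ Q' = Q ∧ Disjoint Q₀ Q' ∧ Module.finrank ℝ Q₀ = 1 ∧
    (∀ t, ∀ F ∈ Q₀, (𝒜.isotropyRep hp).linHom (𝒜.isotropyRep hp) t F = F) ∧
    IsWeightPlane ((𝒜.isotropyRep hp).linHom (𝒜.isotropyRep hp)) m Q'

end TorusAction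

/-! ## Homogeneous spaces as orbits of projections -/

section Conjugation

variable (A : Type*) [NormedRing A] [StarRing A] [NormedAlgebra ℝ A]

/-- A unitary element `g` acts on `A` by `x ↦ g x g⋆`. -/
def conjRep : unitary A →* (A →L[ℝ] A) where
  toFun g := ContinuousLinearMap.mulLeftRight ℝ A (g : A) (star (g : A))
  map_one' := by ext x; simp
  map_mul' g h := by ext x; simp [mul_assoc]

/-- The subgroup `{1, -1}` of the unitary group. -/
def signSubgroup : Subgroup (unitary A) where
  carrier := {g | (g : A) = 1 ∨ (g : A) = -1}
  one_mem' := by simp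
  mul_mem' := by
    rintro a b (ha | ha) (hb | hb) <;>
      simp only [Set.mem_ofPred_eq, Submonoid.coe_mul, ha, hb] <;> simp
  inv_mem' := by
    rintro a (ha | ha)
    · left; rw [← Unitary.star_eq_inv]; simp [ha]
    · right; rw [← Unitary.star_eq_inv]; simp [ha]

instance signSubgroup_normal : (signSubgroup A).Normal where
  conj_mem := by
    rintro a (ha | ha) g
    · left; rw [← Unitary.star_eq_inv]; simp [ha]
    · right; rw [← Unitary.star_eq_inv]; simp [ha]

theorem signSubgroup_le_ker : signSubgroup A ≤ (conjRep A).ker := by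
  rintro a (ha | ha) <;> rw [MonoidHom.mem_ker] <;> ext x <;> simp [conjRep, ha]

/-- The induced action of the quotient of the unitary group by `{1, -1}`. -/
def conjRepMod : unitary A ⧸ signSubgroup A →* (A →L[ℝ] A) :=
  QuotientGroup.lift (signSubgroup A) (conjRep A) (signSubgroup_le_ker A)

variable {A}

/-- The orbit of `p₀` under the unitary group `G`, that is, the homogeneous space `G/H`, where `H`
is the stabilizer of `p₀`. -/
def unitaryOrbit (p₀ : A) : Set A := {x | ∃ g : unitary A, x = conjRep A g p₀}

theorem conjRep_mem_unitaryOrbit (p₀ : A) (g : unitary A) :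
    ∀ x ∈ unitaryOrbit p₀, conjRep A g x ∈ unitaryOrbit p₀ := by
  rintro _ ⟨h, rfl⟩
  exact ⟨g * h, by simp⟩

theorem continuous_conjRep [ContinuousStar A] (x : A) :
    Continuous fun g : unitary A => conjRep A g x := by
  have : (fun g : unitary A => conjRep A g x) = fun g : unitary A => (g : A) * x * star (g : A) := by
    ext g; simp [conjRep]
  rw [this]
  fun_prop

/-- The action of `T` on the orbit of `p₀` that is given by a continuous homomorphism of `T` into
the unitary group. -/
def unitaryOrbitAction [ContinuousStar A] {r : ℕ} (p₀ : A) (φ : Torus r →ₜ* unitary A) :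
    TorusAction r A where
  carrier := unitaryOrbit p₀
  rep := (conjRep A).comp (φ : Torus r →* unitary A)
  continuous_rep x := (continuous_conjRep x).comp φ.continuous_toFun
  mapsTo t := conjRep_mem_unitaryOrbit p₀ (φ t)

/-- The action of `T` on the orbit of `p₀` that is given by a continuous homomorphism of `T` into
the quotient of the unitary group by `{1, -1}`. -/
def unitaryOrbitActionMod [ContinuousStar A] {r : ℕ} (p₀ : A)
    (φ : Torus r →ₜ* unitary A ⧸ signSubgroup A) : TorusAction r A where
  carrier := unitaryOrbit p₀
  rep := (conjRepMod A).comp (φ : Torus r →* unitary A ⧸ signSubgroup A)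
  continuous_rep x := by
    have h : Continuous fun g : unitary A ⧸ signSubgroup A => conjRepMod A g x :=
      (QuotientGroup.isQuotientMap_mk _).continuous_iff.2 (continuous_conjRep x)
    exact h.comp φ.continuous_toFun
  mapsTo t := by
    obtain ⟨g, hg⟩ := QuotientGroup.mk_surjective (φ t)
    intro x hx
    have := conjRep_mem_unitaryOrbit p₀ g x hx
    simpa [← hg, conjRepMod] using this

/-- The endomorphisms `v ↦ [X, v]`, for `X` in a subspace `s` of `A`, of the tangent space of `M`
at `p`.  (For `M` an orbit of the unitary group and `X` in the Lie algebra of the stabilizer of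
`p`, this is the isotropy representation `ad` of the Lie algebra of the stabilizer.) -/
def adEndomorphisms (M : Set A) (p : A) (s : Submodule ℝ A) :
    Submodule ℝ (tangentSpaceAt M p →ₗ[ℝ] tangentSpaceAt M p) where
  carrier := {F | ∃ X ∈ s, ∀ v, (F v : A) = X * (v : A) - (v : A) * X}
  zero_mem' := ⟨0, s.zero_mem, by simp⟩
  add_mem' := by
    rintro F G ⟨X, hX, hF⟩ ⟨Y, hY, hG⟩
    refine ⟨X + Y, s.add_mem hX hY, fun v => ?_⟩
    simp only [LinearMap.add_apply, Submodule.coe_add, hF, hG]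
    noncomm_ring
  smul_mem' := by
    rintro c F ⟨X, hX, hF⟩
    refine ⟨c • X, s.smul_mem c hX, fun v => ?_⟩
    simp [hF, smul_sub]

end Conjugation

/-! ## Quaternionic projective space `ℍPⁿ = Sp(n+1)/(Sp(1) × Sp(n))` -/

/-- Quaternionic `(n+1) × (n+1)` matrices, with `star` the conjugate transpose. -/
abbrev HMat (n : ℕ) : Type := Matrix (Fin (n + 1)) (Fin (n + 1)) ℍ[ℝ]

instance hMat_continuousStar (n : ℕ) :
    @ContinuousStar (HMat n) (PseudoMetricSpace.toUniformSpace.toTopologicalSpace) _ :=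
  ⟨continuous_id.matrix_conjTranspose⟩

/-- `Sp(n+1)`. -/
abbrev SpGroup (n : ℕ) : Type := unitary (HMat n)

/-- `Sp(n+1)/ℤ₂`. -/
abbrev SpGroupMod (n : ℕ) : Type := SpGroup n ⧸ signSubgroup (HMat n)

/-- The quaternionic line `vₖ = [0 : ⋯ : 1 : ⋯ : 0]`, as the orthogonal projection onto it. -/
def hpPoint (n : ℕ) (k : Fin (n + 1)) : HMat n := Matrix.single k k 1

/-- `ℍPⁿ`, as the space of orthogonal projections onto quaternionic lines in `ℍⁿ⁺¹`: the orbit of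
`v₀` under `Sp(n+1)`, with stabilizer the block diagonal subgroup `Sp(1) × Sp(n)`. -/
def HP (n : ℕ) : Set (HMat n) := unitaryOrbit (hpPoint n 0)

/-- The standard diagonal maximal torus of `Sp(n+1)`. -/
def spDiagonalTorus (n : ℕ) : Set (SpGroup n) :=
  {g | ∃ θ : Fin (n + 1) → Circle,
    (g : HMat n) = Matrix.diagonal fun i => ((θ i : ℂ) : ℍ[ℝ])}

/-- The action on `ℍPⁿ` given by a homomorphism `T → Sp(n+1)/ℤ₂`. -/
def hpAction {r n : ℕ} (φ : Torus r →ₜ* SpGroupMod n) : TorusAction r (HMat n) :=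
  unitaryOrbitActionMod (hpPoint n 0) φ

/-- The ideal `𝔰𝔭(1)` of the isotropy algebra `𝔰𝔭(1) ⊕ 𝔰𝔭(n)` at the quaternionic line with
projection `p`: the skew-Hermitian matrices that map this line to itself and vanish on its
orthogonal complement. -/
def hpSp1 (n : ℕ) (p : HMat n) : Submodule ℝ (HMat n) where
  carrier := {X | star X = -X ∧ p * X * p = X}
  zero_mem' := by simp
  add_mem' := by
    rintro X Y ⟨h1, h2⟩ ⟨h3, h4⟩
    exact ⟨by rw [star_add, h1, h3, neg_add], by rw [mul_add, add_mul, h2, h4]⟩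
  smul_mem' := by
    rintro c X ⟨h1, h2⟩
    refine ⟨?_, ?_⟩
    · have h := fun i j => congrFun (congrFun h1 i) j
      refine Matrix.ext fun i j => ?_
      have := h i j
      simp only [Matrix.star_apply, Matrix.neg_apply, Matrix.smul_apply] at this ⊢
      rw [Quaternion.star_smul, this, smul_neg]
    · rw [mul_smul_comm, smul_mul_assoc, h2]

/-- `± m` is the weight of the induced representation of `T` on the fibre at `vₖ` of the
quaternion-Kähler structure `Q ⊆ End (T ℍPⁿ)`, that is, of the equivariant subbundle which at the
origin is `{ad X | X ∈ 𝔰𝔭(1)}`. -/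
def IsHPQuatWeight {r n : ℕ} (φ : Torus r →ₜ* SpGroupMod n) (k : Fin (n + 1))
    (m : Fin r → ℤ) : Prop :=
  (hpAction φ).IsQuatWeight (hpPoint n k)
    (adEndomorphisms (hpAction φ).carrier (hpPoint n k) (hpSp1 n (hpPoint n k))) m

/-- The edges of the graph of `ℍPⁿ`: a biangle between `v₀` and `vₖ`, `k = 1, …, n`, and a biangle
between `vₖ` and `vₗ`, `1 ≤ k < l ≤ n`.  The index `k ≥ 1` is written `k.succ` with
`k : Fin n`, and the Boolean distinguishes the two edges of a biangle. -/
inductive HPEdge (n : ℕ) : Type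
  | zero (k : Fin n) (b : Bool) : HPEdge n
  | succ (k l : Fin n) (h : k < l) (b : Bool) : HPEdge n

/-- The labelled graph of `ℍPⁿ` in terms of `λ` (here `lam`) and `α₁, …, αₙ`
(here `α 0, …, α (n-1)`). -/
def hpGraph {r : ℕ} (n : ℕ) (lam : Fin r → ℤ) (α : Fin n → Fin r → ℤ) : LabelledGraph r where
  Vertex := Fin (n + 1)
  Edge := HPEdge n
  ends
    | .zero k _ => s(0, k.succ)
    | .succ k l _ _ => s(k.succ, l.succ)
  label
    | .zero k false => α k
    | .zero k true => lam - α k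
    | .succ k l _ false => α k - α l
    | .succ k l _ true => lam - α k - α l

/-! ## The Grassmannian `Gr₂(ℂᵐ⁺²) = U(m+2)/(U(2) × U(m))` -/

/-- Complex `(m+2) × (m+2)` matrices, with `star` the conjugate transpose. -/
abbrev CMat (m : ℕ) : Type := Matrix (Fin (m + 2)) (Fin (m + 2)) ℂ

instance cMat_continuousStar (m : ℕ) :
    @ContinuousStar (CMat m) (PseudoMetricSpace.toUniformSpace.toTopologicalSpace) _ :=
  ⟨continuous_id.matrix_conjTranspose⟩

/-- `U(m+2)`. -/
abbrev UGroup (m : ℕ) : Type := unitary (CMat m)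

/-- The orthogonal projection onto the coordinate subspace of `ℂᵐ⁺²` spanned by the standard basis
vectors with index in `s`. -/
def coordProjection (m : ℕ) (s : Finset (Fin (m + 2))) : CMat m :=
  Matrix.diagonal fun i => if i ∈ s then 1 else 0

/-- `Gr₂(ℂᵐ⁺²)`, as the space of orthogonal projections onto complex planes: the orbit of `v₁₂`
under `U(m+2)`, with stabilizer `U(2) × U(m)`. -/
def Gr2 (m : ℕ) : Set (CMat m) := unitaryOrbit (coordProjection m {0, 1})

/-- The standard diagonal maximal torus of `U(m+2)`. -/
def uDiagonalTorus (m : ℕ) : Set (UGroup m) :=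
  {g | ∃ θ : Fin (m + 2) → Circle, (g : CMat m) = Matrix.diagonal fun i => (θ i : ℂ)}

/-- The action on `Gr₂(ℂᵐ⁺²)` given by a homomorphism `T → U(m+2)`. -/
def grAction {r m : ℕ} (φ : Torus r →ₜ* UGroup m) : TorusAction r (CMat m) :=
  unitaryOrbitAction (coordProjection m {0, 1}) φ

/-- The ideal `𝔰𝔭(1) = 𝔰𝔲(2)` of the isotropy algebra `𝔲(2) ⊕ 𝔲(m)` at the plane with projection
`p`: the skew-Hermitian matrices of trace zero that map this plane to itself and vanish on its
orthogonal complement. -/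
def grSp1 (m : ℕ) (p : CMat m) : Submodule ℝ (CMat m) where
  carrier := {X | star X = -X ∧ p * X * p = X ∧ X.trace = 0}
  zero_mem' := by simp
  add_mem' := by
    rintro X Y ⟨h1, h2, h3⟩ ⟨h4, h5, h6⟩
    exact ⟨by rw [star_add, h1, h4, neg_add], by rw [mul_add, add_mul, h2, h5],
      by rw [Matrix.trace_add, h3, h6, add_zero]⟩
  smul_mem' := by
    rintro c X ⟨h1, h2, h3⟩
    refine ⟨?_, ?_, ?_⟩
    · rw [star_smul, h1, smul_neg, star_trivial]
    · rw [mul_smul_comm, smul_mul_assoc, h2]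
    · rw [Matrix.trace_smul, h3, smul_zero]

/-- The vertices `vᵢⱼ = vⱼᵢ`, as two-element sets `{i, j}` of indices.  The indices `1, 2` of the
usual notation are `0, 1 : Fin (m + 2)`, and the indices `k = 3, …, m+2` are `k.succ.succ` with
`k : Fin m`. -/
abbrev GrVertex (m : ℕ) : Type := {s : Finset (Fin (m + 2)) // s.card = 2}

/-- `vᵢⱼ`. -/
def grVertex {m : ℕ} (i j : Fin (m + 2)) (h : i ≠ j) : GrVertex m := ⟨{i, j}, Finset.card_pair h⟩

/-- `v₁₂`. -/
def v12 (m : ℕ) : GrVertex m := grVertex 0 1 (by simp)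

/-- `v₁ₖ`, `k ≥ 3`. -/
def v1 {m : ℕ} (k : Fin m) : GrVertex m := grVertex 0 k.succ.succ (Fin.succ_ne_zero _).symm

/-- `v₂ₖ`, `k ≥ 3`. -/
def v2 {m : ℕ} (k : Fin m) : GrVertex m :=
  grVertex 1 k.succ.succ fun h =>
    Fin.succ_ne_zero k (Fin.succ_injective _ (show (0 : Fin (m + 1)).succ = _ from h)).symm

/-- `vₖₗ`, `k, l ≥ 3`, `k ≠ l`. -/
def vv {m : ℕ} (k l : Fin m) (h : k ≠ l) : GrVertex m :=
  grVertex k.succ.succ l.succ.succ fun e => h (Fin.succ_injective _ (Fin.succ_injective _ e))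

/-- The edges of the graph of `Gr₂(ℂᵐ⁺²)`. -/
inductive GrEdge (m : ℕ) : Type
  /-- the edge between `v₁₂` and `v₁ₖ` -/
  | e12_1 (k : Fin m) : GrEdge m
  /-- the edge between `v₁₂` and `v₂ₖ` -/
  | e12_2 (k : Fin m) : GrEdge m
  /-- the edge between `v₁ₖ` and `v₂ₖ` -/
  | e1_2 (k : Fin m) : GrEdge m
  /-- the edge between `vₖₗ` and `vₖₚ`, with `k` any index and `l < p` different from `k` -/
  | e3 (k : Fin (m + 2)) (l p : Fin m) (h : l < p) (hl : k ≠ l.succ.succ)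
      (hp : k ≠ p.succ.succ) : GrEdge m
  /-- the edge between `v₁ₖ` and `vₖₗ` -/
  | e4_1 (k l : Fin m) (h : k ≠ l) : GrEdge m
  /-- the edge between `v₂ₖ` and `vₖₗ` -/
  | e4_2 (k l : Fin m) (h : k ≠ l) : GrEdge m

/-- The labelled graph of `Gr₂(ℂᵐ⁺²)` in terms of `λ` (here `lam`) and `α₃, …, αₘ₊₂`
(here `α 0, …, α (m-1)`). -/
def grGraph {r : ℕ} (m : ℕ) (lam : Fin r → ℤ) (α : Fin m → Fin r → ℤ) : LabelledGraph r where
  Vertex := GrVertex m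
  Edge := GrEdge m
  ends
    | .e12_1 k => s(v12 m, v1 k)
    | .e12_2 k => s(v12 m, v2 k)
    | .e1_2 k => s(v1 k, v2 k)
    | .e3 k l p _ hl hp => s(grVertex k l.succ.succ hl, grVertex k p.succ.succ hp)
    | .e4_1 k l h => s(v1 k, vv k l h)
    | .e4_2 k l h => s(v2 k, vv k l h)
  label
    | .e12_1 k => α k
    | .e12_2 k => lam - α k
    | .e1_2 _ => lam
    | .e3 _ l p _ _ _ => α l - α p
    | .e4_1 _ l _ => lam - α l
    | .e4_2 _ l _ => α l

/-- The fixed point `vᵢⱼ = ℂᵢ ⊕ ℂⱼ`. -/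
def grPoint (m : ℕ) (v : GrVertex m) : CMat m := coordProjection m v.1

/-- `± w` is the weight of the induced representation of `T` on the fibre at `v = vᵢⱼ` of the
quaternion-Kähler structure `Q ⊆ End (T Gr₂(ℂᵐ⁺²))`, that is, of the equivariant subbundle which at
the origin is `{ad X | X ∈ 𝔰𝔭(1)}`. -/
def IsGrQuatWeight {r m : ℕ} (φ : Torus r →ₜ* UGroup m) (v : GrVertex m)
    (w : Fin r → ℤ) : Prop :=
  (grAction φ).IsQuatWeight (grPoint m v)
    (adEndomorphisms (grAction φ).carrier (grPoint m v) (grSp1 m (grPoint m v))) w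

end

/-! Both spaces are conjugation orbits of a projection `p₀` under a compact unitary group, so a
diagonal torus acts linearly on matrices and multiplies each entry by characters. On quaternionic
matrices `diag(θ₀, …, θₙ)` sends an entry `q` at `(i, j)` to `θᵢ q θⱼ⁻¹`. Writing `q = z + w j` and
using `j z = z̄ j`, the two halves have characters `θᵢθⱼ⁻¹` and `θᵢθⱼ`; these are the two edges of a
biangle. If `λ` is the weight of `θ₀²` and `αₖ` that of `θ₀θₖ⁻¹`, all labels and the quaternionic
weights (those of `θₖ²`) become the stated expressions. On complex matrices the characters are
`θᵢθⱼ⁻¹`, and normalizing the second weight to zero gives the weights `λ, 0, α₃, …, αₙ`. A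
quaternionic weight is unique up to sign (`IsQuatWeight.eq_or_eq_neg`), and replacing `(λ, α)` by
`(-λ, -α)` only changes signs of labels, so both choices of `λ` are covered.

The passage between weights and the GKM graph is axiomatized by `EdgeSpheres`: for every edge an
explicit round sphere through two fixed points, with an equivariant linear complex coordinate. A
point with two nonzero coordinates of independent weights has an orbit of dimension at least two.
Hence, if the labels at each vertex are independent, an elementary matrix computation puts every
point of the one-skeleton on one of the spheres; the components off the fixed points are exactly the
spheres without poles (`EdgeSpheres.hasGKMGraph`). Conversely every weight plane at a vertex is
tangent to one of the spheres (`EdgeSpheres.exists_edge_of_isWeightPlane`), so independence of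
labels at vertices gives the independence required of a GKM action.

For the realization one writes down the `θᵢ`. In the symplectic case `θ₀` is a square root of the
character `λ`, which is multiplicative only up to a common sign; this is why the target is the
quotient by `±1`. Orientability and the vanishing of odd Betti numbers then have to be proved for
the two orbits. The tangent space at `p₀` is `(1 - p₀)Ap₀`, on which the stabilizer acts by `x ↦
g⋆xg`; left and right multiplication each commute with a complex structure, so the determinant is
nonnegative and an invariant volume form exists. For cohomology, let `H` be the group of elements
under which every closed form changes only by an exact form. It contains all exponentials, hence is
open. A closed form differs from its average over `H` by an exact form, by the homotopy formula on
finitely many charts of `H`. The geodesic symmetry at each point is an exponential, so it lies in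
`H`; it acts by `-1` on the tangent space, and therefore the average of a form of odd degree is zero
(`oddBettiNumbersVanish_unitaryOrbit`). -/

noncomputable section

/-! ### Characters of the torus and integral weights -/

section Characters

variable {r : ℕ}

theorem weightChar_one (m : Fin r → ℤ) : weightChar m 1 = 1 := by simp [weightChar]

theorem weightChar_mul (m : Fin r → ℤ) (s t : Torus r) :
    weightChar m (s * t) = weightChar m s * weightChar m t := by
  simp [weightChar, mul_zpow, Finset.prod_mul_distrib]

theorem weightChar_add (m n : Fin r → ℤ) (t : Torus r) :
    weightChar (m + n) t = weightChar m t * weightChar n t := by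
  simp [weightChar, zpow_add, Finset.prod_mul_distrib]

theorem weightChar_neg (m : Fin r → ℤ) (t : Torus r) :
    weightChar (-m) t = (weightChar m t)⁻¹ := by
  simp [weightChar]

theorem weightChar_sub (m n : Fin r → ℤ) (t : Torus r) :
    weightChar (m - n) t = weightChar m t * (weightChar n t)⁻¹ := by
  rw [sub_eq_add_neg, weightChar_add, weightChar_neg]

theorem continuous_weightChar (m : Fin r → ℤ) : Continuous (weightChar m) :=
  continuous_finsetProd _ fun i _ => (continuous_apply i).zpow (m i)

/-- The pairing of an integral weight with an element of the Lie algebra. -/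
def weightPairing (m : Fin r → ℤ) (X : Fin r → ℝ) : ℝ := ∑ i, m i * X i

theorem weightChar_exp (m : Fin r → ℤ) (X : Fin r → ℝ) :
    weightChar m (fun i => Circle.exp (X i)) = Circle.exp (weightPairing m X) := by
  rw [weightPairing, weightChar]
  have : ∀ s : Finset (Fin r), Circle.exp (∑ i ∈ s, m i * X i) =
      ∏ i ∈ s, Circle.exp (X i) ^ m i := by
    classical
    intro s
    induction s using Finset.induction_on with
    | empty => simp
    | insert a s ha ih =>
      rw [Finset.sum_insert ha, Finset.prod_insert ha, Circle.exp_add, ih, Circle.exp_intCast_mul]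
  exact (this _).symm

theorem weightPairing_smul (m : Fin r → ℤ) (s : ℝ) (X : Fin r → ℝ) :
    weightPairing m (fun i => s * X i) = s * weightPairing m X := by
  simp only [weightPairing, Finset.mul_sum]
  exact Finset.sum_congr rfl fun i _ => by ring

theorem weightPairing_add (m : Fin r → ℤ) (X Y : Fin r → ℝ) :
    weightPairing m (X + Y) = weightPairing m X + weightPairing m Y := by
  simp [weightPairing, mul_add, Finset.sum_add_distrib]

theorem weightPairing_single (m : Fin r → ℤ) (i : Fin r) (a : ℝ) :
    weightPairing m (Pi.single i a) = m i * a := by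
  rw [weightPairing, Finset.sum_eq_single i] <;> simp +contextual

theorem exists_exp_eq (t : Torus r) : ∃ X : Fin r → ℝ, t = fun i => Circle.exp (X i) :=
  ⟨fun i => Complex.arg (t i), by ext1 i; simp⟩

/-- Every continuous character of a torus is given by an integral weight. -/
theorem exists_weightChar_eq {f : Torus r → Circle} (hc : Continuous f)
    (hm : ∀ s t, f (s * t) = f s * f t) : ∃ m : Fin r → ℤ, ∀ t, f t = weightChar m t := by
  let e : (Fin r → ℝ) → Torus r := fun X i => Circle.exp (X i)
  have he : Continuous e := continuous_pi fun i => Circle.exp.continuous.comp (continuous_apply i)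
  have he_add : ∀ X Y, e (X + Y) = e X * e Y := fun X Y => by
    ext1 i; simp [e, Circle.exp_add]
  have hf1 : f 1 = 1 := by
    have := hm 1 1
    simpa using this
  have he0 : e 0 = 1 := by ext1 i; simp [e]
  let φ : C(Fin r → ℝ, Circle) := ⟨fun X => f (e X), hc.comp he⟩
  have h0 : Circle.exp 0 = φ 0 := by
    change _ = f (e 0)
    rw [he0, hf1, Circle.exp_zero]
  -- The character, pulled back to the simply connected Lie algebra, lifts through the covering `ℝ →
  -- S¹`.
  obtain ⟨F, ⟨hF0, hF⟩, huniq⟩ := Circle.isCoveringMap_exp.existsUnique_continuousMap_lifts φ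
    (a₀ := 0) (e₀ := 0) h0
  have hF' : ∀ X, Circle.exp (F X) = f (e X) := fun X => congrFun hF X
  have hadd : ∀ X Y, F (X + Y) = F X + F Y := by
    intro X Y
    -- A second lift with the same value at `0`; uniqueness of lifts makes `F` additive, hence
    -- linear.
    let G : C(Fin r → ℝ, ℝ) := ⟨fun X => F (X + Y) - F Y, by fun_prop⟩
    have hG : G = F := by
      refine huniq G ⟨by simp [G], ?_⟩
      ext1 X
      change Circle.exp (F (X + Y) - F Y) = f (e X)
      rw [Circle.exp_sub, hF', hF', he_add, hm, mul_div_cancel_right]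
    have : F (X + Y) - F Y = F X := congrArg (fun K : C(Fin r → ℝ, ℝ) => K X) hG
    linarith
  let Fl : (Fin r → ℝ) →L[ℝ] ℝ :=
    (AddMonoidHom.mk' (fun X => F X) hadd).toRealLinearMap F.continuous
  have hFl : ∀ X, F X = ∑ i, X i * F (Pi.single i 1) := by
    intro X
    have : Fl X = ∑ i, X i • Fl (Pi.single i 1) := by
      conv_lhs => rw [pi_eq_sum_univ' X]
      simp only [map_sum, map_smul]
    exact this
  have hint : ∀ i, ∃ m : ℤ, F (Pi.single i 1) = m := by
    intro i
    -- The `i`-th period maps to the identity of the torus, so `F` takes a multiple of `2π` there;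
    -- this is the integrality of the weight.
    have h1 : Circle.exp (F (Pi.single i (2 * Real.pi))) = 1 := by
      rw [hF', ← hf1]
      congr 1
      ext1 j
      by_cases h : j = i
      · subst h; simp [e]
      · simp [e, h]
    obtain ⟨m, hm'⟩ := Circle.exp_eq_one.1 h1
    refine ⟨m, ?_⟩
    rw [hFl, Finset.sum_eq_single i] at hm'
    · simp only [Pi.single_eq_same] at hm'
      have := Real.pi_pos
      field_simp at hm'
      linarith
    · intro j _ hj; simp [hj]
    · simp
  choose m hm' using hint
  refine ⟨m, fun t => ?_⟩
  obtain ⟨X, rfl⟩ := exists_exp_eq t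
  rw [weightChar_exp, weightPairing]
  change f (e X) = _
  rw [← hF', hFl]
  simp only [hm', mul_comm]

theorem exists_weightPairing_ne_zero {m : Fin r → ℤ} (hm : m ≠ 0) :
    ∃ X : Fin r → ℝ, weightPairing m X = 1 := by
  obtain ⟨i, hi⟩ := Function.ne_iff.1 hm
  have hi' : (m i : ℝ) ≠ 0 := by exact_mod_cast hi
  exact ⟨Pi.single i (m i : ℝ)⁻¹, by rw [weightPairing_single, mul_inv_cancel₀ hi']⟩

/-- Cramer's rule on two coordinates where the `2 × 2` minor of the pair does not vanish. -/
theorem exists_weightPairing_of_linearIndependent {m n : Fin r → ℤ}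
    (h : LinearIndependent ℤ ![m, n]) :
    ∃ X : Fin r → ℝ, weightPairing m X = 1 ∧ weightPairing n X = 0 := by
  have hm : m ≠ 0 := h.ne_zero 0
  obtain ⟨i, hi⟩ := Function.ne_iff.1 hm
  rw [Pi.zero_apply] at hi
  -- If all minors with column `i` vanished, `-nᵢ m + mᵢ n = 0` would be a nontrivial relation.
  obtain ⟨j, hj⟩ : ∃ j, m i * n j - m j * n i ≠ 0 := by
    by_contra! hall
    have h1 := LinearIndependent.pair_iff.1 h (-n i) (m i) (by
      ext j
      have := hall j
      simp only [Pi.add_apply, Pi.smul_apply, smul_eq_mul, Pi.zero_apply]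
      linarith)
    exact hi h1.2
  have hj' : (m i * n j - m j * n i : ℝ) ≠ 0 := by exact_mod_cast hj
  refine ⟨Pi.single i (n j / (m i * n j - m j * n i : ℝ)) +
    Pi.single j (-n i / (m i * n j - m j * n i : ℝ)), ?_, ?_⟩
  · rw [weightPairing_add, weightPairing_single, weightPairing_single]
    field_simp
    ring
  · rw [weightPairing_add, weightPairing_single, weightPairing_single]
    field_simp
    ring

theorem linearIndependent_pair_neg_left {m n : Fin r → ℤ} (h : LinearIndependent ℤ ![m, n]) :
    LinearIndependent ℤ ![-m, n] := by
  rw [LinearIndependent.pair_iff] at h ⊢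
  intro s t hst
  have := h (-s) t (by simpa using hst)
  simpa using this

theorem linearIndependent_pair_symm {m n : Fin r → ℤ} (h : LinearIndependent ℤ ![m, n]) :
    LinearIndependent ℤ ![n, m] :=
  LinearIndependent.pair_symm_iff.1 h

/-- The real part of a character determines the weight up to sign. -/
theorem eq_or_eq_neg_of_weightChar_re_eq {m n : Fin r → ℤ}
    (h : ∀ t : Torus r, (weightChar m t : ℂ).re = (weightChar n t : ℂ).re) : m = n ∨ m = -n := by
  have hcos : ∀ (X : Fin r → ℝ) (s : ℝ),
      Real.cos (s * weightPairing m X) = Real.cos (s * weightPairing n X) := by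
    intro X s
    have := h fun i => Circle.exp (s * X i)
    rw [weightChar_exp, weightChar_exp, weightPairing_smul, weightPairing_smul,
      Circle.coe_exp, Circle.coe_exp, Complex.exp_ofReal_mul_I_re,
      Complex.exp_ofReal_mul_I_re] at this
    exact this
  have hsq : ∀ X : Fin r → ℝ, weightPairing m X ^ 2 = weightPairing n X ^ 2 := by
    intro X
    -- The second derivative at `0` of `cos (s a)` recovers `a²`, so both weights have the same
    -- square as functions on the Lie algebra.
    have hd : ∀ a : ℝ, deriv (deriv fun s : ℝ => Real.cos (s * a)) 0 = -a ^ 2 := by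
      intro a
      have h1 : (deriv fun s : ℝ => Real.cos (s * a)) = fun s => -Real.sin (s * a) * a := by
        ext s
        exact ((Real.hasDerivAt_cos _).comp s (hasDerivAt_mul_const a)).deriv
      rw [h1]
      have h2 : HasDerivAt (fun s : ℝ => -Real.sin (s * a) * a)
          (-(Real.cos (0 * a) * a) * a) 0 :=
        (((Real.hasDerivAt_sin _).comp 0 (hasDerivAt_mul_const a)).neg).mul_const a
      rw [h2.deriv]; simp; ring
    have h1 := hd (weightPairing m X)
    have h2 := hd (weightPairing n X)
    have h3 : (fun s : ℝ => Real.cos (s * weightPairing m X)) =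
        fun s => Real.cos (s * weightPairing n X) := funext (hcos X)
    rw [h3, h2] at h1
    linarith
  -- Polarization of the equality of squares.
  have hmul : ∀ i j, m i * m j = n i * n j := by
    intro i j
    have h1 := hsq (Pi.single i 1)
    have h2 := hsq (Pi.single j 1)
    have h3 := hsq (Pi.single i 1 + Pi.single j 1)
    simp only [weightPairing_add, weightPairing_single, mul_one] at h1 h2 h3
    have h4 : (m i * m j : ℝ) = n i * n j := by nlinarith
    exact_mod_cast h4
  by_cases hn : n = 0
  · left
    ext i
    have := hmul i i
    simpa [hn] using this
  · obtain ⟨i, hi⟩ := Function.ne_iff.1 hn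
    rw [Pi.zero_apply] at hi
    have h1 : (m i - n i) * (m i + n i) = 0 := by linarith [hmul i i]
    rcases mul_eq_zero.1 h1 with h2 | h2
    · left
      have h2 : m i = n i := by linarith
      ext j
      have := hmul i j
      rw [h2] at this
      exact mul_left_cancel₀ hi this
    · right
      have h2 : m i = -n i := by linarith
      ext j
      have := hmul i j
      rw [h2] at this
      refine mul_left_cancel₀ hi ?_
      simp only [Pi.neg_apply]
      linarith

end Characters

end

noncomputable section

/-! ### Weight planes and uniqueness of weights up to sign -/

section WeightPlanes

variable {r : ℕ}

theorem weightChar_neg_re (m : Fin r → ℤ) (t : Torus r) :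
    (weightChar (-m) t : ℂ).re = (weightChar m t : ℂ).re := by
  rw [weightChar_neg, Circle.coe_inv_eq_conj, Complex.conj_re]

theorem weightChar_neg_im (m : Fin r → ℤ) (t : Torus r) :
    (weightChar (-m) t : ℂ).im = -(weightChar m t : ℂ).im := by
  rw [weightChar_neg, Circle.coe_inv_eq_conj, Complex.conj_im]

theorem weightChar_inv (m : Fin r → ℤ) (t : Torus r) :
    weightChar m t⁻¹ = (weightChar m t)⁻¹ := by simp [weightChar]

variable {W : Type*} [AddCommGroup W] [Module ℝ W] {σ : Representation ℝ (Torus r) W}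
  {m n : Fin r → ℤ} {L L' : Submodule ℝ W}

theorem IsWeightPlane.neg (h : IsWeightPlane σ m L) : IsWeightPlane σ (-m) L := by
  obtain ⟨u, w, hi, hs, hσ⟩ := h
  refine ⟨w, u, LinearIndependent.pair_symm_iff.1 hi, by rw [Set.pair_comm, hs], fun t => ?_⟩
  rw [weightChar_neg_re, weightChar_neg_im, neg_neg, (hσ t).1, (hσ t).2]
  exact ⟨add_comm _ _, add_comm _ _⟩

theorem IsWeightPlane.finrank_eq (h : IsWeightPlane σ m L) : Module.finrank ℝ L = 2 := by
  obtain ⟨u, w, hi, hs, -⟩ := h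
  rw [← hs, ← Matrix.range_cons_cons_empty u w ![], finrank_span_eq_card hi]
  simp

/-- A rotation plus its inverse is a scalar. This detects the weight, up to sign, on a single
nonzero vector without reference to a basis. -/
theorem IsWeightPlane.apply_add_apply_inv (h : IsWeightPlane σ m L) (t : Torus r) {x : W}
    (hx : x ∈ L) : σ t x + σ t⁻¹ x = (2 * (weightChar m t : ℂ).re) • x := by
  obtain ⟨u, w, hi, hs, hσ⟩ := h
  have hre : (weightChar m t⁻¹ : ℂ).re = (weightChar m t : ℂ).re := by
    rw [weightChar_inv, Circle.coe_inv_eq_conj, Complex.conj_re]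
  have him : (weightChar m t⁻¹ : ℂ).im = -(weightChar m t : ℂ).im := by
    rw [weightChar_inv, Circle.coe_inv_eq_conj, Complex.conj_im]
  rw [← hs, Submodule.mem_span_pair] at hx
  obtain ⟨a, b, rfl⟩ := hx
  simp only [map_add, map_smul, (hσ t).1, (hσ t).2, (hσ t⁻¹).1, (hσ t⁻¹).2, hre, him]
  module

/-- The decomposition of a representation into fixed vectors, forming a line, and a weight plane
determines the weight up to sign. -/
theorem weight_eq_or_eq_neg_of_line_sup_plane {Q₀ P₀ : Submodule ℝ W} (hL : IsWeightPlane σ m L)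
    (hL' : IsWeightPlane σ n L') (hsup : Q₀ ⊔ L = P₀ ⊔ L') (hdis : Disjoint P₀ L')
    (hdim : Module.finrank ℝ P₀ = 1) (hfix : ∀ t, ∀ x ∈ P₀, σ t x = x) : m = n ∨ m = -n := by
  -- A plane does not fit into the line `P₀`, so some `x = a + b` has a nonzero component `b` in
  -- `L'`.
  obtain ⟨x, hxL, hxP⟩ : ∃ x ∈ L, x ∉ P₀ := by
    by_contra! hall
    have hfin : FiniteDimensional ℝ P₀ := FiniteDimensional.of_finrank_pos (by omega)
    have := Submodule.finrank_mono (R := ℝ) (M := W) (s := L) (t := P₀) hall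
    rw [hL.finrank_eq, hdim] at this
    omega
  have hx : x ∈ P₀ ⊔ L' := hsup ▸ Submodule.mem_sup_right hxL
  obtain ⟨a, ha, b, hb, rfl⟩ := Submodule.mem_sup.1 hx
  have hb0 : b ≠ 0 := by
    rintro rfl
    exact hxP (by simpa using ha)
  refine eq_or_eq_neg_of_weightChar_re_eq fun t => ?_
  have h1 := hL.apply_add_apply_inv t hxL
  have h2 := hL'.apply_add_apply_inv t hb
  set p := (weightChar m t : ℂ).re
  set q := (weightChar n t : ℂ).re
  rw [map_add, map_add, hfix t a ha, hfix t⁻¹ a ha] at h1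
  -- The operator `σ t + σ t⁻¹` is `2p` on `x`, `2` on `a` and `2q` on `b`; comparing leaves a
  -- vector in `P₀ ∩ L' = 0`.
  have h3 : (2 * (p - q)) • b = (2 * (1 - p)) • a := by
    have : σ t b + σ t⁻¹ b = (2 * p) • (a + b) - (2 : ℝ) • a := by rw [← h1]; module
    rw [h2] at this
    calc (2 * (p - q)) • b = (2 * p) • b - (2 * q) • b := by module
      _ = (2 * (1 - p)) • a := by rw [this]; module
  have h4 : (2 * (p - q)) • b = 0 := by
    have hmem : (2 * (p - q)) • b ∈ P₀ := h3 ▸ P₀.smul_mem _ ha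
    have := Submodule.disjoint_def.1 hdis _ hmem (L'.smul_mem _ hb)
    exact this
  rcases smul_eq_zero.1 h4 with h5 | h5
  · linarith
  · exact absurd h5 hb0

namespace TorusAction

variable {V : Type*} [NormedAddCommGroup V] [NormedSpace ℝ V] {𝒜 : TorusAction r V} {p : V}
  {Q : Submodule ℝ (tangentSpaceAt 𝒜.carrier p →ₗ[ℝ] tangentSpaceAt 𝒜.carrier p)}

theorem IsQuatWeight.neg (h : 𝒜.IsQuatWeight p Q m) : 𝒜.IsQuatWeight p Q (-m) := by
  obtain ⟨hp, Q₀, Q', h1, h2, h3, h4, h5⟩ := h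
  exact ⟨hp, Q₀, Q', h1, h2, h3, h4, h5.neg⟩

/-- Both decompositions have the same sum `Q`, and a weight plane cannot lie in the trivial line of
the other one. This is what allows an arbitrary given `λ` to be compared with the one read off from
the action. -/
theorem IsQuatWeight.eq_or_eq_neg (h : 𝒜.IsQuatWeight p Q m) (h' : 𝒜.IsQuatWeight p Q n) :
    m = n ∨ m = -n := by
  obtain ⟨hp, Q₀, Q', h1, h2, h3, h4, h5⟩ := h
  obtain ⟨_, P₀, P', g1, g2, g3, g4, g5⟩ := h'
  exact weight_eq_or_eq_neg_of_line_sup_plane h5 g5 (h1.trans g1.symm) g2 g3 g4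

/-- The labels of the GKM graph are determined up to sign only. -/
theorem HasGKMGraph.congr_label {Γ : LabelledGraph r} {v : Γ.Vertex → V} (h : 𝒜.HasGKMGraph Γ v)
    (lab : Γ.Edge → Fin r → ℤ) (hlab : ∀ e, lab e = Γ.label e ∨ lab e = -Γ.label e) :
    𝒜.HasGKMGraph { Γ with label := lab } v := by
  obtain ⟨h1, h2, c, hc⟩ := h
  refine ⟨h1, h2, c, fun e => ⟨(hc e).1, (hc e).2.1, fun p hp hpe => ⟨((hc e).2.2 p hp hpe).1, ?_⟩⟩⟩
  have := ((hc e).2.2 p hp hpe).2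
  rcases hlab e with he | he
  · change IsWeightPlane _ (lab e) _
    rwa [he]
  · change IsWeightPlane _ (lab e) _
    rw [he]
    exact this.neg

end TorusAction

end WeightPlanes

end

noncomputable section

/-! ### Round spheres in a vector space and their tangent planes at the poles -/

section Spheres

variable {r : ℕ} {V : Type*} [NormedAddCommGroup V] [NormedSpace ℝ V]

/-- A point of the sphere with poles `a` and `b` and equatorial plane given by `Z`. -/
def spherePoint (a b : V) (Z : ℂ →ₗ[ℝ] V) (s : ℝ) (z : ℂ) : V :=
  (1 / 2 : ℝ) • (a + b) + (s / 2) • (a - b) + Z z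

theorem spherePoint_one (a b : V) (Z : ℂ →ₗ[ℝ] V) : spherePoint a b Z 1 0 = a := by
  simp only [spherePoint, map_zero]; module

theorem spherePoint_neg_one (a b : V) (Z : ℂ →ₗ[ℝ] V) : spherePoint a b Z (-1) 0 = b := by
  simp only [spherePoint, map_zero]; module

theorem spherePoint_swap (a b : V) (Z : ℂ →ₗ[ℝ] V) (s : ℝ) (z : ℂ) :
    spherePoint b a Z s z = spherePoint a b Z (-s) z := by
  simp only [spherePoint]; module

/-- The sphere with poles `a` and `b` and equatorial plane given by `Z`. -/
def sphereSet (a b : V) (Z : ℂ →ₗ[ℝ] V) : Set V :=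
  {y | ∃ (s : ℝ) (z : ℂ), s ^ 2 + Complex.normSq z = 1 ∧ y = spherePoint a b Z s z}

theorem sphereSet_swap (a b : V) (Z : ℂ →ₗ[ℝ] V) : sphereSet b a Z = sphereSet a b Z := by
  ext y
  constructor
  · rintro ⟨s, z, h, rfl⟩
    exact ⟨-s, z, by rw [neg_sq, h], spherePoint_swap a b Z s z⟩
  · rintro ⟨s, z, h, rfl⟩
    exact ⟨-s, z, by rw [neg_sq, h], spherePoint_swap b a Z s z⟩

theorem continuous_spherePoint (a b : V) (Z : ℂ →ₗ[ℝ] V) :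
    Continuous fun q : ℝ × ℂ => spherePoint a b Z q.1 q.2 := by
  have := Z.continuous_of_finiteDimensional
  unfold spherePoint
  fun_prop

variable {a b : V} {Z : ℂ →ₗ[ℝ] V} {π : V →ₗ[ℝ] ℂ}

/-- The linear map `π` kills the poles and inverts `Z`, so it is the equatorial coordinate on the
whole sphere. All later separation arguments use it. -/
theorem proj_spherePoint (hZ : ∀ z, π (Z z) = z) (ha : π a = 0) (hb : π b = 0) (s : ℝ) (z : ℂ) :
    π (spherePoint a b Z s z) = z := by
  simp [spherePoint, ha, hb, hZ]

theorem spherePoint_injective (hab : a ≠ b) (hZ : ∀ z, π (Z z) = z) (ha : π a = 0) (hb : π b = 0)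
    {s s' : ℝ} {z z' : ℂ} (h : spherePoint a b Z s z = spherePoint a b Z s' z') :
    s = s' ∧ z = z' := by
  have hz : z = z' := by
    rw [← proj_spherePoint hZ ha hb s z, h, proj_spherePoint hZ ha hb]
  subst hz
  refine ⟨?_, rfl⟩
  have h1 : ((s - s') / 2) • (a - b) = 0 := by
    have : spherePoint a b Z s z - spherePoint a b Z s' z = 0 := sub_eq_zero.2 h
    rw [← this, spherePoint, spherePoint]; module
  rcases smul_eq_zero.1 h1 with h2 | h2
  · linarith
  · exact absurd (sub_eq_zero.1 h2) hab

theorem sphereSet_homeomorph (hab : a ≠ b) (hZ : ∀ z, π (Z z) = z) (ha : π a = 0)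
    (hb : π b = 0) :
    Nonempty (sphereSet a b Z ≃ₜ Metric.sphere (0 : EuclideanSpace ℝ (Fin 3)) 1) := by
  let z : EuclideanSpace ℝ (Fin 3) → ℂ := fun y => ⟨y 1, y 2⟩
  have hnorm : ∀ y : EuclideanSpace ℝ (Fin 3),
      y ∈ Metric.sphere (0 : EuclideanSpace ℝ (Fin 3)) 1 ↔ y 0 ^ 2 + Complex.normSq (z y) = 1 := by
    intro y
    rw [mem_sphere_zero_iff_norm, ← sq_eq_sq₀ (norm_nonneg _) zero_le_one,
      EuclideanSpace.real_norm_sq_eq, Fin.sum_univ_three, Complex.normSq_apply]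
    simp only [z, one_pow]
    constructor <;> intro h <;> linarith
  have hz : Continuous z := by
    have : z = fun y => ((y 1 : ℝ) : ℂ) + ((y 2 : ℝ) : ℂ) * Complex.I := by
      ext y; exact Complex.mk_eq_add_mul_I _ _
    rw [this]; fun_prop
  let f : Metric.sphere (0 : EuclideanSpace ℝ (Fin 3)) 1 → sphereSet a b Z := fun y =>
    ⟨spherePoint a b Z ((y : EuclideanSpace ℝ (Fin 3)) 0) (z y), _, _, (hnorm y).1 y.2, rfl⟩
  have hf : Continuous f := by
    refine Continuous.subtype_mk ?_ _
    have h2 : Continuous fun y : Metric.sphere (0 : EuclideanSpace ℝ (Fin 3)) 1 =>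
        (((y : EuclideanSpace ℝ (Fin 3)) 0 : ℝ), z y) :=
      (by fun_prop : Continuous fun y : Metric.sphere (0 : EuclideanSpace ℝ (Fin 3)) 1 =>
        ((y : EuclideanSpace ℝ (Fin 3)) 0 : ℝ)).prodMk (hz.comp continuous_subtype_val)
    exact (continuous_spherePoint a b Z).comp h2
  have hbij : Function.Bijective f := by
    constructor
    · intro x y hxy
      obtain ⟨h0, h1⟩ := spherePoint_injective hab hZ ha hb (Subtype.ext_iff.1 hxy)
      simp only [z, Complex.mk.injEq] at h1
      ext i
      fin_cases i
      · exact h0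
      · exact h1.1
      · exact h1.2
    · rintro ⟨_, s, w, hs, rfl⟩
      have hw : z !₂[s, w.re, w.im] = w := by simp [z]
      refine ⟨⟨!₂[s, w.re, w.im], (hnorm _).2 ?_⟩, ?_⟩
      · rw [hw]; simpa using hs
      · apply Subtype.ext
        simp only [f, hw]
        simp
  -- A continuous bijection from a compact space to a Hausdorff one.
  exact ⟨(hf.homeoOfEquivCompactToT2 (f := Equiv.ofBijective f hbij)).symm⟩

theorem isCompact_sphereSet : IsCompact (sphereSet a b Z) := by
  have hK : IsCompact {q : ℝ × ℂ | q.1 ^ 2 + Complex.normSq q.2 = 1} := by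
    refine Metric.isCompact_of_isClosed_isBounded ?_ ?_
    · exact isClosed_eq ((continuous_fst.pow 2).add (Complex.continuous_normSq.comp continuous_snd))
        continuous_const
    · refine (Metric.isBounded_closedBall (x := (0 : ℝ × ℂ)) (r := 1)).subset ?_
      rintro ⟨s, z⟩ h
      simp only [Set.mem_ofPred_eq] at h
      rw [mem_closedBall_zero_iff, Prod.norm_def]
      refine max_le ?_ ?_
      · rw [Real.norm_eq_abs, abs_le_one_iff_mul_self_le_one]
        nlinarith [Complex.normSq_nonneg z]
      · rw [Complex.normSq_eq_norm_sq] at h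
        nlinarith [sq_nonneg s, norm_nonneg z]
  convert! hK.image (continuous_spherePoint a b Z) using 1
  ext y
  constructor
  · rintro ⟨s, z, h, rfl⟩; exact ⟨(s, z), h, rfl⟩
  · rintro ⟨⟨s, z⟩, h, rfl⟩; exact ⟨s, z, h, rfl⟩

/-- The sphere without its poles. -/
def openSphereSet (a b : V) (Z : ℂ →ₗ[ℝ] V) : Set V :=
  {y | ∃ (s : ℝ) (z : ℂ), s ^ 2 + Complex.normSq z = 1 ∧ z ≠ 0 ∧ y = spherePoint a b Z s z}

/-- In cylindrical coordinates the sphere without poles is the image of the connected strip `(-1, 1)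
× ℝ`. -/
theorem isPreconnected_openSphereSet : IsPreconnected (openSphereSet a b Z) := by
  have h1 : IsPreconnected (Set.Ioo (-1 : ℝ) 1 ×ˢ (Set.univ : Set ℝ)) :=
    isPreconnected_Ioo.prod isPreconnected_univ
  have h2 : Continuous fun q : ℝ × ℝ =>
      (q.1, ((Real.sqrt (1 - q.1 ^ 2) : ℝ) : ℂ) * Circle.exp q.2) := by fun_prop
  convert! h1.image _ ((continuous_spherePoint a b Z).comp h2).continuousOn using 1
  ext y
  constructor
  · rintro ⟨s, z, h, hz, rfl⟩
    have hpos : 0 < Complex.normSq z := Complex.normSq_pos.2 hz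
    refine ⟨(s, Complex.arg z), ⟨⟨by nlinarith, by nlinarith⟩, trivial⟩, ?_⟩
    have h3 : Real.sqrt (1 - s ^ 2) = ‖z‖ := by
      rw [← h, Complex.normSq_eq_norm_sq, add_sub_cancel_left, Real.sqrt_sq (norm_nonneg z)]
    simp only [Function.comp_apply, h3, Circle.coe_exp, Complex.norm_mul_exp_arg_mul_I]
  · rintro ⟨⟨s, θ⟩, ⟨⟨h3, h4⟩, -⟩, rfl⟩
    simp only at h3 h4
    have h5 : 0 < 1 - s ^ 2 := by nlinarith
    refine ⟨s, _, ?_, ?_, rfl⟩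
    · rw [map_mul, Complex.normSq_ofReal, Real.mul_self_sqrt h5.le, Circle.normSq_coe]
      ring
    · exact mul_ne_zero (by exact_mod_cast (Real.sqrt_pos.2 h5).ne') (Circle.coe_ne_zero _)

theorem openSphereSet_subset : openSphereSet a b Z ⊆ sphereSet a b Z := by
  rintro y ⟨s, z, h, -, rfl⟩
  exact ⟨s, z, h, rfl⟩

/-- Follow a meridian `θ ↦ (cos θ, sin θ)` as `θ` decreases to `0`. -/
theorem pole_mem_closure_openSphereSet : a ∈ closure (openSphereSet a b Z) := by
  have hcont : Continuous fun θ : ℝ => spherePoint a b Z (Real.cos θ) (Real.sin θ : ℂ) := by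
    have h2 : Continuous fun θ : ℝ => (Real.cos θ, ((Real.sin θ : ℝ) : ℂ)) := by fun_prop
    exact (continuous_spherePoint a b Z).comp h2
  have h0 : spherePoint a b Z (Real.cos 0) (Real.sin 0 : ℂ) = a := by
    simp [spherePoint_one]
  have hcl : (0 : ℝ) ∈ closure (Set.Ioo (0 : ℝ) Real.pi) := by
    rw [closure_Ioo Real.pi_pos.ne]
    exact ⟨le_refl _, Real.pi_pos.le⟩
  have := map_mem_closure (t := openSphereSet a b Z) hcont hcl fun θ hθ => ?_
  · rwa [h0] at this
  refine ⟨_, _, ?_, ?_, rfl⟩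
  · rw [Complex.normSq_ofReal, ← sq, Real.cos_sq_add_sin_sq]
  · exact_mod_cast (Real.sin_pos_of_mem_Ioo hθ).ne'

theorem openSphereSet_swap : openSphereSet b a Z = openSphereSet a b Z := by
  ext y
  constructor
  · rintro ⟨s, z, h, hz, rfl⟩
    exact ⟨-s, z, by rw [neg_sq, h], hz, spherePoint_swap a b Z s z⟩
  · rintro ⟨s, z, h, hz, rfl⟩
    exact ⟨-s, z, by rw [neg_sq, h], hz, spherePoint_swap b a Z s z⟩

theorem spherePoint_zero_eq {s : ℝ} (h : s ^ 2 + Complex.normSq 0 = 1) :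
    spherePoint a b Z s 0 = a ∨ spherePoint a b Z s 0 = b := by
  have : s = 1 ∨ s = -1 := sq_eq_one_iff.1 (by simpa using h)
  rcases this with rfl | rfl
  · exact Or.inl (spherePoint_one a b Z)
  · exact Or.inr (spherePoint_neg_one a b Z)

theorem closure_openSphereSet : closure (openSphereSet a b Z) = sphereSet a b Z := by
  refine subset_antisymm (closure_minimal openSphereSet_subset isCompact_sphereSet.isClosed) ?_
  rintro y ⟨s, z, h, rfl⟩
  by_cases hz : z = 0
  · subst hz
    rcases spherePoint_zero_eq (a := a) (b := b) (Z := Z) h with h' | h'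
    · rw [h']; exact pole_mem_closure_openSphereSet
    · rw [h', ← openSphereSet_swap]; exact pole_mem_closure_openSphereSet
  · exact subset_closure ⟨s, z, h, hz, rfl⟩

/-- The tangent plane of the sphere at a pole. -/
theorem tangentSpaceAt_sphereSet_pole [FiniteDimensional ℝ V] (hab : a ≠ b) (hZ : ∀ z, π (Z z) = z) (ha : π a = 0)
    (hb : π b = 0) : tangentSpaceAt (sphereSet a b Z) a = LinearMap.range Z := by
  have hZc := Z.continuous_of_finiteDimensional
  let Zc : ℂ →L[ℝ] V := ⟨Z, hZc⟩
  apply le_antisymm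
  · refine Submodule.span_le.2 ?_
    rintro w ⟨γ, hγ, hM, h0, hd⟩
    choose s z hsz hγe using hM
    have hπ : ∀ τ, π (γ τ) = z τ := fun τ => by rw [hγe τ, proj_spherePoint hZ ha hb]
    -- A functional with value `1` on `a - b` expresses the height `s` linearly through the curve,
    -- so that `s` is differentiable.
    obtain ⟨g, hg⟩ := SeparatingDual.exists_eq_one (R := ℝ) (sub_ne_zero.2 hab)
    let πc : V →L[ℝ] ℂ := LinearMap.toContinuousLinearMap π
    have hs : ∀ τ, s τ = 2 * g (γ τ - (1 / 2 : ℝ) • (a + b) - Zc (πc (γ τ))) := by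
      intro τ
      have : γ τ - (1 / 2 : ℝ) • (a + b) - Zc (πc (γ τ)) = (s τ / 2) • (a - b) := by
        have h1 : Zc (πc (γ τ)) = Z (z τ) := by rw [← hπ τ]; rfl
        rw [h1, hγe τ, spherePoint]; module
      rw [this, map_smul, hg, smul_eq_mul]; ring
    have hs0 : s 0 = 1 ∧ z 0 = 0 := by
      have h1 := (spherePoint_one a b Z).trans (h0.symm.trans (hγe 0))
      have h2 := spherePoint_injective hab hZ ha hb h1
      exact ⟨h2.1.symm, h2.2.symm⟩
    have hds : HasDerivAt s (2 * g (w - Zc (πc w))) 0 := by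
      rw [funext hs]
      have h1 := (hd.sub_const ((1 / 2 : ℝ) • (a + b))).sub
        ((Zc.comp πc).hasFDerivAt.comp_hasDerivAt 0 hd)
      exact (g.hasFDerivAt.comp_hasDerivAt 0 h1).const_mul 2
    -- The height never exceeds `1` and equals `1` at the pole; its derivative vanishes there and
    -- only the equatorial velocity remains.
    have hmax : IsLocalMax s 0 := by
      refine Filter.Eventually.of_forall fun τ => ?_
      rw [hs0.1]
      nlinarith [hsz τ, Complex.normSq_nonneg (z τ)]
    have hgw := hmax.hasDerivAt_eq_zero hds
    have hγs : γ = fun τ => (1 / 2 : ℝ) • (a + b) + (s τ / 2) • (a - b) + Zc (πc (γ τ)) := by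
      ext1 τ
      conv_lhs => rw [hγe τ, spherePoint, ← hπ τ]
      rfl
    have hd2 : HasDerivAt γ (0 + (2 * g (w - Zc (πc w)) / 2) • (a - b) + Zc (πc w)) 0 := by
      rw [hγs]
      refine ((hasDerivAt_const _ _).add ((hds.div_const 2).smul_const _)).add ?_
      exact (Zc.comp πc).hasFDerivAt.comp_hasDerivAt 0 hd
    have := hd.unique hd2
    rw [hgw, zero_div, zero_smul, zero_add, zero_add] at this
    exact ⟨π w, this.symm⟩
  · rintro _ ⟨z, rfl⟩
    by_cases hz : z = 0
    · subst hz; rw [map_zero]; exact Submodule.zero_mem _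
    have hn : ‖z‖ ≠ 0 := norm_ne_zero_iff.2 hz
    suffices h : Z ((‖z‖⁻¹ : ℝ) • z) ∈ tangentSpaceAt (sphereSet a b Z) a by
      have := Submodule.smul_mem _ ‖z‖ h
      rwa [map_smul, smul_smul, mul_inv_cancel₀ hn, one_smul] at this
    set w := (‖z‖⁻¹ : ℝ) • z with hw
    have hw1 : Complex.normSq w = 1 := by
      rw [Complex.normSq_eq_norm_sq, hw, norm_smul, norm_inv, norm_norm, inv_mul_cancel₀ hn,
        one_pow]
    -- The meridian through `w` has velocity `Z w` at the pole.
    refine Submodule.subset_span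
      ⟨fun θ => spherePoint a b Z (Real.cos θ) (Real.sin θ • w), ?_, ?_, ?_, ?_⟩
    · have : (fun θ : ℝ => spherePoint a b Z (Real.cos θ) (Real.sin θ • w)) = fun θ =>
        (1 / 2 : ℝ) • (a + b) + (Real.cos θ / 2) • (a - b) + Real.sin θ • Z w := by
        ext θ; simp [spherePoint, -Complex.real_smul]
      rw [this]
      exact (contDiff_const.add ((Real.contDiff_cos.div_const 2).smul contDiff_const)).add
        (Real.contDiff_sin.smul contDiff_const)
    · intro θ
      refine ⟨_, _, ?_, rfl⟩
      rw [Complex.real_smul, map_mul, hw1, Complex.normSq_ofReal, mul_one, ← sq,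
        Real.cos_sq_add_sin_sq]
    · simp [spherePoint_one]
    · have h1 : HasDerivAt (fun θ : ℝ =>
          (1 / 2 : ℝ) • (a + b) + (Real.cos θ / 2) • (a - b) + Real.sin θ • Z w)
          (0 + (-Real.sin 0 / 2) • (a - b) + Real.cos 0 • Z w) 0 :=
        ((hasDerivAt_const _ _).add (((Real.hasDerivAt_cos 0).div_const 2).smul_const _)).add
          ((Real.hasDerivAt_sin 0).smul_const _)
      convert! h1 using 1
      · ext θ; simp [spherePoint, -Complex.real_smul]
      · simp

end Spheres

end

noncomputable section

/-! ### Differentiability of continuous one-parameter groups -/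

section OneParameterGroups

variable {V : Type*} [NormedAddCommGroup V] [NormedSpace ℝ V] [FiniteDimensional ℝ V]

/-- A continuous one-parameter group of linear maps of a finite-dimensional space is
differentiable. -/
theorem differentiable_of_continuous_oneParameterGroup (F : ℝ → V →L[ℝ] V)
    (hc : ∀ x, Continuous fun s => F s x) (h0 : F 0 = 1) (hadd : ∀ s t, F (s + t) = F s * F t) :
    Differentiable ℝ F := by
  have hF : Continuous F := continuous_clm_apply.2 hc
  let G : ℝ → V →L[ℝ] V := fun τ => ∫ s in (0 : ℝ)..τ, F s
  have hG : ∀ τ, HasDerivAt G (F τ) τ := fun τ =>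
    intervalIntegral.integral_hasDerivAt_right (hF.intervalIntegrable _ _)
      hF.aestronglyMeasurable.stronglyMeasurableAtFilter hF.continuousAt
  -- The means `τ⁻¹ ∫₀^τ F` tend to `F 0 = 1`, and invertible operators form an open set.
  obtain ⟨h, hh⟩ : ∃ h, IsUnit (G h) := by
    have hlim : Filter.Tendsto (fun τ : ℝ => τ⁻¹ • G τ) (nhdsWithin 0 {0}ᶜ) (nhds 1) := by
      have := (hasDerivAt_iff_tendsto_slope.1 (hG 0))
      rw [h0] at this
      refine this.congr fun τ => ?_
      simp [slope_def_module, G]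
    have hu : ∀ᶠ τ in nhdsWithin (0 : ℝ) {0}ᶜ, IsUnit (τ⁻¹ • G τ) :=
      hlim.eventually (Units.isOpen.mem_nhds (isUnit_one))
    obtain ⟨τ, hτ, hτ0⟩ := (hu.and self_mem_nhdsWithin).exists
    refine ⟨τ, ?_⟩
    have hne : τ ≠ 0 := hτ0
    have := (IsUnit.mk0 τ hne)
    have h2 : G τ = (τ • (1 : V →L[ℝ] V)) * (τ⁻¹ • G τ) := by
      rw [smul_mul_smul_comm, mul_inv_cancel₀ hne, one_smul, one_mul]
    rw [h2]
    refine IsUnit.mul ?_ hτ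
    exact ⟨⟨τ • 1, τ⁻¹ • 1, by rw [smul_mul_smul_comm, mul_inv_cancel₀ hne, one_smul, one_mul],
      by rw [smul_mul_smul_comm, inv_mul_cancel₀ hne, one_smul, one_mul]⟩, rfl⟩
  -- Translation of the integral. Dividing by the invertible `G h` expresses `F` through its
  -- differentiable primitive.
  have key : ∀ τ, F τ * G h = G (τ + h) - G τ := by
    intro τ
    have h1 : F τ * G h = ∫ s in (0 : ℝ)..h, F τ * F s :=
      ((ContinuousLinearMap.mul ℝ (V →L[ℝ] V) (F τ)).intervalIntegral_comp_comm
        (hF.intervalIntegrable _ _)).symm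
    rw [h1, intervalIntegral.integral_interval_sub_left (hF.intervalIntegrable _ _)
      (hF.intervalIntegrable _ _)]
    simp_rw [← hadd]
    rw [intervalIntegral.integral_comp_add_left (fun s => F s) τ, add_zero]
  obtain ⟨u, hu⟩ := hh
  have h3 : F = fun τ => (G (τ + h) - G τ) * (↑u⁻¹ : V →L[ℝ] V) := by
    ext1 τ
    rw [← key τ, ← hu, mul_assoc, Units.mul_inv, mul_one]
  rw [h3]
  intro τ
  have hd1 : DifferentiableAt ℝ (fun τ => G (τ + h)) τ :=
    ((hG (τ + h)).comp_add_const τ h).differentiableAt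
  exact (hd1.sub (hG τ).differentiableAt).mul_const _

end OneParameterGroups

/-! ### From invariant spheres to the GKM graph -/

section Graph

variable {r : ℕ} {V : Type*} [NormedAddCommGroup V] [NormedSpace ℝ V]

theorem tangentSpaceAt_mono {M N : Set V} (h : M ⊆ N) (p : V) :
    tangentSpaceAt M p ≤ tangentSpaceAt N p :=
  Submodule.span_mono fun _ ⟨γ, h1, h2, h3⟩ => ⟨γ, h1, fun s => h (h2 s), h3⟩

namespace TorusAction

/-- The representation is only assumed continuous, while `orbitTangent` is spanned by existing
derivatives only; without this it could be too small and the one-skeleton too large. -/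
theorem exists_hasDerivAt_rep_exp [FiniteDimensional ℝ V] (𝒜 : TorusAction r V) (X : Fin r → ℝ)
    (x : V) : ∃ w, HasDerivAt (fun s : ℝ => 𝒜.rep (fun i => Circle.exp (s * X i)) x) w 0 := by
  have h := differentiable_of_continuous_oneParameterGroup
    (fun s : ℝ => 𝒜.rep (fun i => Circle.exp (s * X i))) (fun y => ?_) ?_ ?_ 0
  · exact ⟨_, (h.hasDerivAt.clm_apply (hasDerivAt_const 0 x))⟩
  · refine (𝒜.continuous_rep y).comp (continuous_pi fun i => ?_)
    fun_prop
  · simp only [zero_mul, Circle.exp_zero]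
    exact map_one 𝒜.rep
  · intro s t
    rw [← map_mul]
    congr 1
    ext1 i
    simp only [Pi.mul_apply, add_mul, Circle.exp_add]

end TorusAction

/-- A system of invariant spheres that realizes a labelled graph inside a torus action: to each
edge belongs a sphere with poles at the end points, and an equivariant complex coordinate `π`. -/
structure EdgeSpheres (𝒜 : TorusAction r V) (Γ : LabelledGraph r) (v : Γ.Vertex → V) where
  src : Γ.Edge → Γ.Vertex
  tgt : Γ.Edge → Γ.Vertex
  ends_eq : ∀ e, Γ.ends e = s(src e, tgt e)
  src_ne_tgt : ∀ e, src e ≠ tgt e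
  Z : Γ.Edge → ℂ →ₗ[ℝ] V
  π : Γ.Edge → V →ₗ[ℝ] ℂ
  π_Z : ∀ e z, π e (Z e z) = z
  π_vertex : ∀ e x, π e (v x) = 0
  π_rep : ∀ e t y, π e (𝒜.rep t y) = weightChar (Γ.label e) t * π e y
  rep_Z : ∀ e t z, 𝒜.rep t (Z e z) = Z e (weightChar (Γ.label e) t * z)
  injective : Function.Injective v
  vertex_mem : ∀ x, v x ∈ 𝒜.fixedPoints
  sphere_subset : ∀ e, sphereSet (v (src e)) (v (tgt e)) (Z e) ⊆ 𝒜.carrier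
  π_Z_of_ne : ∀ x e f, x ∈ Γ.ends e → x ∈ Γ.ends f → e ≠ f → ∀ z, π f (Z e z) = 0
  tangent_ext : ∀ x, ∀ w ∈ tangentSpaceAt 𝒜.carrier (v x),
    (∀ e, x ∈ Γ.ends e → π e w = 0) → w = 0
  skeleton : Γ.PairwiseIndependent → ∀ x ∈ 𝒜.carrier,
    (∀ e f, π e x ≠ 0 → π f x ≠ 0 → ¬ LinearIndependent ℤ ![Γ.label e, Γ.label f]) →
    x ∈ Set.range v ∨ ∃ e, x ∈ sphereSet (v (src e)) (v (tgt e)) (Z e)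
  disjoint : ∀ e f, e ≠ f → Disjoint (sphereSet (v (src e)) (v (tgt e)) (Z e))
    (openSphereSet (v (src f)) (v (tgt f)) (Z f))
  exists_other : ∀ x e, x ∈ Γ.ends e → ∃ f, f ≠ e ∧ x ∈ Γ.ends f

namespace EdgeSpheres

variable {𝒜 : TorusAction r V} {Γ : LabelledGraph r} {v : Γ.Vertex → V}

/-- The sphere of an edge. -/
def sphere (E : EdgeSpheres 𝒜 Γ v) (e : Γ.Edge) : Set V := sphereSet (v (E.src e)) (v (E.tgt e)) (E.Z e)

/-- The sphere of an edge, without the two fixed points. -/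
def openSphere (E : EdgeSpheres 𝒜 Γ v) (e : Γ.Edge) : Set V := openSphereSet (v (E.src e)) (v (E.tgt e)) (E.Z e)

theorem mem_ends (E : EdgeSpheres 𝒜 Γ v) {e : Γ.Edge} {x : Γ.Vertex} : x ∈ Γ.ends e ↔ x = E.src e ∨ x = E.tgt e := by
  rw [E.ends_eq, Sym2.mem_iff]

theorem poles_ne (E : EdgeSpheres 𝒜 Γ v) (e : Γ.Edge) : v (E.src e) ≠ v (E.tgt e) :=
  fun h => E.src_ne_tgt e (E.injective h)

theorem tangentSpaceAt_sphere [FiniteDimensional ℝ V] (E : EdgeSpheres 𝒜 Γ v) {e : Γ.Edge} {x : Γ.Vertex}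
    (hx : x ∈ Γ.ends e) : tangentSpaceAt (E.sphere e) (v x) = LinearMap.range (E.Z e) := by
  rcases E.mem_ends.1 hx with rfl | rfl
  · exact tangentSpaceAt_sphereSet_pole (E.poles_ne e) (E.π_Z e) (E.π_vertex e _) (E.π_vertex e _)
  · rw [sphere, ← sphereSet_swap]
    exact tangentSpaceAt_sphereSet_pole (E.poles_ne e).symm (E.π_Z e) (E.π_vertex e _)
      (E.π_vertex e _)

theorem range_le_tangentSpaceAt [FiniteDimensional ℝ V] (E : EdgeSpheres 𝒜 Γ v) {e : Γ.Edge} {x : Γ.Vertex} (hx : x ∈ Γ.ends e) :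
    LinearMap.range (E.Z e) ≤ tangentSpaceAt 𝒜.carrier (v x) := by
  rw [← E.tangentSpaceAt_sphere hx]
  exact tangentSpaceAt_mono (E.sphere_subset e) _

/-- The basis is the image of `1, i` under `Z`, which intertwines multiplication by the character
with the action. -/
theorem isWeightPlane [FiniteDimensional ℝ V] (E : EdgeSpheres 𝒜 Γ v) {e : Γ.Edge} {x : Γ.Vertex} (hx : x ∈ Γ.ends e) :
    IsWeightPlane (𝒜.isotropyRep (E.vertex_mem x)) (Γ.label e)
      ((LinearMap.range (E.Z e)).submoduleOf (tangentSpaceAt 𝒜.carrier (v x))) := by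
  have hmem : ∀ z, E.Z e z ∈ tangentSpaceAt 𝒜.carrier (v x) := fun z =>
    E.range_le_tangentSpaceAt hx ⟨z, rfl⟩
  have hdec : ∀ z : ℂ, E.Z e z = z.re • E.Z e 1 + z.im • E.Z e Complex.I := by
    intro z
    rw [← map_smul, ← map_smul, ← map_add]
    congr 1
    apply Complex.ext <;> simp
  refine ⟨⟨E.Z e 1, hmem 1⟩, ⟨E.Z e Complex.I, hmem _⟩, ?_, ?_, fun t => ⟨?_, ?_⟩⟩
  · rw [LinearIndependent.pair_iff]
    intro p q hpq
    have h1 : E.Z e (p • (1 : ℂ) + q • Complex.I) = 0 := by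
      rw [map_add, map_smul, map_smul]
      exact congrArg Subtype.val hpq
    have h2 := E.π_Z e (p • (1 : ℂ) + q • Complex.I)
    rw [h1, map_zero] at h2
    constructor
    · simpa using (congrArg Complex.re h2).symm
    · simpa using (congrArg Complex.im h2).symm
  · ext ⟨w, hw⟩
    rw [Submodule.mem_span_pair]
    constructor
    · rintro ⟨p, q, h⟩
      have h := congrArg Subtype.val h
      refine ⟨p • (1 : ℂ) + q • Complex.I, ?_⟩
      rw [map_add, map_smul, map_smul]
      exact h
    · rintro ⟨z, hz⟩
      refine ⟨z.re, z.im, Subtype.ext ?_⟩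
      exact (hdec z).symm.trans hz
  · apply Subtype.ext
    change 𝒜.rep t (E.Z e 1) = _
    rw [E.rep_Z, hdec, mul_one]
    rfl
  · apply Subtype.ext
    change 𝒜.rep t (E.Z e Complex.I) = _
    rw [E.rep_Z, hdec]
    simp only [Complex.mul_re, Complex.mul_im, Complex.I_re, Complex.I_im, mul_zero, mul_one,
      zero_sub, add_zero]
    rfl

/-- The coordinate `π f` vanishes on the plane of `e` and is injective on the plane of `f`. -/
theorem submoduleOf_ne [FiniteDimensional ℝ V] (E : EdgeSpheres 𝒜 Γ v) {e f : Γ.Edge} {x : Γ.Vertex} (he : x ∈ Γ.ends e) (hf : x ∈ Γ.ends f)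
    (hne : e ≠ f) :
    (LinearMap.range (E.Z e)).submoduleOf (tangentSpaceAt 𝒜.carrier (v x)) ≠
      (LinearMap.range (E.Z f)).submoduleOf (tangentSpaceAt 𝒜.carrier (v x)) := by
  intro h
  have h1 : (⟨E.Z e 1, E.range_le_tangentSpaceAt he ⟨1, rfl⟩⟩ : tangentSpaceAt 𝒜.carrier (v x)) ∈
      (LinearMap.range (E.Z f)).submoduleOf (tangentSpaceAt 𝒜.carrier (v x)) := by
    rw [← h]; exact ⟨1, rfl⟩
  obtain ⟨z, hz⟩ := h1
  have hz : E.Z f z = E.Z e 1 := hz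
  have h2 := E.π_Z f z
  rw [hz, E.π_Z_of_ne x e f he hf hne] at h2
  have h3 := E.π_Z e 1
  rw [← hz, ← h2, map_zero, map_zero] at h3
  exact one_ne_zero h3.symm

/-- The labels at a vertex of the graph of a GKM action are pairwise independent. -/
theorem pairwiseIndependent [FiniteDimensional ℝ V] (E : EdgeSpheres 𝒜 Γ v) (h : 𝒜.IsGKM) : Γ.PairwiseIndependent := fun x _ _ he hf hne =>
  h.independent _ (E.vertex_mem x) _ _ _ _ (E.isWeightPlane he) (E.isWeightPlane hf)
    (E.submoduleOf_ne he hf hne)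

/-- Independence only concerns pairs, so a second edge at an end point is needed; `exists_other`
provides it. -/
theorem label_ne_zero (E : EdgeSpheres 𝒜 Γ v) (h : Γ.PairwiseIndependent) (e : Γ.Edge) : Γ.label e ≠ 0 := by
  have hx : E.src e ∈ Γ.ends e := E.mem_ends.2 (Or.inl rfl)
  obtain ⟨f, hf, hxf⟩ := E.exists_other _ e hx
  exact (h _ e f hx hxf hf.symm).ne_zero 0

theorem exists_weightChar_ne_one (E : EdgeSpheres 𝒜 Γ v) (h : Γ.PairwiseIndependent) (e : Γ.Edge) :
    ∃ t, weightChar (Γ.label e) t ≠ 1 := by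
  obtain ⟨X, hX⟩ := exists_weightPairing_ne_zero (E.label_ne_zero h e)
  refine ⟨fun i => Circle.exp (1 * X i), fun h1 => ?_⟩
  rw [weightChar_exp, weightPairing_smul, hX, mul_one] at h1
  obtain ⟨k, hk⟩ := Circle.exp_eq_one.1 h1
  -- The pairing was normalized to `1`, which is not an integral multiple of `2π`.
  have hpi : (1 : ℝ) < 2 * Real.pi := by linarith [Real.pi_gt_three]
  have : (0 : ℝ) < (k : ℝ) := by
    by_contra! hneg
    nlinarith [Real.pi_pos]
  have h1k : (1 : ℝ) ≤ (k : ℝ) := by exact_mod_cast (by exact_mod_cast this : (0 : ℤ) < k)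
  nlinarith

/-- At a fixed point the coordinate is multiplied by a nontrivial character and yet unchanged. -/
theorem π_eq_zero_of_fixed (E : EdgeSpheres 𝒜 Γ v) (h : Γ.PairwiseIndependent) {p : V} (hp : p ∈ 𝒜.fixedPoints)
    (e : Γ.Edge) : E.π e p = 0 := by
  obtain ⟨t, ht⟩ := E.exists_weightChar_ne_one h e
  have h1 := E.π_rep e t p
  rw [hp.2 t] at h1
  have h2 : ((weightChar (Γ.label e) t : ℂ) - 1) * E.π e p = 0 := by
    rw [sub_mul, ← h1, one_mul, sub_self]
  rcases mul_eq_zero.1 h2 with h3 | h3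
  · exact absurd (Circle.ext (by simpa using sub_eq_zero.1 h3)) ht
  · exact h3

theorem π_spherePoint (E : EdgeSpheres 𝒜 Γ v) (e : Γ.Edge) (s : ℝ) (z : ℂ) :
    E.π e (spherePoint (v (E.src e)) (v (E.tgt e)) (E.Z e) s z) = z :=
  proj_spherePoint (E.π_Z e) (E.π_vertex e _) (E.π_vertex e _) s z

theorem mem_range_of_mem_sphere (E : EdgeSpheres 𝒜 Γ v) {p : V} {e : Γ.Edge} (hp : p ∈ E.sphere e) (h0 : E.π e p = 0) :
    ∃ x ∈ Γ.ends e, v x = p := by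
  obtain ⟨s, z, hs, rfl⟩ := hp
  rw [E.π_spherePoint] at h0
  subst h0
  rcases spherePoint_zero_eq (a := v (E.src e)) (b := v (E.tgt e)) (Z := E.Z e) hs with h | h
  · exact ⟨_, E.mem_ends.2 (Or.inl rfl), h.symm⟩
  · exact ⟨_, E.mem_ends.2 (Or.inr rfl), h.symm⟩

theorem vertex_mem_sphere (E : EdgeSpheres 𝒜 Γ v) {e : Γ.Edge} {x : Γ.Vertex} (hx : x ∈ Γ.ends e) : v x ∈ E.sphere e := by
  rcases E.mem_ends.1 hx with rfl | rfl
  · exact ⟨1, 0, by simp, (spherePoint_one _ _ _).symm⟩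
  · exact ⟨-1, 0, by simp, (spherePoint_neg_one _ _ _).symm⟩

/-- All coordinates of a fixed point vanish, so the hypothesis of `skeleton` holds vacuously; a
point of a sphere with vanishing coordinate is a pole. -/
theorem range_eq_fixedPoints (E : EdgeSpheres 𝒜 Γ v) (h : Γ.PairwiseIndependent) : Set.range v = 𝒜.fixedPoints := by
  refine subset_antisymm (by rintro _ ⟨x, rfl⟩; exact E.vertex_mem x) fun p hp => ?_
  have h0 := E.π_eq_zero_of_fixed h hp
  rcases E.skeleton h p hp.1 (fun e f he => absurd (h0 e) he) with h1 | ⟨e, he⟩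
  · exact h1
  · obtain ⟨x, -, hx⟩ := E.mem_range_of_mem_sphere he (h0 e)
    exact ⟨x, hx⟩

theorem sphere_inter_fixedPoints (E : EdgeSpheres 𝒜 Γ v) (h : Γ.PairwiseIndependent) (e : Γ.Edge) :
    E.sphere e ∩ 𝒜.fixedPoints = v '' {x | x ∈ Γ.ends e} := by
  ext p
  constructor
  · rintro ⟨h1, h2⟩
    exact E.mem_range_of_mem_sphere h1 (E.π_eq_zero_of_fixed h h2 e)
  · rintro ⟨x, hx, rfl⟩
    exact ⟨E.vertex_mem_sphere hx, E.vertex_mem x⟩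

theorem rep_spherePoint (E : EdgeSpheres 𝒜 Γ v) (e : Γ.Edge) (t : Torus r) (s : ℝ) (z : ℂ) :
    𝒜.rep t (spherePoint (v (E.src e)) (v (E.tgt e)) (E.Z e) s z) =
      spherePoint (v (E.src e)) (v (E.tgt e)) (E.Z e) s (weightChar (Γ.label e) t * z) := by
  simp only [spherePoint, map_add, map_sub, map_smul, E.rep_Z, (E.vertex_mem _).2]

/-- The torus only rotates the equatorial coordinate `z`, so every orbit velocity is a multiple of
`Z (i z)`. -/
theorem finrank_orbitTangent_le [FiniteDimensional ℝ V] (E : EdgeSpheres 𝒜 Γ v) (e : Γ.Edge) (s : ℝ) (z : ℂ) :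
    Module.finrank ℝ
      (𝒜.orbitTangent (spherePoint (v (E.src e)) (v (E.tgt e)) (E.Z e) s z)) ≤ 1 := by
  have hle : 𝒜.orbitTangent (spherePoint (v (E.src e)) (v (E.tgt e)) (E.Z e) s z) ≤
      Submodule.span ℝ {E.Z e (Complex.I * z)} := by
    refine Submodule.span_le.2 ?_
    rintro w ⟨X, hX⟩
    simp_rw [E.rep_spherePoint, weightChar_exp, weightPairing_smul] at hX
    set c := weightPairing (Γ.label e) X
    have h1 : HasDerivAt (fun τ : ℝ => ((Circle.exp (τ * c) : Circle) : ℂ) * z)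
        (c • (Complex.I * z)) 0 := by
      have h2 : HasDerivAt (fun τ : ℝ => Complex.exp (((τ * c : ℝ) : ℂ) * Complex.I))
          (Complex.exp (((0 * c : ℝ) : ℂ) * Complex.I) * (((1 * c : ℝ) : ℂ) * Complex.I)) 0 :=
        ((((hasDerivAt_id (0 : ℝ)).mul_const c).ofReal_comp).mul_const Complex.I).cexp
      have h3 := h2.mul_const z
      simp only [Circle.coe_exp]
      convert! h3 using 1
      simp [mul_assoc]
    have hZ : HasDerivAt (fun τ : ℝ => E.Z e (((Circle.exp (τ * c) : Circle) : ℂ) * z))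
        (E.Z e (c • (Complex.I * z))) 0 :=
      (LinearMap.toContinuousLinearMap (E.Z e)).hasFDerivAt.comp_hasDerivAt 0 h1
    have h4 := hX.unique (hZ.const_add _)
    rw [h4, map_smul]
    exact Submodule.smul_mem _ _ (Submodule.mem_span_singleton_self _)
  exact (Submodule.finrank_mono hle).trans ((finrank_span_le_card _).trans (by simp))

/-- Choose `X, Y` in the Lie algebra dual to the two labels. In the coordinates `π e, π f`, both
nonzero at `x`, their velocities form a diagonal system. -/
theorem two_le_finrank_orbitTangent [FiniteDimensional ℝ V] (E : EdgeSpheres 𝒜 Γ v) {x : V} {e f : Γ.Edge} (he : E.π e x ≠ 0) (hf : E.π f x ≠ 0)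
    (h : LinearIndependent ℤ ![Γ.label e, Γ.label f]) :
    2 ≤ Module.finrank ℝ (𝒜.orbitTangent x) := by
  have hder : ∀ (g : Γ.Edge) (X : Fin r → ℝ) (w : V),
      HasDerivAt (fun s : ℝ => 𝒜.rep (fun i => Circle.exp (s * X i)) x) w 0 →
      E.π g w = weightPairing (Γ.label g) X • (Complex.I * E.π g x) := by
    intro g X w hw
    have h1 : HasDerivAt (fun s : ℝ => E.π g (𝒜.rep (fun i => Circle.exp (s * X i)) x))
        (E.π g w) 0 :=
      (LinearMap.toContinuousLinearMap (E.π g)).hasFDerivAt.comp_hasDerivAt 0 hw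
    simp_rw [E.π_rep, weightChar_exp, weightPairing_smul] at h1
    set c := weightPairing (Γ.label g) X
    have h2 : HasDerivAt (fun τ : ℝ => Complex.exp (((τ * c : ℝ) : ℂ) * Complex.I))
        (Complex.exp (((0 * c : ℝ) : ℂ) * Complex.I) * (((1 * c : ℝ) : ℂ) * Complex.I)) 0 :=
      ((((hasDerivAt_id (0 : ℝ)).mul_const c).ofReal_comp).mul_const Complex.I).cexp
    have h3 := h2.mul_const (E.π g x)
    simp only [Circle.coe_exp] at h1
    rw [h1.unique h3]
    simp [mul_assoc]
  obtain ⟨X, hX1, hX2⟩ := exists_weightPairing_of_linearIndependent h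
  obtain ⟨Y, hY1, hY2⟩ :=
    exists_weightPairing_of_linearIndependent (linearIndependent_pair_symm h)
  obtain ⟨u, hu⟩ := 𝒜.exists_hasDerivAt_rep_exp X x
  obtain ⟨w, hw⟩ := 𝒜.exists_hasDerivAt_rep_exp Y x
  have hli : LinearIndependent ℝ ![u, w] := by
    rw [LinearIndependent.pair_iff]
    intro p q hpq
    have h1 := congrArg (E.π e) hpq
    have h2 := congrArg (E.π f) hpq
    rw [map_add, map_smul, map_smul, map_zero, hder e X u hu, hder e Y w hw, hX1, hY2] at h1
    rw [map_add, map_smul, map_smul, map_zero, hder f X u hu, hder f Y w hw, hX2, hY1] at h2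
    simp only [one_smul, zero_smul, smul_zero, add_zero, zero_add, smul_eq_zero, mul_eq_zero,
      Complex.I_ne_zero, he, hf, or_false] at h1 h2
    exact ⟨h1, h2⟩
  have h5 : Module.finrank ℝ (Submodule.span ℝ (Set.range ![u, w])) = 2 := by
    rw [finrank_span_eq_card hli, Fintype.card_fin]
  rw [← h5]
  refine Submodule.finrank_mono (Submodule.span_le.2 ?_)
  rintro _ ⟨i, rfl⟩
  fin_cases i
  · exact Submodule.subset_span ⟨X, hu⟩
  · exact Submodule.subset_span ⟨Y, hw⟩

/-- By the rank estimate, nonzero coordinates of a point of the one-skeleton have pairwise dependent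
weights, so `skeleton` applies; the reverse inclusion is the upper bound for orbits on a sphere. -/
theorem oneSkeleton_diff_fixedPoints [FiniteDimensional ℝ V] (E : EdgeSpheres 𝒜 Γ v) (h : Γ.PairwiseIndependent) :
    𝒜.oneSkeleton \ 𝒜.fixedPoints = ⋃ e, E.openSphere e := by
  ext x
  simp only [Set.mem_iUnion]
  constructor
  · rintro ⟨⟨hx, h1⟩, h2⟩
    have h3 := E.skeleton h x hx fun e f he hf hli => by
      have := E.two_le_finrank_orbitTangent he hf hli
      omega
    rcases h3 with h3 | ⟨e, he⟩
    · rw [E.range_eq_fixedPoints h] at h3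
      exact absurd h3 h2
    · refine ⟨e, ?_⟩
      by_cases h0 : E.π e x = 0
      · obtain ⟨y, -, hy⟩ := E.mem_range_of_mem_sphere he h0
        exact absurd (hy ▸ E.vertex_mem y) h2
      · obtain ⟨s, z, hs, rfl⟩ := he
        rw [E.π_spherePoint] at h0
        exact ⟨s, z, hs, h0, rfl⟩
  · rintro ⟨e, s, z, hs, hz, rfl⟩
    refine ⟨⟨E.sphere_subset e ⟨s, z, hs, rfl⟩, E.finrank_orbitTangent_le e s z⟩, fun hfix => hz ?_⟩
    rw [← E.π_spherePoint e s z]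
    exact E.π_eq_zero_of_fixed h hfix e

/-- Inside the union of the open spheres, the closed sphere of `e` and the finite union of the other
closed spheres are disjoint closed sets, because an open sphere misses every other closed sphere. A
connected set lies in one of the two. -/
theorem connectedComponentIn_eq [FiniteDimensional ℝ V] (E : EdgeSpheres 𝒜 Γ v) [Finite Γ.Edge] (h : Γ.PairwiseIndependent) {e : Γ.Edge} {x : V}
    (hx : x ∈ E.openSphere e) :
    connectedComponentIn (𝒜.oneSkeleton \ 𝒜.fixedPoints) x = E.openSphere e := by
  have hU := E.oneSkeleton_diff_fixedPoints h
  have hsub : E.openSphere e ⊆ 𝒜.oneSkeleton \ 𝒜.fixedPoints :=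
    hU ▸ Set.subset_iUnion E.openSphere e
  refine subset_antisymm ?_
    (isPreconnected_openSphereSet.subset_connectedComponentIn hx hsub)
  have hC := isPreconnected_connectedComponentIn (F := 𝒜.oneSkeleton \ 𝒜.fixedPoints) (x := x)
  have hCU := connectedComponentIn_subset (𝒜.oneSkeleton \ 𝒜.fixedPoints) x
  have hxC := mem_connectedComponentIn (hsub hx)
  set C := connectedComponentIn (𝒜.oneSkeleton \ 𝒜.fixedPoints) x
  have hcl1 : IsClosed (E.sphere e) := isCompact_sphereSet.isClosed
  have hcl2 : IsClosed (⋃ f : {f // f ≠ e}, E.sphere f) :=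
    isClosed_iUnion_of_finite fun f => isCompact_sphereSet.isClosed
  have hcover : C ⊆ E.sphere e ∪ ⋃ f : {f // f ≠ e}, E.sphere f := by
    intro y hy
    obtain ⟨f, hf⟩ := Set.mem_iUnion.1 (hU ▸ hCU hy)
    by_cases hfe : f = e
    · subst hfe; exact Or.inl (openSphereSet_subset hf)
    · exact Or.inr (Set.mem_iUnion.2 ⟨⟨f, hfe⟩, openSphereSet_subset hf⟩)
  have hdis : C ∩ (E.sphere e ∩ ⋃ f : {f // f ≠ e}, E.sphere f) = ∅ := by
    rw [Set.eq_empty_iff_forall_notMem]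
    rintro y ⟨hy, hye, hyf⟩
    obtain ⟨⟨f, hfe⟩, hf⟩ := Set.mem_iUnion.1 hyf
    obtain ⟨g, hg⟩ := Set.mem_iUnion.1 (hU ▸ hCU hy)
    by_cases hge : g = e
    · subst hge
      exact Set.disjoint_left.1 (E.disjoint f g hfe) hf hg
    · exact Set.disjoint_left.1 (E.disjoint e g (Ne.symm hge)) hye hg
  rcases isPreconnected_iff_subset_of_disjoint_closed.1 hC _ _ hcl1 hcl2 hcover hdis with h1 | h1
  · intro y hy
    obtain ⟨g, hg⟩ := Set.mem_iUnion.1 (hU ▸ hCU hy)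
    by_cases hge : g = e
    · exact hge ▸ hg
    · exact absurd hg (Set.disjoint_left.1 (E.disjoint e g (Ne.symm hge)) (h1 hy))
  · obtain ⟨⟨f, hfe⟩, hf⟩ := Set.mem_iUnion.1 (h1 hxC)
    exact absurd hx (Set.disjoint_left.1 (E.disjoint f e hfe) hf)

theorem openSphere_nonempty (E : EdgeSpheres 𝒜 Γ v) (e : Γ.Edge) : (E.openSphere e).Nonempty :=
  ⟨_, 0, 1, by simp, one_ne_zero, rfl⟩

theorem mem_edges_iff [FiniteDimensional ℝ V] (E : EdgeSpheres 𝒜 Γ v) [Finite Γ.Edge] (h : Γ.PairwiseIndependent) {S : Set V} :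
    S ∈ 𝒜.edges ↔ ∃ e, E.sphere e = S := by
  constructor
  · rintro ⟨x, hx, rfl⟩
    obtain ⟨e, he⟩ := Set.mem_iUnion.1 (E.oneSkeleton_diff_fixedPoints h ▸ hx)
    exact ⟨e, by rw [E.connectedComponentIn_eq h he]; exact closure_openSphereSet.symm⟩
  · rintro ⟨e, rfl⟩
    obtain ⟨x, hx⟩ := E.openSphere_nonempty e
    refine ⟨x, ?_, ?_⟩
    · rw [E.oneSkeleton_diff_fixedPoints h]
      exact Set.mem_iUnion.2 ⟨e, hx⟩
    · rw [E.connectedComponentIn_eq h hx]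
      exact closure_openSphereSet.symm

theorem sphere_injective (E : EdgeSpheres 𝒜 Γ v) : Function.Injective E.sphere := by
  intro e f hef
  by_contra hne
  obtain ⟨x, hx⟩ := E.openSphere_nonempty f
  refine Set.disjoint_left.1 (E.disjoint e f hne) ?_ hx
  change x ∈ E.sphere e
  rw [hef]
  exact openSphereSet_subset hx

/-- If the labels are pairwise independent, then the graph is the GKM graph. -/
theorem hasGKMGraph [FiniteDimensional ℝ V] (E : EdgeSpheres 𝒜 Γ v) [Finite Γ.Edge] (h : Γ.PairwiseIndependent) : 𝒜.HasGKMGraph Γ v := by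
  refine ⟨E.injective, E.range_eq_fixedPoints h,
    Equiv.ofBijective (fun e => ⟨E.sphere e, (E.mem_edges_iff h).2 ⟨e, rfl⟩⟩) ⟨?_, ?_⟩, ?_⟩
  · intro e f hef
    exact E.sphere_injective (Subtype.ext_iff.1 hef)
  · rintro ⟨S, hS⟩
    obtain ⟨e, he⟩ := (E.mem_edges_iff h).1 hS
    exact ⟨e, Subtype.ext he⟩
  · intro e
    refine ⟨sphereSet_homeomorph (E.poles_ne e) (E.π_Z e) (E.π_vertex e _) (E.π_vertex e _),
      E.sphere_inter_fixedPoints h e, fun p hp hpe => ?_⟩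
    have hpe : p ∈ E.sphere e := hpe
    obtain ⟨x, hx, rfl⟩ := E.mem_range_of_mem_sphere hpe (E.π_eq_zero_of_fixed h hp e)
    change tangentSpaceAt (E.sphere e) (v x) ≤ _ ∧ IsWeightPlane _ _
      ((tangentSpaceAt (E.sphere e) (v x)).submoduleOf _)
    rw [E.tangentSpaceAt_sphere hx]
    exact ⟨E.range_le_tangentSpaceAt hx, E.isWeightPlane hx⟩

/-- A nonzero vector of `L` has a nonzero coordinate `π e` for some edge at `x`, and comparing
characters gives the weight `± label e`. By independence all other coordinates vanish on `L`, so `L`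
is contained in the tangent plane of that edge and equals it by dimension. -/
theorem exists_edge_of_isWeightPlane [FiniteDimensional ℝ V] (E : EdgeSpheres 𝒜 Γ v) (h : Γ.PairwiseIndependent) {x : Γ.Vertex}
    {L : Submodule ℝ (tangentSpaceAt 𝒜.carrier (v x))} {m : Fin r → ℤ}
    (hL : IsWeightPlane (𝒜.isotropyRep (E.vertex_mem x)) m L) :
    ∃ e, x ∈ Γ.ends e ∧ (m = Γ.label e ∨ m = -Γ.label e) ∧
      L = (LinearMap.range (E.Z e)).submoduleOf (tangentSpaceAt 𝒜.carrier (v x)) := by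
  have key : ∀ e, ∀ y ∈ L, E.π e (y : V) ≠ 0 → m = Γ.label e ∨ m = -Γ.label e := by
    intro e y hy hne
    refine eq_or_eq_neg_of_weightChar_re_eq fun t => ?_
    have h1 := congrArg (fun w : tangentSpaceAt 𝒜.carrier (v x) => E.π e (w : V))
      (hL.apply_add_apply_inv t hy)
    have h2 : E.π e (𝒜.rep t y + 𝒜.rep t⁻¹ y) = E.π e ((2 * (weightChar m t : ℂ).re) • (y : V)) :=
      h1
    rw [map_add, map_smul, E.π_rep, E.π_rep, weightChar_inv, Circle.coe_inv_eq_conj, ← add_mul,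
      Complex.add_conj, Complex.real_smul] at h2
    have h3 := mul_right_cancel₀ hne h2
    have h4 : 2 * (weightChar (Γ.label e) t : ℂ).re = 2 * (weightChar m t : ℂ).re := by
      exact_mod_cast h3
    linarith
  obtain ⟨y, hyL, hy0⟩ : ∃ y ∈ L, y ≠ 0 := by
    refine L.exists_mem_ne_zero_of_ne_bot ?_
    rintro rfl
    simpa using hL.finrank_eq
  obtain ⟨e, hxe, hye⟩ : ∃ e, x ∈ Γ.ends e ∧ E.π e (y : V) ≠ 0 := by
    by_contra! hall
    exact hy0 (Subtype.ext (E.tangent_ext x y y.2 hall))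
  have hme := key e y hyL hye
  refine ⟨e, hxe, hme, ?_⟩
  refine Submodule.eq_of_le_of_finrank_eq ?_ ?_
  · intro w hw
    refine ⟨E.π e w, ?_⟩
    have hsub : (w : V) - E.Z e (E.π e w) = 0 := by
      refine E.tangent_ext x _ (Submodule.sub_mem _ w.2
        (E.range_le_tangentSpaceAt hxe ⟨_, rfl⟩)) fun f hxf => ?_
      rw [map_sub]
      by_cases hfe : f = e
      · subst hfe; rw [E.π_Z, sub_self]
      · rw [E.π_Z_of_ne x e f hxe hxf (Ne.symm hfe), sub_zero]
        by_contra hne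
        have hli := h x e f hxe hxf (Ne.symm hfe)
        rw [LinearIndependent.pair_iff] at hli
        rcases hme with h1 | h1 <;> rcases key f w hw hne with h2 | h2
        · have := hli 1 (-1) (by rw [← h1, ← h2]; module)
          simp at this
        · have := hli 1 1 (by rw [← h1, h2]; module)
          simp at this
        · have := hli 1 1 (by rw [← h2, h1]; module)
          simp at this
        · have h3 : Γ.label e = Γ.label f := neg_injective (h1.symm.trans h2)
          have := hli 1 (-1) (by rw [h3]; module)
          simp at this
    exact (sub_eq_zero.1 hsub).symm
  · rw [hL.finrank_eq, (E.isWeightPlane hxe).finrank_eq]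

/-- Distinct weight planes at a vertex belong to distinct edges, whose labels are independent; signs
do not affect independence. -/
theorem isGKM [FiniteDimensional ℝ V] (E : EdgeSpheres 𝒜 Γ v) [Finite Γ.Vertex] (h : Γ.PairwiseIndependent)
    (ho : IsOrientableSubmanifold 𝒜.carrier) (hb : OddBettiNumbersVanish 𝒜.carrier) :
    𝒜.IsGKM where
  orientable := ho
  oddBetti := hb
  finite_fixedPoints := E.range_eq_fixedPoints h ▸ Set.finite_range v
  independent := by
    intro p hp L₁ L₂ m₁ m₂ h1 h2 hne
    obtain ⟨x, rfl⟩ := (E.range_eq_fixedPoints h).symm ▸ hp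
    obtain ⟨e, hxe, hme, hLe⟩ := E.exists_edge_of_isWeightPlane h h1
    obtain ⟨f, hxf, hmf, hLf⟩ := E.exists_edge_of_isWeightPlane h h2
    have hef : e ≠ f := by
      rintro rfl
      exact hne (hLe.trans hLf.symm)
    have hli := h x e f hxe hxf hef
    have h3 : LinearIndependent ℤ ![m₁, Γ.label f] := by
      rcases hme with rfl | rfl
      · exact hli
      · exact linearIndependent_pair_neg_left hli
    rcases hmf with rfl | rfl
    · exact h3
    · exact linearIndependent_pair_symm
        (linearIndependent_pair_neg_left (linearIndependent_pair_symm h3))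

end EdgeSpheres

end Graph

end

noncomputable section

/-! ### Conjugation orbits of projections and their tangent spaces -/

section OrbitsOfProjections

open NormedSpace

variable {A : Type*} [NormedRing A] [NormedAlgebra ℝ A]

theorem contDiff_normedSpace_exp [CompleteSpace A] : ContDiff ℝ ∞ (exp : A → A) :=
  contDiff_iff_contDiffAt.2 fun x => (exp_analytic (𝕂 := ℝ) x).contDiffAt

theorem exp_mul_exp_neg_self [CompleteSpace A] (X : A) : exp X * exp (-X) = 1 := by
  let _ : NormedAlgebra ℚ A := NormedAlgebra.restrictScalars ℚ ℝ A
  rw [← exp_add_of_commute (Commute.neg_right (Commute.refl X)), add_neg_cancel, exp_zero]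

theorem exp_neg_mul_exp_self [CompleteSpace A] (X : A) : exp (-X) * exp X = 1 := by
  simpa using exp_mul_exp_neg_self (-X)

/-- Conjugation by `exp X`. -/
def conjExp (X : A) : A →L[ℝ] A := ContinuousLinearMap.mulLeftRight ℝ A (exp X) (exp (-X))

theorem conjExp_apply (X v : A) : conjExp X v = exp X * v * exp (-X) := by
  simp [conjExp]

theorem conjExp_zero : conjExp (0 : A) = ContinuousLinearMap.id ℝ A := by
  ext v; simp [conjExp_apply]

theorem ContDiff.conjExp [CompleteSpace A] {X : Type*} [NormedAddCommGroup X] [NormedSpace ℝ X]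
    {f g : X → A} (hf : ContDiff ℝ ∞ f) (hg : ContDiff ℝ ∞ g) :
    ContDiff ℝ ∞ fun x => conjExp (f x) (g x) := by
  simp only [conjExp_apply]
  exact ((contDiff_normedSpace_exp.comp hf).mul hg).mul (contDiff_normedSpace_exp.comp hf.neg)

/-- The derivation `v ↦ [X, v]`. -/
def adCLM (X : A) : A →L[ℝ] A :=
  ContinuousLinearMap.mul ℝ A X - (ContinuousLinearMap.mul ℝ A).flip X

theorem adCLM_apply (X v : A) : adCLM X v = X * v - v * X := by
  simp [adCLM]

theorem hasDerivAt_conjExp [CompleteSpace A] (X v : A) (s : ℝ) :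
    HasDerivAt (fun s : ℝ => conjExp (s • X) v) (adCLM X (conjExp (s • X) v)) s := by
  simp only [conjExp_apply, adCLM_apply]
  have h1 : HasDerivAt (fun s : ℝ => exp (s • X)) (X * exp (s • X)) s :=
    hasDerivAt_exp_smul_const' X s
  have h2 : HasDerivAt (fun s : ℝ => exp (-(s • X))) (exp (-(s • X)) * (-X)) s := by
    simpa only [smul_neg] using hasDerivAt_exp_smul_const (-X) s
  convert! (h1.mul_const v).mul h2 using 1
  noncomm_ring

variable [StarRing A]

theorem conjRep_apply (g : unitary A) (x : A) : conjRep A g x = (g : A) * x * star (g : A) := by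
  simp [conjRep]

theorem conjRep_mul_apply (g : unitary A) (x y : A) :
    conjRep A g (x * y) = conjRep A g x * conjRep A g y := by
  simp only [conjRep_apply]
  have : star (g : A) * g = 1 := Unitary.star_mul_self_of_mem g.2
  calc (g : A) * (x * y) * star (g : A) = g * x * 1 * y * star (g : A) := by noncomm_ring
    _ = _ := by rw [← this]; noncomm_ring

theorem exp_conjRep [CompleteSpace A] (g : unitary A) (X : A) :
    exp (conjRep A g X) = conjRep A g (exp X) := by
  let _ : NormedAlgebra ℚ A := NormedAlgebra.restrictScalars ℚ ℝ A
  rw [conjRep_apply, conjRep_apply]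
  exact exp_units_conj (Unitary.toUnits g) X

theorem star_conjRep (g : unitary A) (x : A) : star (conjRep A g x) = conjRep A g (star x) := by
  simp [conjRep_apply, mul_assoc]

theorem conjRep_mul (g h : unitary A) (x : A) :
    conjRep A (g * h) x = conjRep A g (conjRep A h x) := by
  rw [map_mul]; rfl

theorem conjRep_inv_apply (g : unitary A) (x : A) : conjRep A g⁻¹ (conjRep A g x) = x := by
  rw [← conjRep_mul]; simp

theorem conjRep_apply_inv (g : unitary A) (x : A) : conjRep A g (conjRep A g⁻¹ x) = x := by
  rw [← conjRep_mul]; simp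

theorem mem_unitaryOrbit_self (p₀ : A) : p₀ ∈ unitaryOrbit p₀ := ⟨1, by simp⟩

variable {p₀ : A}

theorem star_eq_of_mem_unitaryOrbit (h : star p₀ = p₀) {p : A} (hp : p ∈ unitaryOrbit p₀) :
    star p = p := by
  obtain ⟨g, rfl⟩ := hp
  rw [star_conjRep, h]

theorem mul_self_of_mem_unitaryOrbit (h : p₀ * p₀ = p₀) {p : A} (hp : p ∈ unitaryOrbit p₀) :
    p * p = p := by
  obtain ⟨g, rfl⟩ := hp
  rw [← conjRep_mul_apply, h]

theorem conjRep_mem_tangentSpaceAt (g : unitary A) {p v : A}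
    (hv : v ∈ tangentSpaceAt (unitaryOrbit p₀) p) :
    conjRep A g v ∈ tangentSpaceAt (unitaryOrbit p₀) (conjRep A g p) := by
  have h : tangentSpaceAt (unitaryOrbit p₀) p ≤
      (tangentSpaceAt (unitaryOrbit p₀) (conjRep A g p)).comap (conjRep A g : A →ₗ[ℝ] A) := by
    refine Submodule.span_le.2 ?_
    rintro w ⟨γ, hγ, hM, h0, hd⟩
    refine Submodule.subset_span ⟨fun s => conjRep A g (γ s), (conjRep A g).contDiff.comp hγ,
      fun s => conjRep_mem_unitaryOrbit p₀ g _ (hM s), by simp only [h0], ?_⟩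
    exact (conjRep A g).hasFDerivAt.comp_hasDerivAt 0 hd
  exact h hv

theorem star_smul_of_skew [StarModule ℝ A] {X : A} (hX : star X = -X) (s : ℝ) :
    star (s • X) = -(s • X) := by
  rw [star_smul, hX, smul_neg, star_trivial]

variable [ContinuousStar A]

/-- The exponential of a skew-adjoint element, as a unitary element. -/
def expUnitaryOfSkew [CompleteSpace A] (X : A) (hX : star X = -X) : unitary A :=
  ⟨exp X, by
    rw [Unitary.mem_iff, star_exp, hX]
    exact ⟨exp_neg_mul_exp_self X, exp_mul_exp_neg_self X⟩⟩

theorem conjRep_expUnitaryOfSkew [CompleteSpace A] (X : A) (hX : star X = -X) :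
    conjRep A (expUnitaryOfSkew X hX) = conjExp X := by
  ext v
  rw [conjRep_apply, conjExp_apply, ← hX, ← star_exp]
  rfl

variable [StarModule ℝ A]

theorem conjExp_mem_unitaryOrbit [CompleteSpace A] {X : A} (hX : star X = -X) (s : ℝ) {p : A}
    (hp : p ∈ unitaryOrbit p₀) : conjExp (s • X) p ∈ unitaryOrbit p₀ := by
  rw [← conjRep_expUnitaryOfSkew _ (star_smul_of_skew hX s)]
  exact conjRep_mem_unitaryOrbit _ _ _ hp

theorem adCLM_mem_tangentSpaceAt [CompleteSpace A] {X : A} (hX : star X = -X) {p : A}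
    (hp : p ∈ unitaryOrbit p₀) : adCLM X p ∈ tangentSpaceAt (unitaryOrbit p₀) p := by
  have h : HasDerivAt (fun s : ℝ => conjExp (s • X) p) (adCLM X p) 0 := by
    have := hasDerivAt_conjExp X p 0
    rwa [zero_smul, conjExp_zero, ContinuousLinearMap.id_apply] at this
  exact Submodule.subset_span ⟨fun s => conjExp (s • X) p, 
    (contDiff_id.smul contDiff_const).conjExp contDiff_const,
    fun s => conjExp_mem_unitaryOrbit hX s hp, by simp only [zero_smul, conjExp_zero]; rfl, h⟩

/-- The tangent space of an orbit of projections. -/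
theorem mem_tangentSpaceAt_unitaryOrbit [CompleteSpace A] (hs : star p₀ = p₀) (hi : p₀ * p₀ = p₀)
    {p v : A} (hp : p ∈ unitaryOrbit p₀) :
    v ∈ tangentSpaceAt (unitaryOrbit p₀) p ↔ star v = v ∧ p * v + v * p = v := by
  have hps := star_eq_of_mem_unitaryOrbit hs hp
  have hpi := mul_self_of_mem_unitaryOrbit hi hp
  constructor
  · intro hv
    induction hv using Submodule.span_induction with
    | mem w hw =>
      obtain ⟨γ, hγ, hM, h0, hd⟩ := hw
      constructor
      · have h1 : HasDerivAt (fun s => star (γ s)) (star w) 0 := hd.star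
        have h2 : (fun s => star (γ s)) = γ := by
          ext s; exact star_eq_of_mem_unitaryOrbit hs (hM s)
        rw [h2] at h1
        exact h1.unique hd
      -- Differentiate `γ² = γ`.
      · have h1 := hd.mul hd
        have h2 : γ * γ = γ := by
          ext s; exact mul_self_of_mem_unitaryOrbit hi (hM s)
        rw [h2, h0] at h1
        rw [add_comm]
        exact h1.unique hd
    | zero => simp
    | add x y _ _ hx hy =>
      refine ⟨by rw [star_add, hx.1, hy.1], ?_⟩
      nth_rewrite 3 [← hx.2]
      nth_rewrite 3 [← hy.2]
      noncomm_ring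
    | smul c x _ hx =>
      refine ⟨by rw [star_smul, hx.1, star_trivial], ?_⟩
      rw [mul_smul_comm, smul_mul_assoc, ← smul_add, hx.2]
  · rintro ⟨h1, h2⟩
    have h3 : p * v * p = 0 := by
      have h := congrArg (fun x => p * x) h2
      simp only [mul_add, ← mul_assoc, hpi] at h
      simpa using h
    -- Multiplying `pv + vp = v` by `p` gives `pvp = 0`; then `X = vp - pv` is skew with `[X, p] =
    -- v`, so `v` is the velocity of conjugation by `exp (sX)`.
    have hX : star (v * p - p * v) = -(v * p - p * v) := by
      simp [hps, h1]
    have h := adCLM_mem_tangentSpaceAt hX hp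
    have h4 : adCLM (v * p - p * v) p = v := by
      rw [adCLM_apply, sub_mul, mul_sub, mul_assoc v, hpi, ← mul_assoc p p, hpi, ← mul_assoc, h3]
      simp only [sub_zero, zero_sub, sub_neg_eq_add]
      rw [add_comm]; exact h2
    rwa [h4] at h

end OrbitsOfProjections

end

noncomputable section

/-! ### Smooth dependence of integrals on parameters -/

section ParametricIntegral

open MeasureTheory

variable {V W : Type*} [NormedAddCommGroup V] [NormedSpace ℝ V] [FiniteDimensional ℝ V]
  [NormedAddCommGroup W] [NormedSpace ℝ W] [FiniteDimensional ℝ W]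
  {Ω : Type*} [MeasurableSpace Ω] {ν : Measure Ω} [IsFiniteMeasure ν] {L : Ω → W} {C : ℝ}

/-- The parameter stays in a compact ball, so the integrand is bounded on a space of finite measure.
Only measurability of `L` is required, since `L` will be built from a logarithm extended
discontinuously. -/
theorem integrable_of_bounded_parameter {F : Type*} [NormedAddCommGroup F]
    {Φ : W → F} (hΦ : Continuous Φ) (hL : AEStronglyMeasurable L ν) (hC : ∀ a, ‖L a‖ ≤ C) :
    Integrable (fun a => Φ (L a)) ν := by
  obtain ⟨K, hK⟩ := (isCompact_closedBall (0 : W) C).exists_bound_of_continuousOn hΦ.continuousOn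
  refine Integrable.of_bound (hΦ.comp_aestronglyMeasurable hL) K (Filter.Eventually.of_forall ?_)
  intro a
  exact hK _ (by simpa using hC a)

omit [FiniteDimensional ℝ V] [FiniteDimensional ℝ W] in
theorem ContDiff.hasFDerivAt_prodMk_left {F : Type*} [NormedAddCommGroup F]
    [NormedSpace ℝ F] {Φ : V × W → F} (hΦ : ContDiff ℝ ∞ Φ) (x : V) (w : W) :
    HasFDerivAt (fun x => Φ (x, w))
      ((fderiv ℝ Φ (x, w)).comp (ContinuousLinearMap.inl ℝ V W)) x :=
  ((hΦ.differentiable (by simp)) (x, w)).hasFDerivAt.comp x (_root_.hasFDerivAt_prodMk_left x w)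

/-- Differentiation under the integral; the bound on the derivative comes from compactness of a ball
around `x` times the ball containing the parameter. -/
theorem hasFDerivAt_integral_of_bounded_parameter {F : Type*} [NormedAddCommGroup F]
    [NormedSpace ℝ F] {Φ : V × W → F} (hΦ : ContDiff ℝ ∞ Φ) (hL : AEStronglyMeasurable L ν)
    (hC : ∀ a, ‖L a‖ ≤ C) (x : V) :
    HasFDerivAt (fun x => ∫ a, Φ (x, L a) ∂ν)
      (∫ a, (fderiv ℝ Φ (x, L a)).comp (ContinuousLinearMap.inl ℝ V W) ∂ν) x := by
  have hcont : Continuous fun q : V × W =>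
      (fderiv ℝ Φ q).comp (ContinuousLinearMap.inl ℝ V W) :=
    (hΦ.continuous_fderiv (by simp)).clm_comp continuous_const
  obtain ⟨K, hK⟩ := ((isCompact_closedBall x 1).prod
    (isCompact_closedBall (0 : W) C)).exists_bound_of_continuousOn hcont.continuousOn
  refine hasFDerivAt_integral_of_dominated_of_fderiv_le
    (F' := fun x a => (fderiv ℝ Φ (x, L a)).comp (ContinuousLinearMap.inl ℝ V W))
    (bound := fun _ => K) (Metric.closedBall_mem_nhds x one_pos) ?_ ?_ ?_ ?_ (integrable_const _) ?_
  · refine Filter.Eventually.of_forall fun y => ?_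
    exact (hΦ.continuous.comp (Continuous.prodMk_right y)).comp_aestronglyMeasurable hL
  · exact integrable_of_bounded_parameter (Φ := fun w => Φ (x, w))
      (hΦ.continuous.comp (Continuous.prodMk_right x)) hL hC
  · exact (hcont.comp (Continuous.prodMk_right x)).comp_aestronglyMeasurable hL
  · refine Filter.Eventually.of_forall fun a y hy => hK (y, L a) ⟨hy, ?_⟩
    simpa using hC a
  · refine Filter.Eventually.of_forall fun a y _ => ?_
    exact hΦ.hasFDerivAt_prodMk_left y (L a)

theorem contDiff_integral_of_bounded_parameter {F : Type*} [NormedAddCommGroup F]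
    [NormedSpace ℝ F] [CompleteSpace F] {Φ : V × W → F} (hΦ : ContDiff ℝ ∞ Φ) (hL : AEStronglyMeasurable L ν)
    (hC : ∀ a, ‖L a‖ ≤ C) : ContDiff ℝ ∞ fun x => ∫ a, Φ (x, L a) ∂ν := by
  refine contDiff_infty.2 fun n => ?_
  have hd : ∀ {Ψ : V × W → F}, ContDiff ℝ ∞ Ψ → ∀ x, HasFDerivAt (fun x => ∫ a, Ψ (x, L a) ∂ν)
      (∫ a, (fderiv ℝ Ψ (x, L a)).comp (ContinuousLinearMap.inl ℝ V W) ∂ν) x :=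
    fun hΨ x => hasFDerivAt_integral_of_bounded_parameter hΨ hL hC x
  induction n generalizing Φ with
  | zero => exact contDiff_zero.2 (continuous_iff_continuousAt.2 fun x => (hd hΦ x).continuousAt)
  | succ n ih =>
    push_cast
    -- A directional derivative is again an integral of the same kind, with `fderiv ℝ Φ · (y, 0)` in
    -- place of `Φ`.
    refine contDiff_succ_iff_fderiv_apply.2
      ⟨fun x => (hd hΦ x).differentiableAt, by simp, fun y => ?_⟩
    have hi : ∀ x, Integrable
        (fun a => (fderiv ℝ Φ (x, L a)).comp (ContinuousLinearMap.inl ℝ V W)) ν := fun x =>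
      integrable_of_bounded_parameter
        (Φ := fun w => (fderiv ℝ Φ (x, w)).comp (ContinuousLinearMap.inl ℝ V W))
        (((hΦ.continuous_fderiv (by simp)).comp (Continuous.prodMk_right x)).clm_comp
          continuous_const) hL hC
    simp only [(hd hΦ _).fderiv, ContinuousLinearMap.integral_apply (hi _)]
    exact ih (Φ := fun q => fderiv ℝ Φ q (y, 0)) ((hΦ.fderiv_right (by simp)).clm_apply
      contDiff_const)

end ParametricIntegral

/-! ### Pull-back, contraction and Cartan's formula -/

section DifferentialForms

universe u

variable {E : Type u} [NormedAddCommGroup E] [NormedSpace ℝ E] {k : ℕ}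

/-- The pull-back of a differential form by a linear map. -/
def pullbackForm (B : E →L[ℝ] E) (τ : E → E [⋀^Fin k]→L[ℝ] ℝ) : E → E [⋀^Fin k]→L[ℝ] ℝ :=
  fun x => (τ (B x)).compContinuousLinearMap B

theorem pullbackForm_apply (B : E →L[ℝ] E) (τ : E → E [⋀^Fin k]→L[ℝ] ℝ) (x : E)
    (v : Fin k → E) : pullbackForm B τ x v = τ (B x) fun i => B (v i) := rfl

/-- The contraction of a differential form with a linear vector field. -/
def contractForm (D : E →L[ℝ] E) (τ : E → E [⋀^Fin (k + 1)]→L[ℝ] ℝ) : E → E [⋀^Fin k]→L[ℝ] ℝ :=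
  fun x => (τ x).curryLeft (D x)

theorem extDeriv_pullbackForm (B : E →L[ℝ] E) {τ : E → E [⋀^Fin k]→L[ℝ] ℝ}
    (hτ : ContDiff ℝ ∞ τ) (x : E) (v : Fin (k + 1) → E) :
    extDeriv (pullbackForm B τ) x v = extDeriv τ (B x) fun i => B (v i) := by
  have h := extDeriv_pullback (𝕜 := ℝ) (f := B) (x := x) (r := ∞)
    (hτ.differentiable (by simp) (B x)) B.contDiff.contDiffAt (by simp only [minSmoothness_of_isRCLikeNormedField]; exact ENat.LEInfty.out)
  simp only [ContinuousLinearMap.fderiv] at h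
  exact congrArg (fun f => f v) h

variable [FiniteDimensional ℝ E]

/-- An alternating form is determined linearly by its values on tuples of basis vectors. Smoothness
or continuity of a form can thus be tested on fixed arguments. -/
theorem exists_linear_leftInverse_eval : ∃ (ι : Type u) (_ : Fintype ι) (e : ι → Fin k → E)
    (R : (ι → ℝ) →L[ℝ] E [⋀^Fin k]→L[ℝ] ℝ), ∀ f, R (fun i => f (e i)) = f := by
  classical
  let b := Module.Basis.ofVectorSpace ℝ E
  let ev : (E [⋀^Fin k]→L[ℝ] ℝ) →ₗ[ℝ] ((Fin k → Module.Basis.ofVectorSpaceIndex ℝ E) → ℝ) :=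
    { toFun := fun f i => f fun j => b (i j)
      map_add' := fun f g => rfl
      map_smul' := fun c f => rfl }
  have hinj : LinearMap.ker ev = ⊥ := by
    rw [LinearMap.ker_eq_bot]
    intro f g h
    apply ContinuousAlternatingMap.toAlternatingMap_injective
    exact b.ext_alternating fun v _ => congrFun h v
  obtain ⟨R, hR⟩ := ev.exists_leftInverse_of_injective hinj
  refine ⟨_, inferInstance, fun i j => b (i j), LinearMap.toContinuousLinearMap R, fun f => ?_⟩
  exact congrArg (fun T => T f) hR

theorem contDiff_form_of_apply {X : Type*} [NormedAddCommGroup X] [NormedSpace ℝ X]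
    {f : X → E [⋀^Fin k]→L[ℝ] ℝ} (h : ∀ v, ContDiff ℝ ∞ fun x => f x v) : ContDiff ℝ ∞ f := by
  obtain ⟨ι, _, e, R, hR⟩ := exists_linear_leftInverse_eval (E := E) (k := k)
  have : f = fun x => R fun i => f x (e i) := by
    ext1 x; rw [hR]
  rw [this]
  exact R.contDiff.comp (contDiff_pi.2 fun i => h (e i))

omit [FiniteDimensional ℝ E] in
theorem ContDiff.form_apply {X : Type*} [NormedAddCommGroup X] [NormedSpace ℝ X]
    {f : X → E [⋀^Fin k]→L[ℝ] ℝ} {g : Fin k → X → E} (hf : ContDiff ℝ ∞ f)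
    (hg : ∀ i, ContDiff ℝ ∞ (g i)) : ContDiff ℝ ∞ fun x => f x fun i => g i x := by
  let Λ : (E [⋀^Fin k]→L[ℝ] ℝ) →L[ℝ] ContinuousMultilinearMap ℝ (fun _ : Fin k => E) ℝ :=
    ContinuousAlternatingMap.toContinuousMultilinearMapCLM ℝ
  have h : ContDiff ℝ ∞ fun q : (E [⋀^Fin k]→L[ℝ] ℝ) × (Fin k → E) => Λ q.1 q.2 :=
    contDiff_iff_contDiffAt.2 fun q => (Λ.analyticAt_uncurry_of_multilinear).contDiffAt
  exact h.comp (hf.prodMk (contDiff_pi.2 hg))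

theorem contDiff_contractForm (D : E →L[ℝ] E) {τ : E → E [⋀^Fin (k + 1)]→L[ℝ] ℝ}
    (hτ : ContDiff ℝ ∞ τ) : ContDiff ℝ ∞ (contractForm D τ) := by
  refine contDiff_form_of_apply fun v => ?_
  refine hτ.form_apply (g := fun i x => (Matrix.vecCons (D x) v : Fin (k + 1) → E) i) fun i => ?_
  refine Fin.cases ?_ (fun j => ?_) i
  · exact D.contDiff
  · exact contDiff_const

theorem contDiff_pullbackForm (B : E →L[ℝ] E) {τ : E → E [⋀^Fin k]→L[ℝ] ℝ}
    (hτ : ContDiff ℝ ∞ τ) : ContDiff ℝ ∞ (pullbackForm B τ) :=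
  contDiff_form_of_apply fun v =>
    (hτ.comp B.contDiff).form_apply (g := fun i _ => B (v i)) fun _ => contDiff_const

/-- Cartan's formula for a linear vector field. -/
theorem extDeriv_contractForm (D : E →L[ℝ] E) {τ : E → E [⋀^Fin (k + 1)]→L[ℝ] ℝ}
    (hτ : ContDiff ℝ ∞ τ) (x : E) (v : Fin (k + 1) → E) :
    extDeriv (contractForm D τ) x v + extDeriv τ x (Matrix.vecCons (D x) v) =
      fderiv ℝ τ x (D x) v + ∑ i, τ x (Function.update v i (D (v i))) := by
  have hd : DifferentiableAt ℝ τ x := hτ.differentiable (by simp) x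
  have hconst : ∀ (u : Fin (k + 1) → E) (w : E),
      fderiv ℝ (fun y => τ y u) x w = fderiv ℝ τ x w u := by
    intro u w
    have := fderiv_continuousAlternatingMap_apply_apply (g := fun i _ => u i) hd
      (fun i => differentiableAt_const _) w
    rw [this]
    simp
  -- Product rule: the vector field in the first slot is linear, so its derivative in direction `w`
  -- is `D w`.
  have hcons : ∀ (u : Fin k → E) (w : E), fderiv ℝ (fun y => contractForm D τ y u) x w =
      fderiv ℝ τ x w (Matrix.vecCons (D x) u) + τ x (Matrix.vecCons (D w) u) := by
    intro u w
    have hg : ∀ i, DifferentiableAt ℝ (fun y => (Matrix.vecCons (D y) u : Fin (k + 1) → E) i) x :=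
      fun i => Fin.cases D.differentiableAt (fun j => differentiableAt_const _) i
    have := fderiv_continuousAlternatingMap_apply_apply hd hg w
    refine this.trans ?_
    rw [Fin.sum_univ_succ]
    have h0 : fderiv ℝ (fun y => (Matrix.vecCons (D y) u : Fin (k + 1) → E) 0) x w = D w := by
      simp
    have h1 : ∀ j : Fin k,
        fderiv ℝ (fun y => (Matrix.vecCons (D y) u : Fin (k + 1) → E) j.succ) x w = 0 := by
      intro j; simp
    rw [h0, Finset.sum_eq_zero, add_zero]
    · congr 2
      ext j
      refine Fin.cases ?_ (fun j => ?_) j <;> simp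
    · intro j _
      rw [h1]
      exact (τ x).map_coord_zero j.succ (by simp)
  have h3 : ∀ (i : Fin (k + 1)) (w : E), τ x (Function.update v i w) =
      (-1 : ℤ) ^ (i : ℕ) • τ x (Matrix.vecCons w (i.removeNth v)) := by
    intro i w
    have := (τ x).map_insertNth i w (i.removeNth v)
    rw [← this, Fin.insertNth_removeNth]
  have h4 : ∀ (i : Fin (k + 1)), (i.succ.removeNth (Matrix.vecCons (D x) v) : Fin (k + 1) → E) =
      Matrix.vecCons (D x) (i.removeNth v) := by
    intro i
    ext j
    refine Fin.cases ?_ (fun j => ?_) j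
    · simp [Fin.removeNth]
    · simp [Fin.removeNth]
  have h5 : ((0 : Fin (k + 2)).removeNth (Matrix.vecCons (D x) v) : Fin (k + 1) → E) = v := by
    ext j; simp [Fin.removeNth]
  rw [extDeriv_apply ((contDiff_contractForm D hτ).differentiable (by simp) x),
    extDeriv_apply hd, Fin.sum_univ_succ (n := k + 1)]
  -- The derivative terms of `d(ι_D τ)` cancel those of `ι_D dτ` with index `i + 1`, whose sign is
  -- opposite. The term of index `0` and the terms with `D (v i)` in front remain.
  simp only [hconst, hcons, h3, h4, h5]
  simp only [zsmul_eq_mul, mul_add, Finset.sum_add_distrib]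
  simp [pow_succ]
  ring

end DifferentialForms

end

noncomputable section

/-! ### Homotopy formula for averages of pull-backs -/

section OddCohomology

open MeasureTheory NormedSpace

universe u

section Exact

variable {V : Type*} [NormedAddCommGroup V] [NormedSpace ℝ V] {k : ℕ}

/-- The restriction of the form `τ` to the submanifold `M` is closed. -/
def IsClosedFormOn (M : Set V) (τ : V → V [⋀^Fin k]→L[ℝ] ℝ) : Prop :=
  ∀ p ∈ M, ∀ v : Fin (k + 1) → V, (∀ i, v i ∈ tangentSpaceAt M p) → extDeriv τ p v = 0

/-- The restriction to the submanifold `M` of the form `τ`, given as a function of a point and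
tangent vectors, is exact. -/
def IsExactFormOn (M : Set V) (τ : V → (Fin (k + 1) → V) → ℝ) : Prop :=
  ∃ η : V → V [⋀^Fin k]→L[ℝ] ℝ, ContDiff ℝ ∞ η ∧
    ∀ p ∈ M, ∀ v : Fin (k + 1) → V, (∀ i, v i ∈ tangentSpaceAt M p) → τ p v = extDeriv η p v

variable {M : Set V} {τ σ : V → (Fin (k + 1) → V) → ℝ}

theorem IsExactFormOn.add (hτ : IsExactFormOn M τ) (hσ : IsExactFormOn M σ) :
    IsExactFormOn M fun p v => τ p v + σ p v := by
  obtain ⟨η, hη, h⟩ := hτ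
  obtain ⟨θ, hθ, h'⟩ := hσ
  refine ⟨η + θ, hη.add hθ, fun p hp v hv => ?_⟩
  change τ p v + σ p v = _
  rw [extDeriv_add (hη.differentiable (by simp) p) (hθ.differentiable (by simp) p), h p hp v hv,
    h' p hp v hv]
  rfl

theorem IsExactFormOn.const_mul (c : ℝ) (hτ : IsExactFormOn M τ) :
    IsExactFormOn M fun p v => c * τ p v := by
  obtain ⟨η, hη, h⟩ := hτ
  refine ⟨c • η, contDiff_const.smul hη, fun p hp v hv => ?_⟩
  change c * τ p v = _
  rw [extDeriv_smul, h p hp v hv]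
  rfl

theorem IsExactFormOn.congr (hτ : IsExactFormOn M τ)
    (h : ∀ p ∈ M, ∀ v : Fin (k + 1) → V, (∀ i, v i ∈ tangentSpaceAt M p) → τ p v = σ p v) :
    IsExactFormOn M σ := by
  obtain ⟨η, hη, h'⟩ := hτ
  exact ⟨η, hη, fun p hp v hv => by rw [← h p hp v hv, h' p hp v hv]⟩

theorem IsExactFormOn.zero : IsExactFormOn M fun _ (_ : Fin (k + 1) → V) => 0 :=
  ⟨fun _ => 0, contDiff_const, fun p _ v _ => by
    rw [extDeriv_apply (differentiableAt_const _)]; simp⟩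

end Exact

variable {A : Type u} [NormedRing A] [NormedAlgebra ℝ A] [FiniteDimensional ℝ A] [StarRing A]
  [ContinuousStar A] [StarModule ℝ A] {p₀ : A} {k : ℕ}

omit [FiniteDimensional ℝ A] in
theorem conjExp_mem_tangentSpaceAt [CompleteSpace A] {X : A} (hX : star X = -X) (s : ℝ) {p v : A}
    (hv : v ∈ tangentSpaceAt (unitaryOrbit p₀) p) :
    conjExp (s • X) v ∈ tangentSpaceAt (unitaryOrbit p₀) (conjExp (s • X) p) := by
  rw [← conjRep_expUnitaryOfSkew _ (star_smul_of_skew hX s)]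
  exact conjRep_mem_tangentSpaceAt _ hv

omit [FiniteDimensional ℝ A] [ContinuousStar A] [StarModule ℝ A] in
theorem IsClosedFormOn.pullbackForm {τ : A → A [⋀^Fin k]→L[ℝ] ℝ} (hτ : ContDiff ℝ ∞ τ)
    (hc : IsClosedFormOn (unitaryOrbit p₀) τ) (g : unitary A) :
    IsClosedFormOn (unitaryOrbit p₀) (pullbackForm (conjRep A g) τ) := by
  intro p hp v hv
  rw [extDeriv_pullbackForm _ hτ]
  exact hc _ (conjRep_mem_unitaryOrbit p₀ g p hp) _ fun i => conjRep_mem_tangentSpaceAt g (hv i)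

/-- The derivative of the pull-back of a closed form along a one-parameter group. -/
theorem hasDerivAt_pullbackForm_conjExp [CompleteSpace A] {τ : A → A [⋀^Fin (k + 1)]→L[ℝ] ℝ}
    (hτ : ContDiff ℝ ∞ τ) (hc : IsClosedFormOn (unitaryOrbit p₀) τ) {X : A} (hX : star X = -X)
    {p : A} (hp : p ∈ unitaryOrbit p₀) {v : Fin (k + 1) → A}
    (hv : ∀ i, v i ∈ tangentSpaceAt (unitaryOrbit p₀) p) (s : ℝ) :
    HasDerivAt (fun s : ℝ => pullbackForm (conjExp (s • X)) τ p v)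
      (extDeriv (pullbackForm (conjExp (s • X)) (contractForm (adCLM X) τ)) p v) s := by
  have h1 := extDeriv_contractForm (adCLM X) hτ (conjExp (s • X) p) fun i => conjExp (s • X) (v i)
  -- Since `X` is skew its field is tangent to the orbit, so closedness on the orbit kills the term
  -- `ι_X dτ` in Cartan's formula.
  have h2 : extDeriv τ (conjExp (s • X) p) (Matrix.vecCons (adCLM X (conjExp (s • X) p))
      fun i => conjExp (s • X) (v i)) = 0 := by
    refine hc _ (conjExp_mem_unitaryOrbit hX s hp) _ fun i => ?_
    refine Fin.cases ?_ (fun j => ?_) i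
    · exact adCLM_mem_tangentSpaceAt hX (conjExp_mem_unitaryOrbit hX s hp)
    · exact conjExp_mem_tangentSpaceAt hX s (hv j)
  rw [h2, add_zero] at h1
  rw [extDeriv_pullbackForm _ (contDiff_contractForm _ hτ), h1]
  have hd : HasFDerivAt (fun s : ℝ => τ (conjExp (s • X) p))
      ((fderiv ℝ τ (conjExp (s • X) p)).comp
        (ContinuousLinearMap.toSpanSingleton ℝ (adCLM X (conjExp (s • X) p)))) s :=
    ((hτ.differentiable (by simp) _).hasFDerivAt).comp s (hasDerivAt_conjExp X p s).hasFDerivAt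
  have h3 := (hd.continuousAlternatingMap_apply
    (fun i => (hasDerivAt_conjExp X (v i) s).hasFDerivAt)).hasDerivAt
  convert! h3 using 1
  simp

variable {Ω : Type*} [MeasurableSpace Ω]

omit [StarRing A] [ContinuousStar A] [StarModule ℝ A] in
-- Joint smoothness in the point, in `X` and in the time `s`, as needed to integrate over the last
-- two.
theorem contDiff_pullback_contract [CompleteSpace A] {τ : A → A [⋀^Fin (k + 1)]→L[ℝ] ℝ}
    (hτ : ContDiff ℝ ∞ τ) : ContDiff ℝ ∞ fun q : A × (A × ℝ) =>
      pullbackForm (conjExp (q.2.2 • q.2.1)) (contractForm (adCLM q.2.1) τ) q.1 := by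
  have hE : ∀ f : A × (A × ℝ) → A, ContDiff ℝ ∞ f →
      ContDiff ℝ ∞ fun q : A × (A × ℝ) => conjExp (q.2.2 • q.2.1) (f q) := by
    intro f hf
    exact ContDiff.conjExp ((contDiff_snd.comp contDiff_snd).smul (contDiff_fst.comp contDiff_snd)) hf
  refine contDiff_form_of_apply fun v => ?_
  refine (hτ.comp (hE _ contDiff_fst)).form_apply (g := fun i (q : A × (A × ℝ)) =>
    (Matrix.vecCons (adCLM q.2.1 (conjExp (q.2.2 • q.2.1) q.1))
      (fun j => conjExp (q.2.2 • q.2.1) (v j)) : Fin (k + 1) → A) i) fun i => ?_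
  refine Fin.cases ?_ (fun j => ?_) i
  · simp only [Matrix.cons_val_zero, adCLM_apply]
    have h1 : ContDiff ℝ ∞ fun q : A × (A × ℝ) => q.2.1 := contDiff_fst.comp contDiff_snd
    exact (h1.mul (hE _ contDiff_fst)).sub ((hE _ contDiff_fst).mul h1)
  · simp only [Matrix.cons_val_succ]
    exact hE _ contDiff_const

omit [FiniteDimensional ℝ A] [StarRing A] [ContinuousStar A] [StarModule ℝ A] in
theorem integral_form_apply {ν : Measure Ω} {f : Ω → A [⋀^Fin k]→L[ℝ] ℝ} (hf : Integrable f ν)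
    (u : Fin k → A) : (∫ a, f a ∂ν) u = ∫ a, f a u ∂ν :=
  ((ContinuousAlternatingMap.apply ℝ A ℝ u).integral_comp_comm hf).symm

/-- For a closed form `τ`, an average of the forms `exp(X)^* τ - τ` over bounded skew elements `X`
is exact. -/
theorem isExactFormOn_integral_conjExp [CompleteSpace A] {τ : A → A [⋀^Fin (k + 1)]→L[ℝ] ℝ}
    (hτ : ContDiff ℝ ∞ τ) (hc : IsClosedFormOn (unitaryOrbit p₀) τ) (ν : Measure Ω)
    [IsFiniteMeasure ν] {L : Ω → A} (hL : Measurable[_, borel A] L) {C : ℝ} (hC : ∀ a, ‖L a‖ ≤ C)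
    (hX : ∀ a, star (L a) = -L a) :
    IsExactFormOn (unitaryOrbit p₀)
      fun p v => ∫ a, (pullbackForm (conjExp (L a)) τ p v - τ p v) ∂ν := by
  let _ : MeasurableSpace A := borel A
  have _ : BorelSpace A := ⟨rfl⟩
  -- The primitive is the integral of the contracted pull-back over `Ω` and over the time interval
  -- `[0, 1]`.
  let ν' : Measure (Ω × ℝ) := ν.prod (volume.restrict (Set.Icc 0 1))
  have hfin : IsFiniteMeasure ν' := inferInstance
  -- Time is clamped to `[0, 1]` to bound the parameter everywhere, not just almost everywhere.
  let L' : Ω × ℝ → A × ℝ := fun a => (L a.1, max 0 (min a.2 1))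
  have hL' : AEStronglyMeasurable L' ν' := by
    refine Measurable.aestronglyMeasurable ?_
    exact (hL.comp measurable_fst).prodMk
      (measurable_const.max (measurable_snd.min measurable_const))
  have hC' : ∀ a, ‖L' a‖ ≤ max C 1 := by
    intro a
    refine max_le_max (hC a.1) ?_
    rw [Real.norm_eq_abs, abs_le]
    constructor
    · exact le_trans (by norm_num) (le_max_left _ _)
    · exact max_le zero_le_one (min_le_right _ _)
  have hΦ := contDiff_pullback_contract hτ
  set Φ : A × (A × ℝ) → A [⋀^Fin k]→L[ℝ] ℝ := fun q =>
    pullbackForm (conjExp (q.2.2 • q.2.1)) (contractForm (adCLM q.2.1) τ) q.1 with hΦ_def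
  have hΦu : ∀ u, ContDiff ℝ ∞ fun q => Φ q u := fun u =>
    hΦ.form_apply (g := fun i _ => u i) fun _ => contDiff_const
  have heval : ∀ x u, (∫ a, Φ (x, L' a) ∂ν') u = ∫ a, Φ (x, L' a) u ∂ν' := fun x u =>
    integral_form_apply (integrable_of_bounded_parameter (Φ := fun w => Φ (x, w))
      (hΦ.continuous.comp (Continuous.prodMk_right x)) hL' hC') u
  have hη : ContDiff ℝ ∞ fun x => ∫ a, Φ (x, L' a) ∂ν' := by
    refine contDiff_form_of_apply fun u => ?_
    simp only [heval]
    exact contDiff_integral_of_bounded_parameter (hΦu u) hL' hC'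
  refine ⟨fun x => ∫ a, Φ (x, L' a) ∂ν', hη, ?_⟩
  intro p hp v hv
  let Ψ : (Fin k → A) → A × ℝ → (A →L[ℝ] ℝ) := fun u w =>
    (fderiv ℝ (fun q => Φ q u) (p, w)).comp (ContinuousLinearMap.inl ℝ A (A × ℝ))
  have hΨ : ∀ u, Continuous (Ψ u) := fun u =>
    (((hΦu u).continuous_fderiv (by simp)).comp
      (Continuous.prodMk_right p)).clm_comp continuous_const
  let G : A × ℝ → ℝ := fun w => ∑ i : Fin (k + 1), (-1 : ℝ) ^ i.val * Ψ (i.removeNth v) w (v i)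
  have hG : Continuous G := continuous_finsetSum _ fun i _ =>
    continuous_const.mul ((hΨ (i.removeNth v)).clm_apply continuous_const)
  -- `G` is the exterior derivative at fixed parameter, written as a finite sum of partial
  -- derivatives that depends continuously on the parameter; this lets `d` pass through the
  -- integral.
  have hT : ∀ w : A × ℝ, G w =
      extDeriv (pullbackForm (conjExp (w.2 • w.1)) (contractForm (adCLM w.1) τ)) p v := by
    intro w
    rw [extDeriv_apply ((contDiff_pullbackForm _ (contDiff_contractForm _ hτ)).differentiable
      (by simp) p)]
    refine Finset.sum_congr rfl fun i _ => ?_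
    have h : HasFDerivAt (fun x => Φ (x, w) (i.removeNth v)) (Ψ (i.removeNth v) w) p :=
      (hΦu (i.removeNth v)).hasFDerivAt_prodMk_left p w
    rw [← h.fderiv, zsmul_eq_mul]
    push_cast
    rfl
  have h1 : extDeriv (fun x => ∫ a, Φ (x, L' a) ∂ν') p v = ∫ a, G (L' a) ∂ν' := by
    rw [extDeriv_apply (hη.differentiable (by simp) p)]
    simp only [heval]
    have hi : ∀ u, Integrable (fun a => Ψ u (L' a)) ν' := fun u =>
      integrable_of_bounded_parameter (hΨ u) hL' hC'
    rw [integral_finsetSum]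
    · refine Finset.sum_congr rfl fun i _ => ?_
      rw [(hasFDerivAt_integral_of_bounded_parameter (hΦu (i.removeNth v)) hL' hC' p).fderiv,
        ContinuousLinearMap.integral_apply (hi _), integral_const_mul, zsmul_eq_mul]
      push_cast
      rfl
    · intro i _
      exact ((hi _).apply_continuousLinearMap _).const_mul _
  have hint : Integrable (fun a => G (L' a)) ν' := integrable_of_bounded_parameter hG hL' hC'
  rw [h1, integral_prod _ hint]
  refine integral_congr_ae (Filter.Eventually.of_forall fun a => ?_)
  have h2 : ∫ s in Set.Icc (0 : ℝ) 1, G (L' (a, s)) = ∫ s in (0 : ℝ)..1, G (L a, s) := by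
    rw [intervalIntegral.integral_of_le zero_le_one, ← integral_Icc_eq_integral_Ioc]
    refine setIntegral_congr_fun measurableSet_Icc fun s hs => ?_
    simp only [L', min_eq_left hs.2, max_eq_right hs.1]
  change _ = ∫ s in Set.Icc (0 : ℝ) 1, G (L' (a, s))
  rw [h2]
  simp only [hT]
  -- The inner integral telescopes to the values at times `1` and `0`.
  rw [intervalIntegral.integral_eq_sub_of_hasDerivAt (fun s _ =>
    hasDerivAt_pullbackForm_conjExp hτ hc (hX a) hp hv s)]
  · simp [conjExp_zero, pullbackForm_apply]
  · refine Continuous.intervalIntegrable ?_ _ _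
    have : Continuous fun s : ℝ => G (L a, s) :=
      hG.comp (Continuous.prodMk_right (L a))
    simpa only [hT] using this

end OddCohomology

end

noncomputable section

/-! ### Averaging over the group and vanishing of odd cohomology -/

section OddBetti

open MeasureTheory NormedSpace

variable {A : Type*} [NormedRing A] [NormedAlgebra ℝ A] [FiniteDimensional ℝ A] [StarRing A]
  [ContinuousStar A] [StarModule ℝ A] {p₀ : A} {k : ℕ}

omit [FiniteDimensional ℝ A] [StarModule ℝ A] in
/-- A local logarithm on the unitary group. -/
theorem exists_local_log [CompleteSpace A] [MeasurableSpace (unitary A)] [BorelSpace (unitary A)] :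
    ∃ U : Set (unitary A), IsOpen U ∧ 1 ∈ U ∧ ∃ ℓ : unitary A → A, Measurable[_, borel A] ℓ ∧
      (∀ u, ‖ℓ u‖ ≤ 1) ∧ (∀ u, star (ℓ u) = -ℓ u) ∧
      ∀ u ∈ U, conjRep A u = conjExp (ℓ u) := by
  classical
  let _ : MeasurableSpace A := borel A
  have _ : BorelSpace A := ⟨rfl⟩
  have hs : HasStrictFDerivAt (exp : A → A) ((ContinuousLinearEquiv.refl ℝ A : A ≃L[ℝ] A) :
      A →L[ℝ] A) 0 := hasStrictFDerivAt_exp_zero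
  let e := hs.toOpenPartialHomeomorph exp
  have he : ∀ x, e x = exp x := fun x => rfl
  have h0 : (0 : A) ∈ e.source := hs.mem_toOpenPartialHomeomorph_source
  -- The ball gives the bound `1` on the logarithm; the second condition keeps `-star X` in the
  -- domain where `exp` is injective.
  let s : Set A := Metric.ball 0 1 ∩ {X | -star X ∈ e.source}
  have hsopen : IsOpen s :=
    Metric.isOpen_ball.inter (e.open_source.preimage (continuous_star.neg))
  let U : Set (unitary A) := {u | (u : A) ∈ e.target ∩ e.symm ⁻¹' s}
  have hU : IsOpen U := (e.isOpen_inter_preimage_symm hsopen).preimage continuous_subtype_val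
  have hexp : ∀ u ∈ U, exp (e.symm u) = (u : A) := fun u hu => e.right_inv hu.1
  -- For unitary `u`, both `log u` and `-star (log u)` are logarithms of `u` in the domain of
  -- injectivity.
  have hskew : ∀ u ∈ U, star (e.symm (u : A)) = -e.symm (u : A) := by
    intro u hu
    have h1 : exp (-star (e.symm (u : A))) = (u : A) := by
      have h2 : exp (star (e.symm (u : A))) = star (u : A) := by rw [← star_exp, hexp u hu]
      have h3 := exp_neg_mul_exp_self (star (e.symm (u : A)))
      rw [h2] at h3
      calc exp (-star (e.symm (u : A))) = exp (-star (e.symm (u : A))) * (star (u : A) * u) := by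
            rw [Unitary.star_mul_self_of_mem u.2, mul_one]
        _ = u := by rw [← mul_assoc, h3, one_mul]
    have h4 : -star (e.symm (u : A)) = e.symm (u : A) :=
      e.injOn hu.2.2 (e.map_target hu.1) (by rw [he, he, h1, hexp u hu])
    exact neg_eq_iff_eq_neg.1 h4
  -- Extension by `0` outside `U` keeps the map measurable, bounded and skew.
  refine ⟨U, hU, ?_, U.piecewise (fun u => e.symm (u : A)) (fun _ => 0), ?_, ?_, ?_, ?_⟩
  · have h1 : ((1 : unitary A) : A) = e 0 := by rw [he, exp_zero]; rfl
    have h2 : e.symm ((1 : unitary A) : A) = 0 := by rw [h1, e.left_inv h0]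
    refine ⟨by rw [h1]; exact e.map_source h0, ?_⟩
    simp only [Set.mem_preimage, h2]
    exact ⟨by simp, by simpa using h0⟩
  · refine ContinuousOn.measurable_piecewise ?_ continuousOn_const hU.measurableSet
    exact e.continuousOn_symm.comp continuous_subtype_val.continuousOn fun u hu => hu.1
  · intro u
    by_cases hu : u ∈ U
    · rw [Set.piecewise_eq_of_mem _ _ _ hu]
      have := hu.2.1
      rw [mem_ball_zero_iff] at this
      exact this.le
    · rw [Set.piecewise_eq_of_notMem _ _ _ hu]; simp
  · intro u
    by_cases hu : u ∈ U
    · rw [Set.piecewise_eq_of_mem _ _ _ hu]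
      exact hskew u hu
    · rw [Set.piecewise_eq_of_notMem _ _ _ hu]; simp
  · intro u hu
    rw [Set.piecewise_eq_of_mem _ _ _ hu]
    ext v
    have h5 : exp (-e.symm (u : A)) = star (u : A) := by
      rw [← hskew u hu, ← star_exp, hexp u hu]
    rw [conjRep_apply, conjExp_apply, hexp u hu, h5]

/-- The group elements that act trivially on the cohomology classes of closed forms. -/
def cohomologicallyTrivial (p₀ : A) (k : ℕ) : Subgroup (unitary A) where
  carrier := {g | ∀ τ : A → A [⋀^Fin (k + 1)]→L[ℝ] ℝ, ContDiff ℝ ∞ τ →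
    IsClosedFormOn (unitaryOrbit p₀) τ →
    IsExactFormOn (unitaryOrbit p₀) fun p v => pullbackForm (conjRep A g) τ p v - τ p v}
  one_mem' τ _ _ := by simpa [pullbackForm_apply] using IsExactFormOn.zero
  mul_mem' {g h} hg hh τ hτ hc := by
    -- `(gh)*τ - τ = (h*(g*τ) - g*τ) + (g*τ - τ)`; for inverses, apply the hypothesis on `g` to
    -- `(g⁻¹)*τ`.
    refine ((hh _ (contDiff_pullbackForm _ hτ) (hc.pullbackForm hτ g)).add (hg τ hτ hc)).congr ?_
    intro p _ v _
    simp only [pullbackForm_apply, conjRep_mul]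
    ring
  inv_mem' {g} hg τ hτ hc := by
    refine ((hg _ (contDiff_pullbackForm _ hτ) (hc.pullbackForm hτ g⁻¹)).const_mul (-1)).congr ?_
    intro p _ v _
    simp only [pullbackForm_apply, conjRep_inv_apply]
    ring

omit [FiniteDimensional ℝ A] [StarModule ℝ A] in
theorem continuous_pullbackForm_conjRep {τ : A → A [⋀^Fin k]→L[ℝ] ℝ}
    (hτ : ContDiff ℝ ∞ τ) (p : A) (v : Fin k → A) :
    Continuous fun g : unitary A => pullbackForm (conjRep A g) τ p v := by
  have h : Continuous fun q : A × (Fin k → A) => τ q.1 q.2 :=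
    ((hτ.comp contDiff_fst).form_apply (g := fun i (q : A × (Fin k → A)) => q.2 i)
      fun i => (contDiff_apply ℝ A i).comp contDiff_snd).continuous
  exact h.comp ((continuous_conjRep p).prodMk (continuous_pi fun i => continuous_conjRep (v i)))

/-- The averaged homotopy formula for a Dirac measure. -/
theorem expUnitaryOfSkew_mem_cohomologicallyTrivial [CompleteSpace A] (X : A) (hX : star X = -X) :
    expUnitaryOfSkew X hX ∈ cohomologicallyTrivial p₀ k := by
  intro τ hτ hc
  refine (isExactFormOn_integral_conjExp hτ hc (Measure.dirac ()) (L := fun _ => X)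
    (@measurable_const _ _ (borel A) _ X) (fun _ => le_refl ‖X‖) (fun _ => hX)).congr ?_
  intro p _ v _
  rw [conjRep_expUnitaryOfSkew]
  simp

/-- Elements near `1` act as exponentials of skew elements, and a subgroup that is a neighbourhood
of `1` is open. -/
theorem isOpen_cohomologicallyTrivial [CompleteSpace A] :
    IsOpen (cohomologicallyTrivial p₀ k : Set (unitary A)) := by
  borelize ↥(unitary A)
  obtain ⟨U, hU, h1, ℓ, -, -, hs, h⟩ := exists_local_log (A := A)
  refine Subgroup.isOpen_of_mem_nhds _ (Filter.mem_of_superset (hU.mem_nhds h1) ?_)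
  intro u hu
  have := expUnitaryOfSkew_mem_cohomologicallyTrivial (p₀ := p₀) (k := k) (ℓ u) (hs u)
  intro τ hτ hc
  have h2 := this τ hτ hc
  rwa [conjRep_expUnitaryOfSkew, ← h u hu] at h2

/-- No family of primitives measurable in `g` is at hand. Instead the compact subgroup is cut into
finitely many pieces, on each of which `g` is a fixed element times an element with a logarithm, and
the homotopy formula integrates over each piece. -/
theorem IsExactFormOn.setIntegral_pullbackForm [CompleteSpace A] [CompactSpace (unitary A)]
    [MeasurableSpace (unitary A)] [BorelSpace (unitary A)] (μ : Measure (unitary A))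
    [IsFiniteMeasure μ] {τ : A → A [⋀^Fin (k + 1)]→L[ℝ] ℝ}
    (hτ : ContDiff ℝ ∞ τ) (hc : IsClosedFormOn (unitaryOrbit p₀) τ) :
    IsExactFormOn (unitaryOrbit p₀) fun p v => ∫ g in (cohomologicallyTrivial p₀ k : Set (unitary A)),
      (pullbackForm (conjRep A g) τ p v - τ p v) ∂μ := by
  obtain ⟨U, hU, h1, ℓ, hℓ, hb, hs, h⟩ := exists_local_log (A := A)
  have hint : ∀ (B : Set (unitary A)) (c : ℝ) (p : A) (v : Fin (k + 1) → A),
      Integrable (fun g => pullbackForm (conjRep A g) τ p v - c) (μ.restrict B) := by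
    intro B c p v
    have hcont : Continuous fun g => pullbackForm (conjRep A g) τ p v - c :=
      (continuous_pullbackForm_conjRep hτ p v).sub continuous_const
    have := (hcont.continuousOn (s := Set.univ)).integrableOn_compact (μ := μ) isCompact_univ
    exact (this.mono_set (Set.subset_univ B))
  -- On such a piece `g*τ - τ = (exp(ℓ)*h₀*τ - h₀*τ) + (h₀*τ - τ)` with `ℓ` the logarithm of
  -- `h₀⁻¹g`; the last term does not depend on `g` and contributes the measure of the piece as a
  -- factor.
  have hlocal : ∀ h₀ ∈ cohomologicallyTrivial p₀ k, ∀ B : Set (unitary A), MeasurableSet B →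
      (∀ g ∈ B, h₀⁻¹ * g ∈ U) → IsExactFormOn (unitaryOrbit p₀) fun p v =>
        ∫ g in B, (pullbackForm (conjRep A g) τ p v - τ p v) ∂μ := by
    intro h₀ hh₀ B hB hBU
    have e1 := isExactFormOn_integral_conjExp (contDiff_pullbackForm (conjRep A h₀) hτ)
      (hc.pullbackForm hτ h₀) (μ.restrict B) (L := fun g => ℓ (h₀⁻¹ * g))
      (hℓ.comp (measurable_const_mul _)) (fun _ => hb _) (fun _ => hs _)
    have e2 := (hh₀ τ hτ hc).const_mul (μ.real B)
    refine (e1.add e2).congr fun p _ v _ => ?_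
    have e3 : ∫ g in B, (pullbackForm (conjExp (ℓ (h₀⁻¹ * g))) (pullbackForm (conjRep A h₀) τ) p v -
        pullbackForm (conjRep A h₀) τ p v) ∂μ =
        ∫ g in B, (pullbackForm (conjRep A g) τ p v - pullbackForm (conjRep A h₀) τ p v) ∂μ := by
      refine setIntegral_congr_fun hB fun g hg => ?_
      simp only [← h _ (hBU g hg), pullbackForm_apply, ← conjRep_mul, mul_inv_cancel_left]
    rw [e3, ← smul_eq_mul, ← setIntegral_const, ← integral_add (hint _ _ _ _)
      (integrable_const _)]
    simp
  have hcover : ∀ s : Finset (unitary A), (∀ h₀ ∈ s, h₀ ∈ cohomologicallyTrivial p₀ k) →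
      ∀ B : Set (unitary A), MeasurableSet B → (∀ g ∈ B, ∃ h₀ ∈ s, h₀⁻¹ * g ∈ U) →
      IsExactFormOn (unitaryOrbit p₀) fun p v =>
        ∫ g in B, (pullbackForm (conjRep A g) τ p v - τ p v) ∂μ := by
    classical
    intro s
    induction s using Finset.induction_on with
    | empty =>
      intro _ B _ hBs
      have : B = ∅ := Set.eq_empty_of_forall_notMem fun g hg => by simpa using hBs g hg
      subst this
      simpa using IsExactFormOn.zero
    | insert a s _ ih =>
      intro hs' B hB hBs
      have hO : MeasurableSet {g : unitary A | a⁻¹ * g ∈ U} :=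
        (hU.preimage (continuous_const_mul a⁻¹)).measurableSet
      -- The chart at `a` takes its share of `B`, and the remainder is covered by the other charts,
      -- so the pieces are disjoint.
      have f1 := hlocal a (hs' a (Finset.mem_insert_self _ _)) (B ∩ {g | a⁻¹ * g ∈ U})
        (hB.inter hO) fun g hg => hg.2
      have f2 := ih (fun h₀ hh => hs' h₀ (Finset.mem_insert_of_mem hh)) (B \ {g | a⁻¹ * g ∈ U})
        (hB.diff hO) (by
          intro g hg
          obtain ⟨h₀, hh, hu⟩ := hBs g hg.1
          rcases Finset.mem_insert.1 hh with rfl | hh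
          · exact absurd hu hg.2
          · exact ⟨h₀, hh, hu⟩)
      refine (f1.add f2).congr fun p _ v _ => ?_
      exact integral_inter_add_sdiff hO (hint _ _ _ _)
  have hopen := isOpen_cohomologicallyTrivial (p₀ := p₀) (k := k)
  have hcompact : IsCompact (cohomologicallyTrivial p₀ k : Set (unitary A)) :=
    (Subgroup.isClosed_of_isOpen _ hopen).isCompact
  obtain ⟨s, hs1, hs2⟩ := hcompact.elim_nhds_subcover (fun h₀ => {g | h₀⁻¹ * g ∈ U})
    fun h₀ _ => (hU.preimage (continuous_const_mul h₀⁻¹)).mem_nhds (by simpa using h1)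
  refine hcover s hs1 _ hopen.measurableSet fun g hg => ?_
  simpa using hs2 hg

/-- The odd Betti numbers of a symmetric space (of inner type) vanish. -/
theorem oddBettiNumbersVanish_unitaryOrbit [CompactSpace (unitary A)]
    (hsymm : ∃ X : A, star X = -X ∧ conjExp X p₀ = p₀ ∧
      ∀ v ∈ tangentSpaceAt (unitaryOrbit p₀) p₀, conjExp X v = -v) :
    OddBettiNumbersVanish (unitaryOrbit p₀) := by
  have _ : CompleteSpace A := FiniteDimensional.complete ℝ A
  borelize ↥(unitary A)
  intro j τ hτ hc
  obtain ⟨X, hX, hXp, hXv⟩ := hsymm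
  -- Inverting the left-invariant Haar measure gives a right-invariant one; the symmetry will be
  -- multiplied from the right.
  let μ : Measure (unitary A) := (Measure.haar : Measure (unitary A)).inv
  let H := cohomologicallyTrivial p₀ (2 * j)
  have hopen : IsOpen (H : Set (unitary A)) := isOpen_cohomologicallyTrivial
  have hpos : μ.real (H : Set (unitary A)) ≠ 0 := by
    rw [Measure.real, ENNReal.toReal_ne_zero]
    refine ⟨?_, measure_ne_top _ _⟩
    rw [Measure.inv_apply, inv_coe_set]
    exact (hopen.measure_pos _ ⟨1, H.one_mem⟩).ne'
  obtain ⟨η, hη, h⟩ := (IsExactFormOn.setIntegral_pullbackForm μ hτ hc).const_mul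
    (-(μ.real (H : Set (unitary A)))⁻¹)
  refine ⟨η, hη, fun p hp v hv => ?_⟩
  rw [← h p hp v hv]
  have hzero : ∫ g in (H : Set (unitary A)), pullbackForm (conjRep A g) τ p v ∂μ = 0 := by
    obtain ⟨g₀, rfl⟩ := hp
    -- The geodesic symmetry at `g₀ p₀`: the one at `p₀` conjugated by `g₀`, again an exponential.
    let S : unitary A := expUnitaryOfSkew (conjRep A g₀ X) (by rw [star_conjRep, hX, map_neg])
    have hS : S ∈ H := expUnitaryOfSkew_mem_cohomologicallyTrivial _ _
    have hS' : ∀ w, conjRep A S w = conjRep A g₀ (conjExp X (conjRep A g₀⁻¹ w)) := by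
      intro w
      rw [conjRep_expUnitaryOfSkew, conjExp_apply, conjExp_apply, ← map_neg, exp_conjRep,
        exp_conjRep, conjRep_mul_apply, conjRep_mul_apply, conjRep_apply_inv]
    have hSp : conjRep A S (conjRep A g₀ p₀) = conjRep A g₀ p₀ := by
      rw [hS', conjRep_inv_apply, hXp]
    have hSv : ∀ i, conjRep A S (v i) = -v i := by
      intro i
      have := conjRep_mem_tangentSpaceAt g₀⁻¹ (hv i)
      rw [conjRep_inv_apply] at this
      rw [hS', hXv _ this, map_neg, conjRep_apply_inv]
    set f : unitary A → ℝ := fun g => pullbackForm (conjRep A g) τ (conjRep A g₀ p₀) v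
    -- `S` fixes the point and negates the `2j + 1` tangent arguments, an odd number of signs.
    have hf : ∀ g, f (g * S) = -f g := by
      intro g
      simp only [f, pullbackForm_apply, conjRep_mul, hSp, hSv, map_neg]
      have := (τ (conjRep A g (conjRep A g₀ p₀))).map_smul_univ (fun _ => (-1 : ℝ))
        fun i => conjRep A g (v i)
      simpa [pow_succ, pow_mul] using this
    -- Right translation by `S ∈ H` preserves both `H` and the measure, so the integral equals its
    -- own negative.
    have h1 : ∫ g, (H : Set (unitary A)).indicator f (g * S) ∂μ =
        ∫ g, (H : Set (unitary A)).indicator f g ∂μ := integral_mul_right_eq_self _ S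
    have h2 : ∀ g, (H : Set (unitary A)).indicator f (g * S) =
        -(H : Set (unitary A)).indicator f g := by
      intro g
      by_cases hg : g ∈ H
      · rw [Set.indicator_of_mem (show g * S ∈ (H : Set (unitary A)) from H.mul_mem hg hS),
          Set.indicator_of_mem (show g ∈ (H : Set (unitary A)) from hg), hf]
      · have : g * S ∉ H := fun hh => hg ((H.mul_mem_cancel_right hS).1 hh)
        rw [Set.indicator_of_notMem (by exact this), Set.indicator_of_notMem (by exact hg), neg_zero]
    simp only [h2, integral_neg] at h1
    rw [← integral_indicator hopen.measurableSet]
    linarith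
  have hi : Integrable (fun g => pullbackForm (conjRep A g) τ p v)
      (μ.restrict (H : Set (unitary A))) := by
    have := ((continuous_pullbackForm_conjRep hτ p v).continuousOn
      (s := Set.univ)).integrableOn_compact (μ := μ) isCompact_univ
    exact (this.mono_set (Set.subset_univ _))
  change τ p v = -(μ.real (H : Set (unitary A)))⁻¹ *
    ∫ g in (H : Set (unitary A)), (pullbackForm (conjRep A g) τ p v - τ p v) ∂μ
  rw [integral_sub hi (integrable_const _), hzero, setIntegral_const, smul_eq_mul]
  field_simp
  ring

end OddBetti

end

noncomputable section

/-! ### Orientability of orbits -/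

section Orientability

variable {A : Type*} [NormedRing A] [NormedAlgebra ℝ A] [FiniteDimensional ℝ A] [StarRing A]
  [ContinuousStar A] {p₀ : A}

omit [StarRing A] [ContinuousStar A] in
theorem continuous_form_of_apply {k : ℕ} {X : Type*} [TopologicalSpace X]
    {f : X → A [⋀^Fin k]→L[ℝ] ℝ} (h : ∀ v, Continuous fun x => f x v) : Continuous f := by
  obtain ⟨ι, _, e, R, hR⟩ := exists_linear_leftInverse_eval (E := A) (k := k)
  have : f = fun x => R fun i => f x (e i) := by
    ext1 x; rw [hR]
  rw [this]
  exact R.continuous.comp (continuous_pi fun i => h (e i))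

/-- An orbit is orientable if the stabilizer of the base point acts on the tangent space with
nonnegative determinant. The tangent space at the base point is identified with `E` by `col`. -/
theorem isOrientableSubmanifold_unitaryOrbit [CompactSpace (unitary A)] {E : Type*}
    [AddCommGroup E] [Module ℝ E] [FiniteDimensional ℝ E] (col : A →ₗ[ℝ] E)
    (hcol : Set.BijOn col (tangentSpaceAt (unitaryOrbit p₀) p₀) Set.univ)
    (hstab : ∀ g : unitary A, conjRep A g p₀ = p₀ → ∃ f : E →ₗ[ℝ] E, 0 ≤ LinearMap.det f ∧
      ∀ v, col (conjRep A g⁻¹ v) = f (col v)) :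
    IsOrientableSubmanifold (unitaryOrbit p₀) := by
  classical
  set d := Module.finrank ℝ E with hd
  let b : Module.Basis (Fin d) ℝ E := Module.finBasis ℝ E
  -- A volume form at the base point, to be transported over the orbit by the group.
  let τ₀ : A [⋀^Fin d]→L[ℝ] ℝ :=
    { b.det.compLinearMap col with
      cont := by
        change Continuous fun v : Fin d → A => b.det fun i => col (v i)
        simp only [Module.Basis.det_apply]
        refine Continuous.matrix_det (continuous_matrix fun i j => ?_)
        exact ((b.coord i ∘ₗ col).continuous_of_finiteDimensional).comp (continuous_apply j) }
  have hτ₀ : ∀ v : Fin d → A, τ₀ v = b.det fun i => col (v i) := fun v => rfl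
  choose w hwT hw using fun i : Fin d => hcol.2.2 (Set.mem_univ (b i))
  have hw1 : τ₀ w = 1 := by
    rw [hτ₀]; simp only [hw]; exact b.det_self
  let F : unitary A → ℝ := fun g => τ₀ fun i => conjRep A g⁻¹ (w i)
  have hcontv : ∀ v : Fin d → A, Continuous fun g : unitary A => τ₀ fun i => conjRep A g⁻¹ (v i) :=
    fun v => τ₀.cont.comp (continuous_pi fun i => (continuous_conjRep (v i)).comp continuous_inv)
  have hF : ∀ g : unitary A, conjRep A g p₀ = p₀ → 0 ≤ F g ∧
      ∀ v : Fin d → A, τ₀ (fun i => conjRep A g⁻¹ (v i)) = F g * τ₀ v := by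
    intro g hg
    obtain ⟨f, hf0, hf⟩ := hstab g hg
    have h1 : ∀ v : Fin d → A, τ₀ (fun i => conjRep A g⁻¹ (v i)) = LinearMap.det f * τ₀ v := by
      intro v
      simp only [hτ₀, hf]
      exact b.det_comp f _
    have h2 : F g = LinearMap.det f := by
      simp only [F, h1, hw1, mul_one]
    exact ⟨h2 ▸ hf0, fun v => by rw [h1, h2]⟩
  -- On the stabilizer `F` is the determinant of the action. It is multiplicative on powers, while
  -- compactness bounds it, so it is at most `1`; the inverse then forces it to be exactly `1`.
  have hpow : ∀ g : unitary A, conjRep A g p₀ = p₀ → ∀ n : ℕ,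
      conjRep A (g ^ n) p₀ = p₀ ∧ F (g ^ n) = F g ^ n := by
    intro g hg n
    induction n with
    | zero => simpa [F] using hw1
    | succ n ih =>
      refine ⟨by rw [pow_succ, conjRep_mul, hg, ih.1], ?_⟩
      rw [pow_succ (F g), ← ih.2, mul_comm]
      have := (hF g hg).2 fun i => conjRep A (g ^ n)⁻¹ (w i)
      simp only [← conjRep_mul, ← mul_inv_rev] at this
      simp only [F, pow_succ] at this ⊢
      exact this
  obtain ⟨C, hC⟩ := isCompact_univ.exists_bound_of_continuousOn (hcontv w).continuousOn
  have hle : ∀ g : unitary A, conjRep A g p₀ = p₀ → F g ≤ 1 := by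
    intro g hg
    by_contra! hlt
    obtain ⟨n, hn⟩ := pow_unbounded_of_one_lt C hlt
    have := hC (g ^ n) (Set.mem_univ _)
    have h2 : F (g ^ n) ≤ C := (le_abs_self _).trans this
    rw [(hpow g hg n).2] at h2
    linarith
  have hinv : ∀ g : unitary A, conjRep A g p₀ = p₀ → conjRep A g⁻¹ p₀ = p₀ := by
    intro g hg
    nth_rewrite 1 [← hg]
    exact conjRep_inv_apply g p₀
  have hone : ∀ g : unitary A, conjRep A g p₀ = p₀ → F g = 1 := by
    intro g hg
    have h1 := (hF g hg).2 fun i => conjRep A g⁻¹⁻¹ (w i)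
    simp only [← conjRep_mul] at h1
    have h2 : F g * F g⁻¹ = 1 := by
      rw [← hw1]
      simp only [F] at h1 ⊢
      rw [← h1]
      simp
    have h3 := hle g hg
    have h4 := hle g⁻¹ (hinv g hg)
    have h5 := (hF g hg).1
    have h6 := (hF g⁻¹ (hinv g hg)).1
    nlinarith
  let T : unitary A → A [⋀^Fin d]→L[ℝ] ℝ := fun g => τ₀.compContinuousLinearMap (conjRep A g⁻¹)
  have hT : Continuous T := continuous_form_of_apply hcontv
  -- Invariance of `τ₀` under the stabilizer: the transported form depends only on the point
  -- reached.
  have hTeq : ∀ g h : unitary A, conjRep A g p₀ = conjRep A h p₀ → T g = T h := by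
    intro g h hgh
    have hk : conjRep A (h⁻¹ * g) p₀ = p₀ := by
      rw [conjRep_mul, hgh, conjRep_inv_apply]
    ext v
    have := (hF _ hk).2 fun i => conjRep A h⁻¹ (v i)
    rw [hone _ hk, one_mul] at this
    simp only [← conjRep_mul, mul_inv_rev, inv_inv, mul_assoc, mul_inv_cancel, mul_one] at this
    exact this
  let π : unitary A → unitaryOrbit p₀ := fun g => ⟨conjRep A g p₀, g, rfl⟩
  have hπ : Continuous π := (continuous_conjRep p₀).subtype_mk _
  have hπs : Function.Surjective π := by
    rintro ⟨_, g, rfl⟩; exact ⟨g, rfl⟩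
  -- The orbit carries the quotient topology of the compact group, so continuity of the form can be
  -- tested upstairs.
  have hq : Topology.IsQuotientMap π := hπ.isClosedMap.isQuotientMap hπ hπs
  let τ : A → A [⋀^Fin d]→L[ℝ] ℝ := fun p => if h : p ∈ unitaryOrbit p₀ then T h.choose else 0
  have hτ : ∀ g : unitary A, τ (conjRep A g p₀) = T g := by
    intro g
    have h : conjRep A g p₀ ∈ unitaryOrbit p₀ := ⟨g, rfl⟩
    simp only [τ, dif_pos h]
    exact hTeq _ _ h.choose_spec.symm
  refine ⟨d, τ, ?_, ?_⟩
  · rw [continuousOn_iff_continuous_domRestrict, hq.continuous_iff]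
    convert! hT using 1
    ext1 g
    exact hτ g
  · rintro _ ⟨g, rfl⟩
    constructor
    · let c : tangentSpaceAt (unitaryOrbit p₀) (conjRep A g p₀) →ₗ[ℝ] E :=
        (col ∘ₗ (conjRep A g⁻¹ : A →ₗ[ℝ] A)).domRestrict _
      have hback : ∀ v ∈ tangentSpaceAt (unitaryOrbit p₀) (conjRep A g p₀),
          conjRep A g⁻¹ v ∈ tangentSpaceAt (unitaryOrbit p₀) p₀ := by
        intro v hv
        have := conjRep_mem_tangentSpaceAt g⁻¹ hv
        rwa [conjRep_inv_apply] at this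
      have hc : Function.Bijective c := by
        constructor
        · rintro ⟨x, hx⟩ ⟨y, hy⟩ hxy
          have h1 := hcol.2.1 (hback x hx) (hback y hy) hxy
          have h2 := congrArg (conjRep A g) h1
          rw [conjRep_apply_inv, conjRep_apply_inv] at h2
          exact Subtype.ext h2
        · intro e
          obtain ⟨v, hv, hve⟩ := hcol.2.2 (Set.mem_univ e)
          refine ⟨⟨conjRep A g v, conjRep_mem_tangentSpaceAt g hv⟩, ?_⟩
          simp only [c, LinearMap.domRestrict_apply, LinearMap.comp_apply,
            ContinuousLinearMap.coe_coe, conjRep_inv_apply]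
          exact hve
      exact (LinearEquiv.ofBijective c hc).finrank_eq
    · refine ⟨fun i => conjRep A g (w i), fun i => conjRep_mem_tangentSpaceAt g (hwT i), ?_⟩
      rw [hτ]
      simp only [T, ContinuousAlternatingMap.compContinuousLinearMap_apply, Function.comp_def,
        conjRep_inv_apply, hw1]
      exact one_ne_zero

/-- A real endomorphism that commutes with a complex structure has nonnegative determinant. -/
theorem det_nonneg_of_commute_complexStructure {E : Type*} [AddCommGroup E] [Module ℝ E]
    [FiniteDimensional ℝ E] (J f : E →ₗ[ℝ] E) (hJ : ∀ x, J (J x) = -x)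
    (hf : ∀ x, f (J x) = J (f x)) : 0 ≤ LinearMap.det f := by
  let φ : ℂ →ₐ[ℝ] Module.End ℝ E := Complex.lift ⟨J, by ext x; simpa using hJ x⟩
  let _ : Module ℂ E := Module.compHom E (φ : ℂ →+* Module.End ℝ E)
  have hsmul : ∀ (z : ℂ) (x : E), z • x = z.re • x + z.im • J x := by
    intro z x
    change φ z x = _
    simp [φ, Complex.liftAux_apply]
  have _ : IsScalarTower ℝ ℂ E := ⟨fun a z x => by
    rw [hsmul, hsmul]; simp [mul_smul]⟩
  let f' : E →ₗ[ℂ] E :=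
    { f with
      map_smul' := fun z x => by
        change f (z • x) = z • f x
        rw [hsmul, hsmul, map_add, map_smul, map_smul, hf] }
  have h : f = f'.restrictScalars ℝ := rfl
  -- The real determinant of a complex linear map is `|det_ℂ|²`.
  rw [h, LinearMap.det_restrictScalars, Algebra.norm_complex_eq]
  exact Complex.normSq_nonneg _

end Orientability

end

noncomputable section

/-! ### A criterion for quaternionic weights -/

section QuaternionicWeights

variable {r : ℕ} {A : Type*} [NormedRing A] [NormedAlgebra ℝ A]

/-- A criterion for quaternionic weights: the Lie algebra `s` has a basis `X₀, X₁, X₂` such that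
the torus fixes `X₀` and rotates `X₁, X₂`, and it acts faithfully on the tangent space. -/
theorem TorusAction.isQuatWeight_adEndomorphisms {𝒜 : TorusAction r A} {p : A}
    (hp : p ∈ 𝒜.fixedPoints) {s : Submodule ℝ A} {m : Fin r → ℤ} (X₀ X₁ X₂ : A)
    (hs : ∀ X, X ∈ s ↔ ∃ a b c : ℝ, X = a • X₀ + (b • X₁ + c • X₂))
    (hT : ∀ X ∈ s, ∀ v ∈ tangentSpaceAt 𝒜.carrier p, X * v - v * X ∈ tangentSpaceAt 𝒜.carrier p)
    (hinj : ∀ a b c : ℝ, (∀ v ∈ tangentSpaceAt 𝒜.carrier p,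
      (a • X₀ + (b • X₁ + c • X₂)) * v - v * (a • X₀ + (b • X₁ + c • X₂)) = 0) →
      a = 0 ∧ b = 0 ∧ c = 0)
    (hmul : ∀ t x y, 𝒜.rep t (x * y) = 𝒜.rep t x * 𝒜.rep t y)
    (h0 : ∀ t, 𝒜.rep t X₀ = X₀)
    (h1 : ∀ t, 𝒜.rep t X₁ = (weightChar m t : ℂ).re • X₁ + (weightChar m t : ℂ).im • X₂)
    (h2 : ∀ t, 𝒜.rep t X₂ = -(weightChar m t : ℂ).im • X₁ + (weightChar m t : ℂ).re • X₂) :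
    𝒜.IsQuatWeight p (adEndomorphisms 𝒜.carrier p s) m := by
  have m0 : X₀ ∈ s := (hs _).2 ⟨1, 0, 0, by simp⟩
  have m1 : X₁ ∈ s := (hs _).2 ⟨0, 1, 0, by simp⟩
  have m2 : X₂ ∈ s := (hs _).2 ⟨0, 0, 1, by simp⟩
  let T := tangentSpaceAt 𝒜.carrier p
  let ad : s →ₗ[ℝ] T →ₗ[ℝ] T :=
    { toFun := fun X =>
        { toFun := fun v => ⟨X * v - v * X, hT X X.2 v v.2⟩
          map_add' := fun v w => Subtype.ext (by simp only [Submodule.coe_add]; noncomm_ring)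
          map_smul' := fun c v => Subtype.ext (by simp [smul_sub]) }
      map_add' := fun X Y => by
        ext v; simp only [Submodule.coe_add, LinearMap.coe_mk, AddHom.coe_mk,
          LinearMap.add_apply]; noncomm_ring
      map_smul' := fun c X => by ext v; simp [smul_sub] }
  have had : ∀ (X : s) (v : T), ((ad X v : T) : A) = X * v - v * X := fun X v => rfl
  -- The action is by algebra automorphisms, so conjugating `ad X` by `t` gives `ad` of the image of
  -- `X`.
  have hrep : ∀ t (X Y : s), 𝒜.rep t X = Y →
      (𝒜.isotropyRep hp).linHom (𝒜.isotropyRep hp) t (ad X) = ad Y := by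
    intro t X Y hXY
    ext v
    have hv : 𝒜.rep t (𝒜.rep t⁻¹ v) = v := by
      rw [← mul_apply_eq_comp, ← map_mul, mul_inv_cancel, map_one]; rfl
    change 𝒜.rep t (X * (𝒜.rep t⁻¹ v) - 𝒜.rep t⁻¹ v * X) = Y * v - v * Y
    rw [map_sub, hmul, hmul, hv, hXY]
  have hlin : ∀ a b c : ℝ, a • ad ⟨X₀, m0⟩ + (b • ad ⟨X₁, m1⟩ + c • ad ⟨X₂, m2⟩) = 0 →
      a = 0 ∧ b = 0 ∧ c = 0 := by
    intro a b c h
    refine hinj a b c fun v hv => ?_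
    have h3 : ad (a • ⟨X₀, m0⟩ + (b • ⟨X₁, m1⟩ + c • ⟨X₂, m2⟩)) = 0 := by
      simpa only [map_add, map_smul] using h
    exact congrArg Subtype.val (LinearMap.congr_fun h3 ⟨v, hv⟩)
  have hadne : ad ⟨X₀, m0⟩ ≠ 0 := by
    intro h
    have := (hlin 1 0 0 (by simp [h])).1
    exact one_ne_zero this
  refine ⟨hp, Submodule.span ℝ {ad ⟨X₀, m0⟩}, Submodule.span ℝ {ad ⟨X₁, m1⟩, ad ⟨X₂, m2⟩},
    ?_, ?_, finrank_span_singleton hadne, ?_, ad ⟨X₁, m1⟩, ad ⟨X₂, m2⟩, ?_, rfl, fun t => ⟨?_, ?_⟩⟩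
  · apply le_antisymm
    · rw [← Submodule.span_union, Submodule.span_le]
      have hmem : ∀ X : s, ad X ∈ adEndomorphisms 𝒜.carrier p s := fun X => ⟨X, X.2, had X⟩
      rintro F (rfl | rfl | rfl) <;> exact hmem _
    · rintro F ⟨X, hX, hF⟩
      have hFX : F = ad ⟨X, hX⟩ := by
        ext v; exact hF v
      obtain ⟨a, b, c, rfl⟩ := (hs X).1 hX
      have h3 : F = a • ad ⟨X₀, m0⟩ + (b • ad ⟨X₁, m1⟩ + c • ad ⟨X₂, m2⟩) := by
        rw [hFX]
        simp only [← map_smul, ← map_add]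
        rfl
      rw [h3]
      exact Submodule.add_mem_sup
        (Submodule.smul_mem _ _ (Submodule.mem_span_singleton_self _))
        (Submodule.mem_span_pair.2 ⟨b, c, rfl⟩)
  · rw [Submodule.disjoint_def]
    intro F h3 h4
    obtain ⟨a, rfl⟩ := Submodule.mem_span_singleton.1 h3
    obtain ⟨b, c, h5⟩ := Submodule.mem_span_pair.1 h4
    have := (hlin a (-b) (-c) (by rw [← h5]; module)).1
    rw [this, zero_smul]
  · intro t F hF
    obtain ⟨a, rfl⟩ := Submodule.mem_span_singleton.1 hF
    rw [map_smul, hrep t ⟨X₀, m0⟩ ⟨X₀, m0⟩ (h0 t)]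
  · rw [LinearIndependent.pair_iff]
    intro b c hbc
    exact (hlin 0 b c (by rw [zero_smul, zero_add, hbc])).2
  · rw [hrep t ⟨X₁, m1⟩ ((weightChar m t : ℂ).re • ⟨X₁, m1⟩ + (weightChar m t : ℂ).im • ⟨X₂, m2⟩)
      (h1 t), map_add, map_smul, map_smul]
  · rw [hrep t ⟨X₂, m2⟩ (-(weightChar m t : ℂ).im • ⟨X₁, m1⟩ + (weightChar m t : ℂ).re • ⟨X₂, m2⟩)
      (h2 t), map_add, map_smul, map_smul]

omit [NormedAlgebra ℝ A] in
-- An `X` in the isotropy algebra commutes with `p`, so `ad X` commutes with `v ↦ pv + vp`, whose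
-- fixed vectors contain the tangent space.
theorem commutator_add_eq {p X v : A} (hc : p * X = X * p) (hv : p * v + v * p = v) :
    p * (X * v - v * X) + (X * v - v * X) * p = X * v - v * X := by
  have h1 : p * X * v = X * p * v := by rw [hc]
  have h2 : v * (X * p) = v * (p * X) := by rw [hc]
  calc p * (X * v - v * X) + (X * v - v * X) * p
      = p * X * v - p * v * X + X * (v * p) - v * (X * p) := by noncomm_ring
    _ = X * (p * v + v * p) - (p * v + v * p) * X := by rw [h1, h2]; noncomm_ring
    _ = X * v - v * X := by rw [hv]

end QuaternionicWeights

/-! ### Permutation matrices and block reflections -/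

section UnitaryMatrices

variable {N R : Type*} [Fintype N] [DecidableEq N] [Ring R] [StarRing R]

/-- The permutation matrix of `σ`, as a unitary matrix. -/
def permUnitary (R : Type*) [Ring R] [StarRing R] (σ : Equiv.Perm N) : unitary (Matrix N N R) :=
  ⟨(1 : Matrix N N R).submatrix σ id, by
    have h : star ((1 : Matrix N N R).submatrix σ id) = (1 : Matrix N N R).submatrix id σ := by
      rw [Matrix.star_eq_conjTranspose, Matrix.conjTranspose_submatrix, Matrix.conjTranspose_one]
    rw [Unitary.mem_iff, h]
    constructor
    · rw [Matrix.submatrix_mul_equiv]; simp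
    · have := Matrix.submatrix_mul_equiv (1 : Matrix N N R) (1 : Matrix N N R) σ (Equiv.refl N) σ
      simpa using this⟩

theorem permUnitary_mul_diagonal_mul_star (σ : Equiv.Perm N) (d : N → R) :
    (permUnitary R σ : Matrix N N R) * Matrix.diagonal d * star (permUnitary R σ : Matrix N N R) =
      Matrix.diagonal (d ∘ σ) := by
  have h : star ((1 : Matrix N N R).submatrix σ id) = (1 : Matrix N N R).submatrix id σ := by
    rw [Matrix.star_eq_conjTranspose, Matrix.conjTranspose_submatrix, Matrix.conjTranspose_one]
  change (1 : Matrix N N R).submatrix σ id * Matrix.diagonal d *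
    star ((1 : Matrix N N R).submatrix σ id) = _
  rw [h]
  have h1 := Matrix.submatrix_mul_equiv (1 : Matrix N N R) (Matrix.diagonal d) σ (Equiv.refl N) id
  have h2 := Matrix.submatrix_mul_equiv (Matrix.diagonal d) (1 : Matrix N N R) σ (Equiv.refl N) σ
  simp only [Equiv.coe_refl, Matrix.submatrix_id_id, one_mul, mul_one] at h1 h2
  rw [h1, h2, Matrix.submatrix_diagonal_equiv]

variable {k l : N} {a b : R}

/-- The Hermitian matrix that is `!![a, star b; b, -a]` on the `k`-th and `l`-th coordinates and
the identity on the other ones. -/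
def blockReflection (k l : N) (a b : R) : Matrix N N R :=
  (1 - Matrix.single k k 1 - Matrix.single l l 1) + (Matrix.single k k a + Matrix.single l k b +
    Matrix.single k l (star b) - Matrix.single l l a)

omit [Fintype N] in
theorem star_blockReflection (ha : star a = a) :
    star (blockReflection k l a b) = blockReflection k l a b := by
  simp only [blockReflection, Matrix.star_eq_conjTranspose, Matrix.conjTranspose_add,
    Matrix.conjTranspose_sub, Matrix.conjTranspose_one, Matrix.conjTranspose_single, ha, star_one,
    star_star]
  abel

theorem blockReflection_mul_self (hkl : k ≠ l) (hab : a * b = b * a)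
    (hab' : a * star b = star b * a)
    (h1 : a * a + star b * b = 1) (h2 : b * star b = star b * b) :
    blockReflection k l a b * blockReflection k l a b = 1 := by
  have e1 : Matrix.single k k (1 : R) = Matrix.single k k (a * a) +
      Matrix.single k k (star b * b) := by
    rw [← Matrix.single_add, h1]
  have e2 : Matrix.single l l (1 : R) = Matrix.single l l (a * a) +
      Matrix.single l l (star b * b) := by
    rw [← Matrix.single_add, h1]
  simp only [blockReflection, mul_add, add_mul, mul_sub, sub_mul, Matrix.single_mul_single_same,
    Matrix.single_mul_single_of_ne _ _ _ _ hkl, Matrix.single_mul_single_of_ne _ _ _ _ hkl.symm,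
    mul_one, one_mul, h2, hab, hab', sub_zero, add_zero, zero_add]
  rw [e1, e2]
  abel

theorem blockReflection_mem_unitary (hkl : k ≠ l) (ha : star a = a) (hab : a * b = b * a)
    (hab' : a * star b = star b * a)
    (h1 : a * a + star b * b = 1) (h2 : b * star b = star b * b) :
    blockReflection k l a b ∈ unitary (Matrix N N R) := by
  rw [Unitary.mem_iff, star_blockReflection ha, blockReflection_mul_self hkl hab hab' h1 h2]
  exact ⟨rfl, rfl⟩

/-- The result is the rank one matrix `c c⋆`, where `c` is the `k`-th column of the reflection, with
entries `a` and `b`. -/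
theorem blockReflection_mul_single_mul (hkl : k ≠ l) :
    blockReflection k l a b * Matrix.single k k 1 * blockReflection k l a b =
      Matrix.single k k (a * a) + Matrix.single l k (b * a) + Matrix.single k l (a * star b) +
        Matrix.single l l (b * star b) := by
  simp only [blockReflection, mul_add, add_mul, mul_sub, sub_mul, Matrix.single_mul_single_same,
    Matrix.single_mul_single_of_ne _ _ _ _ hkl, Matrix.single_mul_single_of_ne _ _ _ _ hkl.symm,
    mul_one, one_mul, sub_zero, add_zero]
  abel

theorem blockReflection_mul_single_mul_of_ne {c : N} (hk : c ≠ k) (hl : c ≠ l) :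
    blockReflection k l a b * Matrix.single c c 1 * blockReflection k l a b =
      Matrix.single c c 1 := by
  simp only [blockReflection, mul_add, add_mul, mul_sub, sub_mul,
    Matrix.single_mul_single_of_ne _ _ _ _ hk, Matrix.single_mul_single_of_ne _ _ _ _ hl,
    Matrix.single_mul_single_of_ne _ _ _ _ hk.symm, Matrix.single_mul_single_of_ne _ _ _ _ hl.symm,
    mul_one, one_mul, sub_zero, add_zero]

/-- The points of the sphere through two coordinate projections are conjugate to the poles. -/
theorem exists_conj_single_eq [Algebra ℝ R] [StarModule ℝ R] (hkl : k ≠ l) {s M : ℝ} {w : R}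
    (h1 : w * star w = algebraMap ℝ R M) (h2 : star w * w = algebraMap ℝ R M) (hM : 0 ≤ M)
    (hw : M = 0 → w = 0) (hs : s ^ 2 + 4 * M = 1) :
    ∃ g ∈ unitary (Matrix N N R),
      g * Matrix.single k k 1 * star g = Matrix.single k k (algebraMap ℝ R ((1 + s) / 2)) +
        Matrix.single l l (algebraMap ℝ R ((1 - s) / 2)) + (Matrix.single k l w +
          Matrix.single l k (star w)) ∧
      ∀ c, c ≠ k → c ≠ l → g * Matrix.single c c 1 * star g = Matrix.single c c 1 := by
  have hstar : ∀ x : ℝ, star (algebraMap ℝ R x) = algebraMap ℝ R x := fun x => by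
    rw [← algebraMap_star_comm, star_trivial]
  -- The conditions on `a, b` say that the column `(a, b)` spans the line of the given projection:
  -- the diagonal entries are `a²` and `bb⋆`, and the off-diagonal entry is `ab⋆`.
  have main : ∀ (a : ℝ) (b : R), a ^ 2 = (1 + s) / 2 →
      b * star b = algebraMap ℝ R ((1 - s) / 2) → star b * b = algebraMap ℝ R ((1 - s) / 2) →
      algebraMap ℝ R a * star b = w → ∃ g ∈ unitary (Matrix N N R),
      g * Matrix.single k k 1 * star g = Matrix.single k k (algebraMap ℝ R ((1 + s) / 2)) +
        Matrix.single l l (algebraMap ℝ R ((1 - s) / 2)) + (Matrix.single k l w +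
          Matrix.single l k (star w)) ∧
      ∀ c, c ≠ k → c ≠ l → g * Matrix.single c c 1 * star g = Matrix.single c c 1 := by
    intro a b ha hb hb' hab
    have hba : b * algebraMap ℝ R a = star w := by
      rw [← hab, star_mul, star_star, hstar]
    have haa : algebraMap ℝ R a * algebraMap ℝ R a = algebraMap ℝ R ((1 + s) / 2) := by
      rw [← map_mul, ← sq, ha]
    refine ⟨blockReflection k l (algebraMap ℝ R a) b,
      blockReflection_mem_unitary hkl (hstar a) (Algebra.commutes _ _) (Algebra.commutes _ _) ?_
        (hb.trans hb'.symm), ?_, fun c hk hl => ?_⟩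
    · rw [haa, hb', ← map_add, ← map_one (algebraMap ℝ R)]
      congr 1; ring
    · rw [star_blockReflection (hstar a), blockReflection_mul_single_mul hkl, haa, hba, hab, hb]
      abel
    · rw [star_blockReflection (hstar a), blockReflection_mul_single_mul_of_ne hk hl]
  have hs1 : 0 ≤ 1 + s := by nlinarith
  rcases hs1.eq_or_lt with h0 | h0
  · have hM0 : M = 0 := by nlinarith
    have hs' : (1 - s) / 2 = 1 := by linarith
    -- At the antipodal pole `s = -1` the formula `b = w⋆/a` breaks down; exchange the two
    -- coordinates instead.
    refine main 0 1 (by rw [← h0]; simp) ?_ ?_ (by rw [hw hM0]; simp) <;>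
    · rw [hs']; simp
  · have ha0 : 0 < Real.sqrt ((1 + s) / 2) := Real.sqrt_pos.2 (by linarith)
    have ha2 : Real.sqrt ((1 + s) / 2) ^ 2 = (1 + s) / 2 := Real.sq_sqrt (by linarith)
    set a := Real.sqrt ((1 + s) / 2)
    -- Because `4M = (1 - s)(1 + s)` and `a² = (1 + s)/2`.
    have hval : a⁻¹ * a⁻¹ * M = (1 - s) / 2 := by
      have : a⁻¹ * a⁻¹ = ((1 + s) / 2)⁻¹ := by rw [← ha2, sq, mul_inv]
      rw [this]
      field_simp
      linarith
    have hsm : star (a⁻¹ • star w) = a⁻¹ • w := by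
      rw [star_smul, star_star, star_trivial a⁻¹]
    refine main a (a⁻¹ • star w) ha2 ?_ ?_ ?_
    · rw [hsm, smul_mul_smul_comm, h2, ← hval,
        map_mul _ (a⁻¹ * a⁻¹), Algebra.smul_def]
    · rw [hsm, smul_mul_smul_comm, h1, ← hval,
        map_mul _ (a⁻¹ * a⁻¹), Algebra.smul_def]
    · rw [hsm, ← Algebra.smul_def, smul_smul,
        mul_inv_cancel₀ ha0.ne', one_smul]

end UnitaryMatrices

end

noncomputable section

open NormedSpace

/-! ### Orbits of projections commuting with a complex structure -/

section Projections

variable {A : Type*} [NormedRing A] [NormedAlgebra ℝ A]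

/-- Both sides solve `G' = JG` with `G 0 = 1`: `J` is a complex structure on the range of `p` and
vanishes off it. -/
theorem exp_smul_of_mul_self_eq_neg [CompleteSpace A] {p J : A} (hJ : J * J = -p) (hpJ : J * p = J)
    (s : ℝ) : exp (s • J) = 1 + (Real.cos s - 1) • p + Real.sin s • J := by
  let G : ℝ → A := fun s => 1 + (Real.cos s - 1) • p + Real.sin s • J
  have hG : ∀ s, HasDerivAt G (J * G s) s := by
    intro s
    have h1 : HasDerivAt G (0 + (-Real.sin s) • p + Real.cos s • J) s :=
      ((hasDerivAt_const s (1 : A)).add (((Real.hasDerivAt_cos s).sub_const 1).smul_const p)).add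
        ((Real.hasDerivAt_sin s).smul_const J)
    convert! h1 using 1
    simp only [G, mul_add, mul_smul_comm, hJ, hpJ, mul_one]
    module
  have hE : ∀ s : ℝ, HasDerivAt (fun s : ℝ => exp (s • (-J))) (exp (s • (-J)) * (-J)) s :=
    fun s => hasDerivAt_exp_smul_const (-J) s
  have hconst : ∀ s, exp (s • (-J)) * G s = exp ((0 : ℝ) • (-J)) * G 0 := by
    intro s
    refine is_const_of_deriv_eq_zero (f := fun s => exp (s • (-J)) * G s)
      (fun τ => ((hE τ).mul (hG τ)).differentiableAt) (fun τ => ?_) s 0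
    refine ((hE τ).mul (hG τ)).deriv.trans ?_
    noncomm_ring
  have h1 : exp (-(s • J)) * G s = 1 := by
    have := hconst s
    simpa [G] using this
  calc exp (s • J) = exp (s • J) * (exp (-(s • J)) * G s) := by rw [h1, mul_one]
    _ = G s := by rw [← mul_assoc, exp_mul_exp_neg_self, one_mul]

theorem exp_pi_smul [CompleteSpace A] {p J : A} (hJ : J * J = -p) (hpJ : J * p = J) :
    exp (Real.pi • J) = 1 - (2 : ℝ) • p := by
  rw [exp_smul_of_mul_self_eq_neg hJ hpJ, Real.cos_pi, Real.sin_pi]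
  module

variable [StarRing A] [ContinuousStar A] [StarModule ℝ A] [FiniteDimensional ℝ A]
  [CompactSpace (unitary A)] {p₀ ι : A}

/-- The orbit of a projection that commutes with a skew-adjoint complex structure `ι` is an inner
symmetric space. -/
theorem oddBettiNumbersVanish_of_complexStructure (hs : star p₀ = p₀) (hi : p₀ * p₀ = p₀)
    (hι : ι * ι = -1) (hιs : star ι = -ι) (hιp : ι * p₀ = p₀ * ι) :
    OddBettiNumbersVanish (unitaryOrbit p₀) := by
  have _ : CompleteSpace A := FiniteDimensional.complete ℝ A
  have hJ : ι * p₀ * (ι * p₀) = -p₀ := by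
    calc ι * p₀ * (ι * p₀) = ι * (p₀ * ι) * p₀ := by noncomm_ring
      _ = ι * ι * (p₀ * p₀) := by rw [← hιp]; noncomm_ring
      _ = _ := by rw [hι, hi, neg_one_mul]
  have hJp : ι * p₀ * p₀ = ι * p₀ := by rw [mul_assoc, hi]
  have hconj : ∀ v, conjExp (Real.pi • (ι * p₀)) v =
      (1 - (2 : ℝ) • p₀) * v * (1 - (2 : ℝ) • p₀) := by
    intro v
    rw [conjExp_apply, ← smul_neg, exp_pi_smul hJ hJp, exp_pi_smul (by rw [neg_mul_neg, hJ])
      (by rw [neg_mul, hJp])]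
  -- On tangent vectors `pv + vp = v` and `pvp = 0`, so conjugation by the reflection `1 - 2p` gives
  -- `v - 2v = -v`.
  have hexp : ∀ v, (1 - (2 : ℝ) • p₀) * v * (1 - (2 : ℝ) • p₀) =
      v - (2 : ℝ) • (p₀ * v + v * p₀) + (4 : ℝ) • (p₀ * v * p₀) := by
    intro v
    simp only [sub_mul, mul_sub, smul_mul_assoc, mul_smul_comm, one_mul, mul_one]
    module
  refine oddBettiNumbersVanish_unitaryOrbit ⟨Real.pi • (ι * p₀), ?_, ?_, fun v hv => ?_⟩
  · rw [star_smul, star_mul, hs, hιs, mul_neg, hιp, smul_neg, star_trivial]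
  · rw [hconj, hexp, hi, hi]
    module
  · have h1 := ((mem_tangentSpaceAt_unitaryOrbit hs hi (mem_unitaryOrbit_self p₀)).1 hv).2
    have h2 : p₀ * v * p₀ = 0 := by
      have h3 := congrArg (p₀ * ·) h1
      simp only [mul_add, ← mul_assoc, hi] at h3
      simpa using h3
    rw [hconj, hexp, h1, h2]
    module

/-- The orbit of a projection that commutes with a complex structure `ι` is orientable. -/
theorem isOrientableSubmanifold_of_complexStructure (hs : star p₀ = p₀) (hi : p₀ * p₀ = p₀)
    (hι : ι * ι = -1) (hιp : ι * p₀ = p₀ * ι) : IsOrientableSubmanifold (unitaryOrbit p₀) := by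
  have _ : CompleteSpace A := FiniteDimensional.complete ℝ A
  -- A tangent vector is Hermitian with vanishing diagonal blocks, so it is determined by its corner
  -- in `(1 - p₀)Ap₀`, and `x + x⋆` recovers it from the corner `x`.
  let c : A →ₗ[ℝ] A := LinearMap.mulLeft ℝ (1 - p₀) ∘ₗ LinearMap.mulRight ℝ p₀
  have hc : ∀ x, c x = (1 - p₀) * (x * p₀) := fun x => rfl
  have hq : (1 - p₀) * (1 - p₀) = 1 - p₀ := by
    simp only [sub_mul, mul_sub, hi, one_mul, mul_one, sub_self, sub_zero]
  let E : Submodule ℝ A := LinearMap.range c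
  have hE : ∀ x : E, (1 - p₀) * x = x ∧ (x : A) * p₀ = x := by
    rintro ⟨_, y, rfl⟩
    simp only [hc]
    exact ⟨by rw [← mul_assoc, hq], by rw [mul_assoc, mul_assoc, hi]⟩
  have hE' : ∀ x : A, (1 - p₀) * x = x → x * p₀ = x → x ∈ E := fun x h1 h2 =>
    ⟨x, by rw [hc, h2, h1]⟩
  have hl : ∀ h : A, h * p₀ = p₀ * h → ∀ x ∈ E, h * x ∈ E := by
    intro h hh x hx
    obtain ⟨h1, h2⟩ := hE ⟨x, hx⟩
    refine hE' _ ?_ ?_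
    · have h3 : (1 - p₀) * h = h * (1 - p₀) := by rw [sub_mul, mul_sub, one_mul, mul_one, hh]
      rw [← mul_assoc, h3, mul_assoc, h1]
    · rw [mul_assoc, h2]
  have hr : ∀ h : A, h * p₀ = p₀ * h → ∀ x ∈ E, x * h ∈ E := by
    intro h hh x hx
    obtain ⟨h1, h2⟩ := hE ⟨x, hx⟩
    refine hE' _ ?_ ?_
    · rw [← mul_assoc, h1]
    · rw [mul_assoc, hh, ← mul_assoc, h2]
  let col : A →ₗ[ℝ] E := c.rangeRestrict
  have hcol : ∀ x, (col x : A) = (1 - p₀) * (x * p₀) := fun x => rfl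
  have hmem := fun v => mem_tangentSpaceAt_unitaryOrbit (v := v) hs hi (mem_unitaryOrbit_self p₀)
  have hpvp : ∀ v, p₀ * v + v * p₀ = v → p₀ * v * p₀ = 0 := by
    intro v h1
    have h3 := congrArg (p₀ * ·) h1
    simp only [mul_add, ← mul_assoc, hi] at h3
    simpa using h3
  have hcolT : ∀ v, p₀ * v + v * p₀ = v → (col v : A) = v * p₀ := by
    intro v h1
    rw [hcol, sub_mul, one_mul, ← mul_assoc, hpvp v h1, sub_zero]
  refine isOrientableSubmanifold_unitaryOrbit col ⟨fun _ _ => trivial, ?_, ?_⟩ ?_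
  · intro v hv w hw hvw
    obtain ⟨hv1, hv2⟩ := (hmem v).1 hv
    obtain ⟨hw1, hw2⟩ := (hmem w).1 hw
    have h1 : v * p₀ = w * p₀ := by
      rw [← hcolT v hv2, ← hcolT w hw2, hvw]
    have h2 : p₀ * v = p₀ * w := by
      have := congrArg star h1
      rwa [star_mul, star_mul, hs, hv1, hw1] at this
    rw [← hv2, ← hw2, h1, h2]
  · rintro x -
    obtain ⟨h1, h2⟩ := hE x
    have h3 : p₀ * (x : A) = 0 := by
      rw [sub_mul, one_mul, sub_eq_self] at h1; exact h1
    have h4 : star (x : A) * p₀ = 0 := by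
      have := congrArg star h3
      rwa [star_mul, hs, star_zero] at this
    have h5 : p₀ * star (x : A) = star (x : A) := by
      have := congrArg star h2
      rwa [star_mul, hs] at this
    have h6 : p₀ * ((x : A) + star (x : A)) + ((x : A) + star (x : A)) * p₀ =
        (x : A) + star (x : A) := by
      rw [mul_add, add_mul, h2, h3, h4, h5]; abel
    refine ⟨x + star (x : A), (hmem _).2 ⟨by rw [star_add, star_star, add_comm], h6⟩, ?_⟩
    apply Subtype.ext
    rw [hcolT _ h6, add_mul, h2, h4, add_zero]
  · intro g hg
    have hgp : (g : A) * p₀ = p₀ * g := by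
      rw [conjRep_apply] at hg
      nth_rw 2 [← hg]
      rw [mul_assoc _ (star (g : A)), Unitary.star_mul_self_of_mem g.2, mul_one]
    have hgp' : star (g : A) * p₀ = p₀ * star (g : A) := by
      have := congrArg star hgp
      rw [star_mul, star_mul, hs] at this
      exact this.symm
    let mL : ∀ h : A, h * p₀ = p₀ * h → (E →ₗ[ℝ] E) := fun h hh =>
      (LinearMap.mulLeft ℝ h).restrict (hl h hh)
    let mR : ∀ h : A, h * p₀ = p₀ * h → (E →ₗ[ℝ] E) := fun h hh =>
      (LinearMap.mulRight ℝ h).restrict (hr h hh)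
    -- The stabilizer acts by `x ↦ g⋆xg`. Since `ι` need not commute with `g`, the two factors are
    -- treated separately: left multiplication commutes with right multiplication by `ι`, and
    -- conversely.
    refine ⟨mL (star (g : A)) hgp' ∘ₗ mR g hgp, ?_, fun v => ?_⟩
    · rw [LinearMap.det_comp]
      refine mul_nonneg (det_nonneg_of_commute_complexStructure (mR ι hιp) _ ?_ ?_)
        (det_nonneg_of_commute_complexStructure (mL ι hιp) _ ?_ ?_)
      · intro x; apply Subtype.ext
        change (x : A) * ι * ι = -x
        rw [mul_assoc, hι, mul_neg_one]
      · intro x; apply Subtype.ext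
        change star (g : A) * ((x : A) * ι) = star (g : A) * x * ι
        rw [mul_assoc]
      · intro x; apply Subtype.ext
        change ι * (ι * (x : A)) = -x
        rw [← mul_assoc, hι, neg_one_mul]
      · intro x; apply Subtype.ext
        change ι * (x : A) * g = ι * (x * g)
        rw [mul_assoc]
    · apply Subtype.ext
      change (col (conjRep A g⁻¹ v) : A) = star (g : A) * ((col v : A) * g)
      rw [hcol, hcol, conjRep_apply, ← Unitary.star_eq_inv, Unitary.coe_star, star_star]
      have h7 : star (g : A) * (1 - p₀) = (1 - p₀) * star (g : A) := by
        rw [mul_sub, sub_mul, hgp', mul_one, one_mul]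
      calc (1 - p₀) * (star (g : A) * v * g * p₀)
          = (1 - p₀) * star (g : A) * v * (g * p₀) := by noncomm_ring
        _ = _ := by rw [← h7, hgp]; noncomm_ring

end Projections

/-! ### Compactness of the unitary groups -/

section CompactUnitaryGroup

variable {N R : Type*} [Fintype N] [DecidableEq N] [NormedRing R] [NormedAlgebra ℝ R]
  [FiniteDimensional ℝ R] [StarRing R] [ContinuousStar R]

omit [NormedAlgebra ℝ R] [FiniteDimensional ℝ R] [ContinuousStar R] in
-- The map `ρ` is the real part: applied to a diagonal entry of `gg⋆ = 1` it gives the sum of the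
-- squared norms of a row.
theorem norm_apply_le_one_of_mem_unitary (ρ : R →+ ℝ) (hρ : ∀ a, ρ (a * star a) = ‖a‖ ^ 2)
    (h1 : ρ 1 = 1) {g : Matrix N N R} (hg : g ∈ unitary (Matrix N N R)) (i j : N) :
    ‖g i j‖ ≤ 1 := by
  have h0 : g * star g = 1 := (Unitary.mem_iff.1 hg).2
  have h : (g * star g) i i = (1 : Matrix N N R) i i := by rw [h0]
  rw [Matrix.mul_apply, Matrix.one_apply_eq] at h
  have h2 := congrArg ρ h
  simp only [map_sum, Matrix.star_apply, hρ, h1] at h2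
  have h3 := Finset.single_le_sum (f := fun j => ‖g i j‖ ^ 2) (fun _ _ => sq_nonneg _)
    (Finset.mem_univ j)
  rw [h2] at h3
  nlinarith [norm_nonneg (g i j)]

theorem compactSpace_unitary (ρ : R →+ ℝ) (hρ : ∀ a, ρ (a * star a) = ‖a‖ ^ 2) (h1 : ρ 1 = 1) :
    CompactSpace (unitary (Matrix N N R)) := by
  have hcs : @ContinuousStar (Matrix N N R) (PseudoMetricSpace.toUniformSpace.toTopologicalSpace) _ :=
    ⟨continuous_id.matrix_conjTranspose⟩
  have _ : ProperSpace (Matrix N N R) := FiniteDimensional.proper ℝ _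
  refine isCompact_iff_compactSpace.1 (Metric.isCompact_of_isClosed_isBounded ?_ ?_)
  · have : (unitary (Matrix N N R) : Set (Matrix N N R)) =
        {g | star g * g = 1} ∩ {g | g * star g = 1} := by
      ext g; exact Unitary.mem_iff
    rw [this]
    exact (isClosed_eq (continuous_star.mul continuous_id) continuous_const).inter
      (isClosed_eq (continuous_id.mul continuous_star) continuous_const)
  · refine (Metric.isBounded_closedBall (x := (0 : Matrix N N R)) (r := Fintype.card N)).subset ?_
    intro g hg
    rw [mem_closedBall_zero_iff, Matrix.linfty_opNorm_def]
    have : (Finset.univ.sup fun i => ∑ j, ‖g i j‖₊) ≤ (Fintype.card N : NNReal) := by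
      refine Finset.sup_le fun i _ => ?_
      calc ∑ j, ‖g i j‖₊ ≤ ∑ _j : N, (1 : NNReal) := Finset.sum_le_sum fun j _ => by
            exact_mod_cast norm_apply_le_one_of_mem_unitary ρ hρ h1 hg i j
        _ = _ := by simp
    exact_mod_cast this

instance compactSpace_unitary_hMat (n : ℕ) : @CompactSpace (unitary (HMat n))
    (@instTopologicalSpaceSubtype _ _ PseudoMetricSpace.toUniformSpace.toTopologicalSpace) :=
  compactSpace_unitary ⟨⟨fun q => q.re, rfl⟩, fun _ _ => rfl⟩
    (fun a => by
      change (a * star a).re = _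
      rw [Quaternion.self_mul_star, Quaternion.re_coe, Quaternion.normSq_eq_norm_mul_self, sq]) rfl

instance compactSpace_unitary_cMat (m : ℕ) : @CompactSpace (unitary (CMat m))
    (@instTopologicalSpaceSubtype _ _ PseudoMetricSpace.toUniformSpace.toTopologicalSpace) :=
  compactSpace_unitary Complex.reAddGroupHom
    (fun a => by
      change (a * star a).re = _
      rw [Complex.star_def, Complex.mul_conj, Complex.ofReal_re, Complex.normSq_eq_norm_sq]) rfl

end CompactUnitaryGroup

instance finiteDimensional_hMat (n : ℕ) : FiniteDimensional ℝ (HMat n) := inferInstance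
instance starModule_quaternion : StarModule ℝ ℍ[ℝ] := ⟨fun c x => Quaternion.star_smul c x⟩
instance starModule_hMat (n : ℕ) : StarModule ℝ (HMat n) := inferInstance
instance finiteDimensional_cMat (n : ℕ) : FiniteDimensional ℝ (CMat n) := inferInstance
instance starModule_cMat (n : ℕ) : StarModule ℝ (CMat n) := inferInstance

end

noncomputable section

/-! ### Complex components of quaternions -/

section QuaternionParts

/-- The two complex components `z, w` of a quaternion `z + w j`. -/
def quatPart : Bool → ℍ[ℝ] →ₗ[ℝ] ℂ
  | false => { toFun := fun q => ⟨q.re, q.imI⟩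
               map_add' := fun p q => rfl
               map_smul' := fun c q => by apply Complex.ext <;> simp }
  | true => { toFun := fun q => ⟨q.imJ, q.imK⟩
              map_add' := fun p q => rfl
              map_smul' := fun c q => by apply Complex.ext <;> simp }

/-- The inclusions `z ↦ z` and `z ↦ z j` of the complex numbers into the quaternions. -/
def quatEmb : Bool → ℂ →ₗ[ℝ] ℍ[ℝ]
  | false => { toFun := fun z => ⟨z.re, z.im, 0, 0⟩
               map_add' := fun p q => by
                ext
                exacts [rfl, rfl, (add_zero (0 : ℝ)).symm, (add_zero (0 : ℝ)).symm]
               map_smul' := fun c q => by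
                ext
                exacts [Complex.re_ofReal_mul c q, Complex.im_ofReal_mul c q, (mul_zero c).symm,
                  (mul_zero c).symm] }
  | true => { toFun := fun z => ⟨0, 0, z.re, z.im⟩
              map_add' := fun p q => by
                ext
                exacts [(add_zero (0 : ℝ)).symm, (add_zero (0 : ℝ)).symm, rfl, rfl]
              map_smul' := fun c q => by
                ext
                exacts [(mul_zero c).symm, (mul_zero c).symm, Complex.re_ofReal_mul c q,
                  Complex.im_ofReal_mul c q] }

section
variable (z : ℂ) (q : ℍ[ℝ])

@[simp] theorem quatEmb_false_re : (quatEmb false z).re = z.re := rfl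
@[simp] theorem quatEmb_false_imI : (quatEmb false z).imI = z.im := rfl
@[simp] theorem quatEmb_false_imJ : (quatEmb false z).imJ = 0 := rfl
@[simp] theorem quatEmb_false_imK : (quatEmb false z).imK = 0 := rfl
@[simp] theorem quatEmb_true_re : (quatEmb true z).re = 0 := rfl
@[simp] theorem quatEmb_true_imI : (quatEmb true z).imI = 0 := rfl
@[simp] theorem quatEmb_true_imJ : (quatEmb true z).imJ = z.re := rfl
@[simp] theorem quatEmb_true_imK : (quatEmb true z).imK = z.im := rfl
@[simp] theorem quatPart_false_re : (quatPart false q).re = q.re := rfl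
@[simp] theorem quatPart_false_im : (quatPart false q).im = q.imI := rfl
@[simp] theorem quatPart_true_re : (quatPart true q).re = q.imJ := rfl
@[simp] theorem quatPart_true_im : (quatPart true q).im = q.imK := rfl

end

theorem quatPart_quatEmb (b : Bool) (z : ℂ) : quatPart b (quatEmb b z) = z := by
  cases b <;> rfl

theorem quatPart_quatEmb_of_ne {b b' : Bool} (h : b ≠ b') (z : ℂ) :
    quatPart b (quatEmb b' z) = 0 := by
  cases b <;> cases b' <;> first | exact absurd rfl h | rfl

theorem quat_eq_zero_of_parts {q : ℍ[ℝ]} (h : ∀ b, quatPart b q = 0) : q = 0 := by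
  have h1 := h false
  have h2 := h true
  ext
  exacts [congrArg Complex.re h1, congrArg Complex.im h1, congrArg Complex.re h2,
    congrArg Complex.im h2]

theorem quatEmb_quatPart {q : ℍ[ℝ]} {b : Bool} (h : quatPart (!b) q = 0) :
    quatEmb b (quatPart b q) = q := by
  have h1 := (congrArg Complex.re h).symm
  have h2 := (congrArg Complex.im h).symm
  cases b <;> ext
  exacts [rfl, rfl, h1, h2, h1, h2, rfl, rfl]

theorem normSq_quatEmb (b : Bool) (z : ℂ) : Quaternion.normSq (quatEmb b z) = Complex.normSq z := by
  cases b <;> simp [Quaternion.normSq_def', Complex.normSq_apply] <;> ring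

/-- The character by which the pair `θ, θ'` acts on a complex component of a quaternion. -/
def quatChar (b : Bool) (θ θ' : Circle) : Circle := θ * bif b then θ' else θ'⁻¹

/-- Moving `star θ'` to the left past `j` conjugates it. Hence the two components see `θθ'⁻¹` and
`θθ'`, the source of the double edges. -/
theorem mul_quatEmb_mul (b : Bool) (θ θ' : Circle) (z : ℂ) :
    ((θ : ℂ) : ℍ[ℝ]) * quatEmb b z * star ((θ' : ℂ) : ℍ[ℝ]) =
      quatEmb b ((quatChar b θ θ' : ℂ) * z) := by
  cases b <;> ext <;> simp [quatChar] <;> ring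

theorem quatPart_mul (b : Bool) (θ θ' : Circle) (q : ℍ[ℝ]) :
    quatPart b (((θ : ℂ) : ℍ[ℝ]) * q * star ((θ' : ℂ) : ℍ[ℝ])) =
      (quatChar b θ θ' : ℂ) * quatPart b q := by
  cases b <;> apply Complex.ext <;> simp [quatChar] <;> ring

end QuaternionParts

/-! ### Edges, coordinates and spheres in quaternionic projective space -/

section ProjectiveSpace

variable {r n : ℕ}

namespace HPEdge

/-- The row of the matrix entry that belongs to an edge. -/
def row : HPEdge n → Fin (n + 1)
  | .zero _ _ => 0
  | .succ _ l _ _ => l.succ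

/-- The column of the matrix entry that belongs to an edge. -/
def col : HPEdge n → Fin (n + 1)
  | .zero k _ => k.succ
  | .succ k _ _ _ => k.succ

/-- The Boolean that distinguishes the two edges of a biangle. -/
def tag : HPEdge n → Bool
  | .zero _ b => b
  | .succ _ _ _ b => b

theorem row_ne_col (e : HPEdge n) : e.row ≠ e.col := by
  cases e with
  | zero k b => exact (Fin.succ_ne_zero k).symm
  | succ k l h b => exact fun he => h.ne (Fin.succ_injective _ he).symm

theorem ext' {e f : HPEdge n} (h1 : e.row = f.row) (h2 : e.col = f.col) (h3 : e.tag = f.tag) :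
    e = f := by
  cases e <;> cases f <;> simp_all [row, col, tag, Fin.succ_ne_zero]
  exact absurd h1.symm (Fin.succ_ne_zero _)

/-- Each pair of indices occurs in one orientation only: `0` is always a row, and among positive
indices the larger one is. So distinct edges have distinct coordinates. -/
theorem not_swap (e f : HPEdge n) (h1 : e.row = f.col) (h2 : e.col = f.row) : False := by
  cases e <;> cases f <;> simp only [row, col] at h1 h2
  · exact Fin.succ_ne_zero _ h1.symm
  · exact Fin.succ_ne_zero _ h1.symm
  · exact Fin.succ_ne_zero _ h2
  · rename_i h _ _ _ h' _
    have := Fin.succ_injective _ h1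
    have := Fin.succ_injective _ h2
    subst_vars
    exact absurd h (not_lt.2 h'.le)

theorem exists_of_ne {i j : Fin (n + 1)} (h : i ≠ j) :
    (∀ b, ∃ e : HPEdge n, e.row = i ∧ e.col = j ∧ e.tag = b) ∨
      ∀ b, ∃ e : HPEdge n, e.row = j ∧ e.col = i ∧ e.tag = b := by
  induction i using Fin.cases with
  | zero =>
    induction j using Fin.cases with
    | zero => exact absurd rfl h
    | succ l => exact Or.inl fun b => ⟨.zero l b, rfl, rfl, rfl⟩
  | succ k =>
    induction j using Fin.cases with
    | zero => exact Or.inr fun b => ⟨.zero k b, rfl, rfl, rfl⟩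
    | succ l =>
      rcases lt_trichotomy k l with hkl | rfl | hkl
      · exact Or.inr fun b => ⟨.succ k l hkl b, rfl, rfl, rfl⟩
      · exact absurd rfl h
      · exact Or.inl fun b => ⟨.succ l k hkl b, rfl, rfl, rfl⟩

/-- The other edge of the biangle. -/
def other : HPEdge n → HPEdge n
  | .zero k b => .zero k !b
  | .succ k l h b => .succ k l h !b

theorem other_row (e : HPEdge n) : e.other.row = e.row := by cases e <;> rfl
theorem other_col (e : HPEdge n) : e.other.col = e.col := by cases e <;> rfl
theorem other_tag (e : HPEdge n) : e.other.tag = !e.tag := by cases e <;> rfl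

theorem other_ne (e : HPEdge n) : e.other ≠ e := fun h => by
  have := congrArg tag h
  rw [other_tag] at this
  simp at this

instance : Finite (HPEdge n) :=
  Finite.of_injective (fun e : HPEdge n => (e.row, e.col, e.tag)) fun e f h => by
    simp only [Prod.mk.injEq] at h
    exact ext' h.1 h.2.1 h.2.2

end HPEdge

theorem hpGraph_ends (lam : Fin r → ℤ) (α : Fin n → Fin r → ℤ) (e : HPEdge n) :
    (hpGraph n lam α).ends e = s(e.row, e.col) := by
  cases e with
  | zero k b => rfl
  | succ k l h b => exact Sym2.eq_swap

theorem star_hpPoint (k : Fin (n + 1)) : star (hpPoint n k) = hpPoint n k := by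
  rw [hpPoint, Matrix.star_eq_conjTranspose, Matrix.conjTranspose_single, star_one]

theorem hpPoint_mul_self (k : Fin (n + 1)) : hpPoint n k * hpPoint n k = hpPoint n k := by
  rw [hpPoint, Matrix.single_mul_single_same, one_mul]

theorem quat_mul_star (w : ℍ[ℝ]) : w * star w = algebraMap ℝ ℍ[ℝ] (Quaternion.normSq w) :=
  Quaternion.self_mul_star w

theorem quat_star_mul (w : ℍ[ℝ]) : star w * w = algebraMap ℝ ℍ[ℝ] (Quaternion.normSq w) :=
  Quaternion.star_mul_self w

/-- The off-diagonal Hermitian matrices, parametrized by a complex component of an entry. -/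
def hpZ (i j : Fin (n + 1)) (b : Bool) : ℂ →ₗ[ℝ] HMat n where
  toFun z := Matrix.single i j (quatEmb b ((1 / 2 : ℝ) • z)) +
    Matrix.single j i (star (quatEmb b ((1 / 2 : ℝ) • z)))
  map_add' z w := by
    simp only [smul_add, map_add, star_add, Matrix.single_add]; abel
  map_smul' c z := by
    simp only [smul_comm _ c, map_smul, star_smul, star_trivial, smul_add, RingHom.id_apply]
    rw [Matrix.smul_single, Matrix.smul_single]

/-- Twice a complex component of a matrix entry. -/
def hpPi (i j : Fin (n + 1)) (b : Bool) : HMat n →ₗ[ℝ] ℂ :=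
  (2 : ℝ) • (quatPart b ∘ₗ Matrix.entryLinearMap ℝ ℍ[ℝ] i j)

theorem hpPi_apply (i j : Fin (n + 1)) (b : Bool) (x : HMat n) :
    hpPi i j b x = (2 : ℝ) • quatPart b (x i j) := rfl

theorem hpPi_hpZ {i j : Fin (n + 1)} (h : i ≠ j) (b : Bool) (z : ℂ) :
    hpPi i j b (hpZ i j b z) = z := by
  rw [hpPi_apply]
  simp only [hpZ, LinearMap.coe_mk, AddHom.coe_mk, Matrix.add_apply, Matrix.single_apply_same]
  rw [Matrix.single_apply_of_ne _ _ _ _ _ (fun h' => h h'.2), add_zero, quatPart_quatEmb]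
  module

theorem hpPi_hpZ_of_ne {e f : HPEdge n} (h : e ≠ f) (z : ℂ) :
    hpPi f.row f.col f.tag (hpZ e.row e.col e.tag z) = 0 := by
  rw [hpPi_apply]
  simp only [hpZ, LinearMap.coe_mk, AddHom.coe_mk, Matrix.add_apply]
  rw [Matrix.single_apply_of_ne _ _ _ f.row f.col
    (fun h' => HPEdge.not_swap e f h'.2 h'.1), add_zero]
  by_cases h1 : e.row = f.row ∧ e.col = f.col
  · rw [← h1.1, ← h1.2, Matrix.single_apply_same, quatPart_quatEmb_of_ne, smul_zero]
    exact fun h2 => h (HPEdge.ext' h1.1 h1.2 h2.symm)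
  · rw [Matrix.single_apply_of_ne _ _ _ _ _ h1, map_zero, smul_zero]

theorem spherePoint_hp (i j : Fin (n + 1)) (b : Bool) (s : ℝ) (z : ℂ) :
    spherePoint (hpPoint n i) (hpPoint n j) (hpZ i j b) s z =
      Matrix.single i i (algebraMap ℝ ℍ[ℝ] ((1 + s) / 2)) +
        Matrix.single j j (algebraMap ℝ ℍ[ℝ] ((1 - s) / 2)) +
          (Matrix.single i j (quatEmb b ((1 / 2 : ℝ) • z)) +
            Matrix.single j i (star (quatEmb b ((1 / 2 : ℝ) • z)))) := by
  have h : ∀ (k : Fin (n + 1)) (c : ℝ),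
      Matrix.single k k (algebraMap ℝ ℍ[ℝ] c) = c • hpPoint n k := by
    intro k c
    rw [hpPoint, Matrix.smul_single, Algebra.algebraMap_eq_smul_one]
  rw [h, h]
  simp only [spherePoint, hpZ, LinearMap.coe_mk, AddHom.coe_mk]
  module

theorem normSq_quatEmb_half (b : Bool) (z : ℂ) :
    4 * Quaternion.normSq (quatEmb b ((1 / 2 : ℝ) • z)) = Complex.normSq z := by
  rw [normSq_quatEmb, Complex.real_smul, map_mul, Complex.normSq_ofReal]
  ring

theorem conj_mem_HP {g x : HMat n} (hg : g ∈ unitary (HMat n)) (hx : x ∈ HP n) :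
    g * x * star g ∈ HP n := by
  have := conjRep_mem_unitaryOrbit (hpPoint n 0) ⟨g, hg⟩ x hx
  rwa [conjRep_apply] at this

theorem hpPoint_mem (k : Fin (n + 1)) : hpPoint n k ∈ HP n := by
  by_cases hk : 0 = k
  · rw [← hk]; exact mem_unitaryOrbit_self _
  -- The opposite pole `s = -1` of a sphere through the base point.
  · obtain ⟨g, hg, h1, -⟩ := exists_conj_single_eq (R := ℍ[ℝ]) hk (s := -1) (M := 0) (w := 0)
      (by simp) (by simp) le_rfl (fun _ => rfl) (by norm_num)
    have h2 : hpPoint n k = g * hpPoint n 0 * star g := by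
      rw [hpPoint, hpPoint, h1]
      norm_num
    rw [h2]
    exact conj_mem_HP hg (mem_unitaryOrbit_self _)

theorem sphereSet_subset_HP {i j : Fin (n + 1)} (h : i ≠ j) (b : Bool) :
    sphereSet (hpPoint n i) (hpPoint n j) (hpZ i j b) ⊆ HP n := by
  rintro _ ⟨s, z, hs, rfl⟩
  obtain ⟨g, hg, h1, -⟩ := exists_conj_single_eq (R := ℍ[ℝ]) h (s := s)
    (w := quatEmb b ((1 / 2 : ℝ) • z)) (quat_mul_star _) (quat_star_mul _)
    Quaternion.normSq_nonneg (fun h => Quaternion.normSq_eq_zero.1 h)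
    (by rw [normSq_quatEmb_half, hs])
  rw [spherePoint_hp, ← h1]
  exact conj_mem_HP hg (hpPoint_mem i)

/-- With `q` the column of `g` of index `0`, conjugation gives `x = q q⋆`; these are homogeneous
coordinates. -/
theorem exists_vector_of_mem_HP {x : HMat n} (hx : x ∈ HP n) : ∃ q : Fin (n + 1) → ℍ[ℝ],
    (∀ i j, x i j = q i * star (q j)) ∧ ∑ i, Quaternion.normSq (q i) = 1 := by
  obtain ⟨g, rfl⟩ := hx
  refine ⟨fun i => (g : HMat n) i 0, fun i j => ?_, ?_⟩
  · rw [conjRep_apply, hpPoint, Matrix.mul_apply, Finset.sum_eq_single 0]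
    · rw [Matrix.mul_single_apply_same, mul_one, Matrix.star_apply]
    · intro k _ hk
      rw [Matrix.mul_single_apply_of_ne _ _ _ _ _ hk, zero_mul]
    · simp
  · have h : (star (g : HMat n) * g) 0 0 = (1 : HMat n) 0 0 := by
      rw [Unitary.star_mul_self_of_mem g.2]
    rw [Matrix.mul_apply, Matrix.one_apply_eq] at h
    simp only [Matrix.star_apply, quat_star_mul, ← map_sum] at h
    rw [← map_one (algebraMap ℝ ℍ[ℝ])] at h
    exact (algebraMap ℝ ℍ[ℝ]).injective h

end ProjectiveSpace

end

noncomputable section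

/-! ### Diagonal actions on quaternionic projective space -/

section ProjectiveSpaceActions

variable {r n : ℕ}

/-- The matrix `diag(θ₀, …, θₙ)`. -/
abbrev hpDiag (θ : Fin (n + 1) → Circle) : HMat n :=
  Matrix.diagonal fun i => ((θ i : ℂ) : ℍ[ℝ])

theorem hpDiag_mul_mul_star_apply (θ : Fin (n + 1) → Circle) (x : HMat n) (i j : Fin (n + 1)) :
    (hpDiag θ * x * star (hpDiag θ)) i j =
      ((θ i : ℂ) : ℍ[ℝ]) * x i j * star ((θ j : ℂ) : ℍ[ℝ]) := by
  rw [Matrix.star_eq_conjTranspose, Matrix.diagonal_conjTranspose, Matrix.mul_diagonal,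
    Matrix.diagonal_mul]
  rfl

theorem circle_mul_star (θ : Circle) : ((θ : ℂ) : ℍ[ℝ]) * star ((θ : ℂ) : ℍ[ℝ]) = 1 := by
  rw [Quaternion.self_mul_star]
  have : Quaternion.normSq ((θ : ℂ) : ℍ[ℝ]) = 1 := by
    rw [Quaternion.normSq_def']
    simpa [Complex.normSq_apply, sq] using Circle.normSq_coe θ
  rw [this, Quaternion.coe_one]

theorem circle_star_mul (θ : Circle) : star ((θ : ℂ) : ℍ[ℝ]) * ((θ : ℂ) : ℍ[ℝ]) = 1 := by
  rw [Quaternion.star_mul_self, ← Quaternion.self_mul_star, circle_mul_star]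

theorem hpDiag_mem_unitary (θ : Fin (n + 1) → Circle) : hpDiag θ ∈ unitary (HMat n) := by
  rw [Unitary.mem_iff, Matrix.star_eq_conjTranspose, Matrix.diagonal_conjTranspose,
    Matrix.diagonal_mul_diagonal, Matrix.diagonal_mul_diagonal, ← Matrix.diagonal_one]
  exact ⟨congrArg _ (funext fun i => circle_star_mul (θ i)),
    congrArg _ (funext fun i => circle_mul_star (θ i))⟩

theorem hpDiag_mul_single_mul_star (θ : Fin (n + 1) → Circle) (i j : Fin (n + 1)) (q : ℍ[ℝ]) :
    hpDiag θ * Matrix.single i j q * star (hpDiag θ) =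
      Matrix.single i j (((θ i : ℂ) : ℍ[ℝ]) * q * star ((θ j : ℂ) : ℍ[ℝ])) := by
  ext1 k l
  rw [hpDiag_mul_mul_star_apply]
  by_cases h : i = k ∧ j = l
  · obtain ⟨rfl, rfl⟩ := h
    rw [Matrix.single_apply_same, Matrix.single_apply_same]
  · rw [Matrix.single_apply_of_ne _ _ _ _ _ h, Matrix.single_apply_of_ne _ _ _ _ _ h, mul_zero,
      zero_mul]

/-- `θ` is a diagonal lift of the element of `Sp(n+1)/ℤ₂`. -/
def IsDiagLift (g : SpGroupMod n) (θ : Fin (n + 1) → Circle) : Prop :=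
  g = ((⟨hpDiag θ, hpDiag_mem_unitary θ⟩ : SpGroup n) : SpGroupMod n)

theorem exists_isDiagLift {φ : Torus r →ₜ* SpGroupMod n}
    (hφ : ∀ t, ∃ g ∈ spDiagonalTorus n, φ t = (g : SpGroupMod n)) (t : Torus r) :
    ∃ θ, IsDiagLift (φ t) θ := by
  obtain ⟨g, ⟨θ, hθ⟩, hg⟩ := hφ t
  refine ⟨θ, hg.trans ?_⟩
  congr 1
  exact Subtype.ext hθ

theorem hpAction_rep {φ : Torus r →ₜ* SpGroupMod n} {t : Torus r} {θ : Fin (n + 1) → Circle}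
    (h : IsDiagLift (φ t) θ) (x : HMat n) :
    (hpAction φ).rep t x = hpDiag θ * x * star (hpDiag θ) := by
  change conjRepMod (HMat n) (φ t) x = _
  rw [h]
  change conjRep (HMat n) ⟨hpDiag θ, hpDiag_mem_unitary θ⟩ x = _
  rw [conjRep_apply]

theorem hpPoint_mem_fixedPoints {φ : Torus r →ₜ* SpGroupMod n}
    (hφ : ∀ t, ∃ θ, IsDiagLift (φ t) θ) (k : Fin (n + 1)) :
    hpPoint n k ∈ (hpAction φ).fixedPoints := by
  refine ⟨hpPoint_mem k, fun t => ?_⟩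
  obtain ⟨θ, hθ⟩ := hφ t
  rw [hpAction_rep hθ, hpPoint, hpDiag_mul_single_mul_star, mul_one, circle_mul_star]

/-- The weights of a diagonal action in terms of `λ` and the `αₖ`. -/
def HPWeights (φ : Torus r →ₜ* SpGroupMod n) (lam : Fin r → ℤ) (α : Fin n → Fin r → ℤ) : Prop :=
  ∀ t, ∃ θ, IsDiagLift (φ t) θ ∧ θ 0 * θ 0 = weightChar lam t ∧
    ∀ k, θ 0 * (θ k.succ)⁻¹ = weightChar (α k) t

/-- In terms of `λ = θ₀²` and `αₖ = θ₀/θₖ`: `θ₀θₖ = λ/αₖ`, `θₗ/θₖ = αₖ/αₗ` and `θₗθₖ = λ/(αₖαₗ)`.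
The larger index is chosen as row to obtain `αₖ - αₗ` with the right sign. -/
theorem quatChar_eq_weightChar_label {lam : Fin r → ℤ} {α : Fin n → Fin r → ℤ} {t : Torus r}
    {θ : Fin (n + 1) → Circle} (h0 : θ 0 * θ 0 = weightChar lam t)
    (hα : ∀ k, θ 0 * (θ k.succ)⁻¹ = weightChar (α k) t) (e : HPEdge n) :
    quatChar e.tag (θ e.row) (θ e.col) = weightChar ((hpGraph n lam α).label e) t := by
  rcases e with ⟨k, _ | _⟩ | ⟨k, l, h, _ | _⟩ <;>
    simp only [hpGraph, HPEdge.row, HPEdge.col, HPEdge.tag, quatChar, weightChar_sub, ← h0, ← hα,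
      cond_true, cond_false, mul_inv_rev, inv_inv]
  · rw [mul_comm (θ k.succ), mul_assoc, mul_inv_cancel_left]
  · rw [mul_comm (θ 0) (θ k.succ)⁻¹, mul_comm (θ l.succ) (θ 0)⁻¹, mul_assoc, mul_inv_cancel_left,
      mul_comm]
  · have h1 : ∀ a b c : Circle, a * b = c * c * (b * c⁻¹) * (a * c⁻¹) := fun a b c => by
      rw [mul_mul_mul_comm c c b, mul_inv_cancel, mul_one, mul_comm c b, mul_mul_mul_comm b c a,
        mul_inv_cancel, mul_one, mul_comm]
    exact h1 _ _ _

theorem hpGraph_mem_ends (lam : Fin r → ℤ) (α : Fin n → Fin r → ℤ) (e : HPEdge n)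
    (i : Fin (n + 1)) :
    (show (hpGraph n lam α).Vertex from i) ∈ (hpGraph n lam α).ends e ↔ i = e.row ∨ i = e.col := by
  rw [hpGraph_ends]
  exact Sym2.mem_iff

theorem tangent_hp_iff {k : Fin (n + 1)} {v : HMat n} :
    v ∈ tangentSpaceAt (HP n) (hpPoint n k) ↔ star v = v ∧
      hpPoint n k * v + v * hpPoint n k = v := by
  have _ : CompleteSpace (HMat n) := FiniteDimensional.complete ℝ _
  exact mem_tangentSpaceAt_unitaryOrbit (star_hpPoint 0) (hpPoint_mul_self 0) (hpPoint_mem k)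

/-- Tangent vectors live in the off-diagonal blocks, here the `k`-th row and column without the
diagonal entry. -/
theorem tangent_hp_apply_eq_zero {k : Fin (n + 1)} {v : HMat n}
    (hv : v ∈ tangentSpaceAt (HP n) (hpPoint n k)) {i j : Fin (n + 1)} (h : i ≠ k ↔ j ≠ k) :
    v i j = 0 := by
  have h1 := congrFun (congrFun (tangent_hp_iff.1 hv).2 i) j
  rw [Matrix.add_apply, hpPoint] at h1
  by_cases hi : i = k
  · have hj : j = k := not_not.1 fun hj => (h.2 hj) hi
    subst hi hj
    rw [Matrix.single_mul_apply_same, Matrix.mul_single_apply_same, one_mul, mul_one] at h1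
    simpa using h1
  · have hj := h.1 hi
    rw [Matrix.single_mul_apply_of_ne _ _ _ _ _ hi, Matrix.mul_single_apply_of_ne _ _ _ _ _ hj,
      add_zero] at h1
    exact h1.symm

theorem single_add_single_mem_tangent {k l : Fin (n + 1)} (h : k ≠ l) (q : ℍ[ℝ]) :
    Matrix.single k l q + Matrix.single l k (star q) ∈
      tangentSpaceAt (HP n) (hpPoint n k) := by
  rw [tangent_hp_iff]
  constructor
  · rw [star_add, Matrix.star_eq_conjTranspose, Matrix.star_eq_conjTranspose,
      Matrix.conjTranspose_single, Matrix.conjTranspose_single, star_star, add_comm]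
  · rw [hpPoint, mul_add, add_mul, Matrix.single_mul_single_same, Matrix.single_mul_single_same,
      Matrix.single_mul_single_of_ne _ _ _ _ h, Matrix.single_mul_single_of_ne _ _ _ _ h.symm,
      one_mul, mul_one, add_zero, zero_add]

/-- A point of `ℍPⁿ` all of whose independent weights coincide lies on one of the spheres. -/
theorem exists_sphere_of_mem_HP (lam : Fin r → ℤ) (α : Fin n → Fin r → ℤ)
    (hpi : (hpGraph n lam α).PairwiseIndependent) {x : HMat n} (hx : x ∈ HP n)
    (hdep : ∀ e f : HPEdge n, hpPi e.row e.col e.tag x ≠ 0 → hpPi f.row f.col f.tag x ≠ 0 →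
      ¬ LinearIndependent ℤ ![(hpGraph n lam α).label e, (hpGraph n lam α).label f]) :
    x ∈ Set.range (hpPoint n) ∨ ∃ e : HPEdge n,
      x ∈ sphereSet (hpPoint n e.row) (hpPoint n e.col) (hpZ e.row e.col e.tag) := by
  obtain ⟨q, hq, hsum⟩ := exists_vector_of_mem_HP hx
  -- Two nonzero homogeneous coordinates make the entry between them nonzero, hence one of its two
  -- complex components.
  have hact : ∀ i j, i ≠ j → q i ≠ 0 → q j ≠ 0 →
      ∃ e : HPEdge n, hpPi e.row e.col e.tag x ≠ 0 ∧
        (e.row = i ∧ e.col = j ∨ e.row = j ∧ e.col = i) := by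
    intro i j hij hi hj
    have hne : ∀ i j, q i ≠ 0 → q j ≠ 0 → ∃ b, hpPi i j b x ≠ 0 := by
      intro i j hi hj
      by_contra! hall
      have h0 : x i j = 0 := quat_eq_zero_of_parts fun b => by
        have := hall b
        rw [hpPi_apply, smul_eq_zero] at this
        exact this.resolve_left two_ne_zero
      rw [hq, mul_eq_zero, star_eq_zero] at h0
      exact h0.elim hi hj
    rcases HPEdge.exists_of_ne hij with h | h
    · obtain ⟨b, hb⟩ := hne i j hi hj
      obtain ⟨e, h1, h2, h3⟩ := h b
      exact ⟨e, by rwa [h1, h2, h3], Or.inl ⟨h1, h2⟩⟩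
    · obtain ⟨b, hb⟩ := hne j i hj hi
      obtain ⟨e, h1, h2, h3⟩ := h b
      exact ⟨e, by rwa [h1, h2, h3], Or.inr ⟨h1, h2⟩⟩
  -- Edges with nonzero coordinate and a common vertex coincide, as their labels would otherwise be
  -- independent.
  have hadj : ∀ e f : HPEdge n, hpPi e.row e.col e.tag x ≠ 0 → hpPi f.row f.col f.tag x ≠ 0 →
      ∀ i, (i = e.row ∨ i = e.col) → (i = f.row ∨ i = f.col) → e = f := by
    intro e f he hf i hie hif
    by_contra hne
    refine hdep e f he hf (hpi i e f ?_ ?_ hne)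
    · exact (hpGraph_mem_ends lam α e i).2 hie
    · exact (hpGraph_mem_ends lam α f i).2 hif
  obtain ⟨i, hi⟩ : ∃ i, q i ≠ 0 := by
    by_contra! hall
    simp [hall] at hsum
  by_cases hall : ∀ j, j ≠ i → q j = 0
  · left
    refine ⟨i, ?_⟩
    have h1 : Quaternion.normSq (q i) = 1 := by
      rw [← hsum, Finset.sum_eq_single i (fun j _ hj => by rw [hall j hj, map_zero]) (by simp)]
    ext1 a b
    rw [hq, hpPoint]
    by_cases h : i = a ∧ i = b
    · obtain ⟨rfl, rfl⟩ := h
      rw [Matrix.single_apply_same, quat_mul_star, h1, map_one]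
    · rw [Matrix.single_apply_of_ne _ _ _ _ _ h]
      rw [not_and_or] at h
      rcases h with h | h
      · rw [hall a (Ne.symm h), zero_mul]
      · rw [hall b (Ne.symm h), star_zero, mul_zero]
  · right
    push Not at hall
    obtain ⟨j, hji, hj⟩ := hall
    obtain ⟨e, he, hends⟩ := hact i j hji.symm hi hj
    -- A third nonzero homogeneous coordinate would yield another such edge at `i`.
    have hzero : ∀ k, k ≠ e.row → k ≠ e.col → q k = 0 := by
      intro k hk1 hk2
      by_contra hk
      have hki : k ≠ i := by rcases hends with h | h <;> [exact h.1 ▸ hk1; exact h.2 ▸ hk2]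
      obtain ⟨f, hf, hfends⟩ := hact k i hki hk hi
      have hie : i = e.row ∨ i = e.col := by
        rcases hends with h | h <;> [exact Or.inl h.1.symm; exact Or.inr h.2.symm]
      have hif : i = f.row ∨ i = f.col := by
        rcases hfends with h | h <;> [exact Or.inr h.2.symm; exact Or.inl h.1.symm]
      have hef := hadj e f he hf i hie hif
      subst hef
      rcases hfends with h | h <;> [exact hk1 h.1.symm; exact hk2 h.2.symm]
    refine ⟨e, ?_⟩
    have hother : hpPi e.row e.col (!e.tag) x = 0 := by
      by_contra hne
      have h1 : hpPi e.other.row e.other.col e.other.tag x ≠ 0 := by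
        rwa [HPEdge.other_row, HPEdge.other_col, HPEdge.other_tag]
      exact HPEdge.other_ne e (hadj e.other e h1 he e.row (Or.inl (HPEdge.other_row e).symm)
        (Or.inl rfl))
    have hrc := HPEdge.row_ne_col e
    generalize e.row = i at *
    generalize e.col = j at *
    generalize e.tag = b at *
    have hsum2 : Quaternion.normSq (q i) + Quaternion.normSq (q j) = 1 := by
      rw [← hsum, ← Finset.sum_pair (f := fun i => Quaternion.normSq (q i)) hrc]
      refine (Finset.sum_subset (Finset.subset_univ _) fun k _ hk => ?_)
      simp only [Finset.mem_insert, Finset.mem_singleton, not_or] at hk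
      rw [hzero k hk.1 hk.2, map_zero]
    have hemb : quatEmb b ((1 / 2 : ℝ) • hpPi i j b x) = x i j := by
      have h1 : quatPart (!b) (x i j) = 0 := by
        rw [hpPi_apply, smul_eq_zero] at hother
        exact hother.resolve_left two_ne_zero
      rw [hpPi_apply, smul_smul, ← quatEmb_quatPart h1]
      norm_num [quatPart_quatEmb]
    -- The diagonal entries of a sphere point are `(1 ± s)/2`, which fixes the height.
    refine ⟨2 * Quaternion.normSq (q i) - 1, hpPi i j b x, ?_, ?_⟩
    · rw [← normSq_quatEmb_half b, hemb, hq, map_mul, Quaternion.normSq_star]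
      have : Quaternion.normSq (q j) = 1 - Quaternion.normSq (q i) := by linarith
      rw [this]; ring
    · rw [spherePoint_hp, hemb]
      have e1 : (1 + (2 * Quaternion.normSq (q i) - 1)) / 2 = Quaternion.normSq (q i) := by ring
      have e2 : (1 - (2 * Quaternion.normSq (q i) - 1)) / 2 = Quaternion.normSq (q j) := by
        linarith
      rw [e1, e2, ← quat_mul_star, ← quat_mul_star]
      have hs : star (x i j) = x j i := by rw [hq, hq, star_mul, star_star]
      rw [hs, ← hq, ← hq]
      ext1 a c
      simp only [Matrix.add_apply, Matrix.single_apply]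
      by_cases ha : i = a
      · subst ha
        by_cases hc : i = c
        · subst hc
          simp [hrc.symm]
        · by_cases hc' : j = c
          · subst hc'; simp [hrc, hrc.symm]
          · rw [hq, hzero c (Ne.symm hc) (Ne.symm hc')]
            simp [hc, hc']
      · by_cases ha' : j = a
        · subst ha'
          by_cases hc : i = c
          · subst hc; simp [hrc, hrc.symm]
          · by_cases hc' : j = c
            · subst hc'; simp [hrc]
            · rw [hq, hzero c (Ne.symm hc) (Ne.symm hc')]
              simp [hc, hc']
        · rw [hq, hzero a (Ne.symm ha) (Ne.symm ha')]
          simp [ha, ha']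

theorem hpPi_hpPoint (e : HPEdge n) (k : Fin (n + 1)) :
    hpPi e.row e.col e.tag (hpPoint n k) = 0 := by
  rw [hpPi_apply, hpPoint, Matrix.single_apply_of_ne, map_zero, smul_zero]
  exact fun hx => e.row_ne_col (hx.1.symm.trans hx.2)

theorem hpPi_conj (e : HPEdge n) (θ : Fin (n + 1) → Circle) (y : HMat n) :
    hpPi e.row e.col e.tag (hpDiag θ * y * star (hpDiag θ)) =
      (quatChar e.tag (θ e.row) (θ e.col) : ℂ) * hpPi e.row e.col e.tag y := by
  rw [hpPi_apply, hpPi_apply, hpDiag_mul_mul_star_apply, quatPart_mul, mul_smul_comm]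

theorem conj_hpZ (e : HPEdge n) (θ : Fin (n + 1) → Circle) (z : ℂ) :
    hpDiag θ * hpZ e.row e.col e.tag z * star (hpDiag θ) =
      hpZ e.row e.col e.tag ((quatChar e.tag (θ e.row) (θ e.col) : ℂ) * z) := by
  simp only [hpZ, LinearMap.coe_mk, AddHom.coe_mk, mul_add, add_mul]
  rw [hpDiag_mul_single_mul_star, hpDiag_mul_single_mul_star, ← mul_smul_comm, ← mul_quatEmb_mul,
    star_mul, star_mul, star_star, mul_assoc, mul_assoc]

theorem hpPoint_injective : Function.Injective (hpPoint n) := by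
  intro k l hkl
  by_contra hne
  have := congrFun (congrFun hkl k) k
  rw [hpPoint, hpPoint, Matrix.single_apply_same,
    Matrix.single_apply_of_ne _ _ _ _ _ (fun h => hne h.1.symm)] at this
  exact one_ne_zero this

theorem tangent_hp_ext {k : Fin (n + 1)} {w : HMat n}
    (hw : w ∈ tangentSpaceAt (HP n) (hpPoint n k))
    (hall : ∀ e : HPEdge n, (k = e.row ∨ k = e.col) → hpPi e.row e.col e.tag w = 0) : w = 0 := by
  have hstar : ∀ i j, w i j = star (w j i) := fun i j =>
    (congrFun (congrFun (tangent_hp_iff.1 hw).1 i) j).symm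
  have hz : ∀ i j b, hpPi i j b w = 0 → quatPart b (w i j) = 0 := by
    intro i j b h
    rw [hpPi_apply, smul_eq_zero] at h
    exact h.resolve_left two_ne_zero
  have hrow : ∀ j, w k j = 0 := by
    intro j
    by_cases hjk : j = k
    · exact tangent_hp_apply_eq_zero hw (by simp [hjk])
    · rcases HPEdge.exists_of_ne (Ne.symm hjk) with h1 | h1
      · refine quat_eq_zero_of_parts fun b => ?_
        obtain ⟨e, h2, h3, h4⟩ := h1 b
        have := hall e (Or.inl h2.symm)
        rw [h2, h3, h4] at this
        exact hz _ _ _ this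
      · rw [hstar, star_eq_zero]
        refine quat_eq_zero_of_parts fun b => ?_
        obtain ⟨e, h2, h3, h4⟩ := h1 b
        have := hall e (Or.inr h3.symm)
        rw [h2, h3, h4] at this
        exact hz _ _ _ this
  ext1 i j
  by_cases hi : i = k
  · rw [hi]; exact hrow j
  · by_cases hj : j = k
    · rw [hj, hstar, hrow, star_zero]; rfl
    · exact tangent_hp_apply_eq_zero hw (by simp [hi, hj])

/-- The coordinate of `f` vanishes identically on the sphere of `e` and nowhere on the open sphere
of `f`. -/
theorem disjoint_hp_spheres {e f : HPEdge n} (hne : e ≠ f) :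
    Disjoint (sphereSet (hpPoint n e.row) (hpPoint n e.col) (hpZ e.row e.col e.tag))
      (openSphereSet (hpPoint n f.row) (hpPoint n f.col) (hpZ f.row f.col f.tag)) := by
  rw [Set.disjoint_left]
  rintro _ ⟨s, z, hs, rfl⟩ ⟨s', z', hs', hz', h'⟩
  have h1 := congrArg (hpPi f.row f.col f.tag) h'
  rw [proj_spherePoint (hpPi_hpZ f.row_ne_col f.tag) (hpPi_hpPoint f _) (hpPi_hpPoint f _)] at h1
  refine hz' (h1.symm.trans ?_)
  rw [spherePoint, map_add, map_add, map_smul, map_smul, map_add, map_sub, hpPi_hpPoint,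
    hpPi_hpPoint, hpPi_hpZ_of_ne hne]
  simp

/-- The invariant spheres of a diagonal action on `ℍPⁿ`. -/
def hpSpheres {φ : Torus r →ₜ* SpGroupMod n} {lam : Fin r → ℤ} {α : Fin n → Fin r → ℤ}
    (h : HPWeights φ lam α) : EdgeSpheres (hpAction φ) (hpGraph n lam α) (hpPoint n) where
  src := HPEdge.row
  tgt := HPEdge.col
  ends_eq := hpGraph_ends lam α
  src_ne_tgt := HPEdge.row_ne_col
  Z := fun e : HPEdge n => hpZ e.row e.col e.tag
  π := fun e : HPEdge n => hpPi e.row e.col e.tag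
  π_Z := fun e : HPEdge n => hpPi_hpZ e.row_ne_col e.tag
  π_vertex := hpPi_hpPoint
  π_rep e t y := by
    obtain ⟨θ, hθ, h0, hα⟩ := h t
    rw [hpAction_rep hθ, ← quatChar_eq_weightChar_label h0 hα e]
    exact hpPi_conj e θ y
  rep_Z e t z := by
    obtain ⟨θ, hθ, h0, hα⟩ := h t
    rw [hpAction_rep hθ, ← quatChar_eq_weightChar_label h0 hα e]
    exact conj_hpZ e θ z
  injective := hpPoint_injective
  vertex_mem := hpPoint_mem_fixedPoints fun t => (h t).imp fun _ => And.left
  sphere_subset := fun e : HPEdge n => sphereSet_subset_HP e.row_ne_col e.tag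
  π_Z_of_ne _ _ _ _ _ hne := hpPi_hpZ_of_ne hne
  tangent_ext k w hw hall := tangent_hp_ext hw fun e he =>
    hall e ((hpGraph_mem_ends lam α e k).2 he)
  skeleton hpi _ hx hdep := exists_sphere_of_mem_HP lam α hpi hx hdep
  disjoint _ _ hne := disjoint_hp_spheres hne
  exists_other x e hx := by
    refine ⟨HPEdge.other e, HPEdge.other_ne e, (hpGraph_mem_ends lam α (HPEdge.other e) x).2 ?_⟩
    have h1 := (hpGraph_mem_ends lam α e x).1 hx
    rwa [← HPEdge.other_row e, ← HPEdge.other_col e] at h1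

/-- Quaternions with vanishing real part, as multiples of `i`, `j` and `k`. -/
theorem eq_of_re_eq_zero {q : ℍ[ℝ]} (h : q.re = 0) :
    q = q.imI • quatEmb false Complex.I + (q.imJ • quatEmb true 1 + q.imK • quatEmb true Complex.I)
    := by
  ext <;> simp [h]

theorem mem_hpSp1_iff {k : Fin (n + 1)} {X : HMat n} :
    X ∈ hpSp1 n (hpPoint n k) ↔ ∃ a b c : ℝ, X = a • Matrix.single k k (quatEmb false Complex.I) +
      (b • Matrix.single k k (quatEmb true 1) + c • Matrix.single k k (quatEmb true Complex.I)) := by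
  constructor
  · rintro ⟨h1, h2⟩
    have h3 : X = Matrix.single k k (X k k) := by
      rw [hpPoint, Matrix.single_mul_mul_single, one_mul, mul_one] at h2
      exact h2.symm
    have h4 : star (X k k) = -X k k := congrFun (congrFun h1 k) k
    have h5 : (X k k).re = 0 := by
      have := congrArg (fun q : ℍ[ℝ] => q.re) h4
      simp only [Quaternion.re_star, Quaternion.re_neg] at this
      linarith
    refine ⟨(X k k).imI, (X k k).imJ, (X k k).imK, ?_⟩
    rw [Matrix.smul_single, Matrix.smul_single, Matrix.smul_single, ← Matrix.single_add,
      ← Matrix.single_add, ← eq_of_re_eq_zero h5]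
    exact h3
  · rintro ⟨a, b, c, rfl⟩
    rw [Matrix.smul_single, Matrix.smul_single, Matrix.smul_single, ← Matrix.single_add,
      ← Matrix.single_add]
    constructor
    · rw [Matrix.star_eq_conjTranspose, Matrix.conjTranspose_single, Matrix.single_neg]
      congr 1
      ext <;> simp
    · rw [hpPoint, Matrix.single_mul_mul_single, Matrix.single_apply_same, one_mul, mul_one]

/-- The quaternionic weight at `vₖ` of a diagonal action is twice the `k`-th weight. -/
theorem isHPQuatWeight_of_isDiagLift (hn : 1 ≤ n) {φ : Torus r →ₜ* SpGroupMod n}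
    {k : Fin (n + 1)} {m : Fin r → ℤ}
    (h : ∀ t, ∃ θ, IsDiagLift (φ t) θ ∧ θ k * θ k = weightChar m t) : IsHPQuatWeight φ k m := by
  have hrot : ∀ (t : Torus r) (b : Bool) (z : ℂ) (θ : Fin (n + 1) → Circle), IsDiagLift (φ t) θ →
      (hpAction φ).rep t (Matrix.single k k (quatEmb b z)) =
        Matrix.single k k (quatEmb b ((quatChar b (θ k) (θ k) : ℂ) * z)) := by
    intro t b z θ hθ
    rw [hpAction_rep hθ, hpDiag_mul_single_mul_star, mul_quatEmb_mul]
  have hcomb : ∀ (c : ℂ) (z : ℂ), Matrix.single k k (quatEmb true (c * z)) =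
      c.re • Matrix.single k k (quatEmb true z) +
        c.im • Matrix.single k k (quatEmb true (Complex.I * z)) := by
    intro c z
    rw [Matrix.smul_single, Matrix.smul_single, ← Matrix.single_add, ← map_smul, ← map_smul,
      ← map_add]
    congr 2
    rw [Complex.real_smul, Complex.real_smul, ← mul_assoc, ← add_mul, Complex.re_add_im]
  refine TorusAction.isQuatWeight_adEndomorphisms
    (hpPoint_mem_fixedPoints (fun t => (h t).imp fun _ => And.left) k)
    (Matrix.single k k (quatEmb false Complex.I)) (Matrix.single k k (quatEmb true 1))
    (Matrix.single k k (quatEmb true Complex.I)) (fun X => mem_hpSp1_iff) ?_ ?_ ?_ ?_ ?_ ?_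
  · intro X ⟨hX1, hX2⟩ v hv
    have hv' := tangent_hp_iff.1 hv
    have hpX : hpPoint n k * X = X := by rw [← hX2, ← mul_assoc, ← mul_assoc, hpPoint_mul_self]
    have hXp : X * hpPoint n k = X := by rw [← hX2, mul_assoc, hpPoint_mul_self]
    refine tangent_hp_iff.2 ⟨?_, ?_⟩
    · rw [star_sub, star_mul, star_mul, hX1, hv'.1]; noncomm_ring
    · exact commutator_add_eq (hpX.trans hXp.symm) hv'.2
  · intro a b c hall
    -- A second index exists because `n ≥ 1`; the commutator of `X` with `Eₖₗ + Eₗₖ` has `(k, l)`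
    -- entry `Xₖₖ`, which shows faithfulness.
    have : Nontrivial (Fin (n + 1)) := Fin.nontrivial_iff_two_le.2 (by omega)
    obtain ⟨l, hl⟩ := exists_ne k
    have h1 := hall _ (single_add_single_mem_tangent hl.symm 1)
    rw [Matrix.smul_single, Matrix.smul_single, Matrix.smul_single, ← Matrix.single_add,
      ← Matrix.single_add] at h1
    have h2 := congrFun (congrFun h1 k) l
    rw [star_one, mul_add, add_mul, Matrix.single_mul_single_same,
      Matrix.single_mul_single_of_ne _ _ _ _ hl.symm, Matrix.single_mul_single_of_ne _ _ _ _ hl,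
      Matrix.single_mul_single_same, mul_one, one_mul, add_zero, zero_add, Matrix.sub_apply,
      Matrix.single_apply_same, Matrix.single_apply_of_ne _ _ _ _ _ (fun h => hl h.1),
      sub_zero] at h2
    refine ⟨?_, ?_, ?_⟩
    · simpa using congrArg (fun q : ℍ[ℝ] => q.imI) h2
    · simpa using congrArg (fun q : ℍ[ℝ] => q.imJ) h2
    · simpa using congrArg (fun q : ℍ[ℝ] => q.imK) h2
  · intro t x y
    obtain ⟨θ, hθ, -⟩ := h t
    have hu := (Unitary.mem_iff.1 (hpDiag_mem_unitary θ)).1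
    rw [hpAction_rep hθ, hpAction_rep hθ, hpAction_rep hθ]
    calc hpDiag θ * (x * y) * star (hpDiag θ)
        = hpDiag θ * x * 1 * y * star (hpDiag θ) := by noncomm_ring
      _ = _ := by rw [← hu]; noncomm_ring
  · intro t
    obtain ⟨θ, hθ, -⟩ := h t
    rw [hrot t false _ θ hθ]
    simp [quatChar]
  · intro t
    obtain ⟨θ, hθ, hm⟩ := h t
    rw [hrot t true _ θ hθ]
    have : quatChar true (θ k) (θ k) = weightChar m t := hm
    rw [this, hcomb, mul_one]
  · intro t
    obtain ⟨θ, hθ, hm⟩ := h t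
    rw [hrot t true _ θ hθ]
    have : quatChar true (θ k) (θ k) = weightChar m t := hm
    rw [this, hcomb, Complex.I_mul_I, map_neg, ← Matrix.single_neg]
    module

theorem HPWeights.isHPQuatWeight_zero (hn : 1 ≤ n) {φ : Torus r →ₜ* SpGroupMod n}
    {lam : Fin r → ℤ} {α : Fin n → Fin r → ℤ} (h : HPWeights φ lam α) : IsHPQuatWeight φ 0 lam :=
  isHPQuatWeight_of_isDiagLift hn fun t => (h t).imp fun _ h1 => ⟨h1.1, h1.2.1⟩

theorem HPWeights.isHPQuatWeight_succ (hn : 1 ≤ n) {φ : Torus r →ₜ* SpGroupMod n}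
    {lam : Fin r → ℤ} {α : Fin n → Fin r → ℤ} (h : HPWeights φ lam α) (k : Fin n) :
    IsHPQuatWeight φ k.succ (lam - 2 • α k) := by
  refine isHPQuatWeight_of_isDiagLift hn fun t => (h t).imp fun θ h1 => ⟨h1.1, ?_⟩
  rw [weightChar_sub, two_smul, weightChar_add, ← h1.2.1, ← h1.2.2 k]
  simp only [mul_inv_rev, inv_inv]
  have h1 : ∀ a c : Circle, a * a = c * c * (a * c⁻¹ * (a * c⁻¹)) := fun a c => by
    rw [mul_mul_mul_comm a, mul_comm (c * c), mul_assoc, mul_mul_mul_comm c⁻¹]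
    simp
  exact h1 _ _

end ProjectiveSpaceActions

end

noncomputable section

/-! ### Weights and realization for quaternionic projective space -/

section ProjectiveSpaceMain

variable {r n : ℕ}

theorem continuous_quatPart (b : Bool) : Continuous (quatPart b) :=
  LinearMap.continuous_of_finiteDimensional _

/-- The characters by which a diagonal action acts on the components of the matrix entries. -/
theorem exists_weightChar_eq_quatChar {φ : Torus r →ₜ* SpGroupMod n}
    {θ : Torus r → Fin (n + 1) → Circle} (hθ : ∀ t, IsDiagLift (φ t) (θ t)) (b : Bool)
    (i j : Fin (n + 1)) : ∃ m : Fin r → ℤ, ∀ t, quatChar b (θ t i) (θ t j) = weightChar m t := by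
  have hrep : ∀ t z, (hpAction φ).rep t (Matrix.single i j (quatEmb b z)) =
      Matrix.single i j (quatEmb b ((quatChar b (θ t i) (θ t j) : ℂ) * z)) := by
    intro t z
    rw [hpAction_rep (hθ t), hpDiag_mul_single_mul_star, mul_quatEmb_mul]
  -- The lifts `θ t` are chosen pointwise, without any continuity. Read off from a matrix entry of
  -- the representation, the character is continuous and multiplicative all the same.
  have hval : ∀ t, ((quatChar b (θ t i) (θ t j) : Circle) : ℂ) =
      quatPart b ((hpAction φ).rep t (Matrix.single i j (quatEmb b 1)) i j) := by
    intro t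
    rw [hrep, Matrix.single_apply_same, quatPart_quatEmb, mul_one]
  refine exists_weightChar_eq ?_ fun s t => ?_
  · refine Continuous.subtype_mk (f := fun t => ((quatChar b (θ t i) (θ t j) : Circle) : ℂ)) ?_
      (fun t => (quatChar b (θ t i) (θ t j)).2)
    simp_rw [hval]
    exact (continuous_quatPart b).comp
      (((hpAction φ).continuous_rep _).matrix_elem i j)
  · refine Circle.ext ?_
    rw [hval, map_mul, mul_apply_eq_comp, hrep t, hrep s, Matrix.single_apply_same,
      quatPart_quatEmb, mul_one, Circle.coe_mul]

theorem exists_hpWeights {φ : Torus r →ₜ* SpGroupMod n}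
    (hφ : ∀ t, ∃ g ∈ spDiagonalTorus n, φ t = (g : SpGroupMod n)) :
    ∃ lam α, HPWeights φ lam α := by
  choose θ hθ using fun t => exists_isDiagLift hφ t
  obtain ⟨lam, hlam⟩ := exists_weightChar_eq_quatChar hθ true 0 0
  choose α hα using fun k : Fin n => exists_weightChar_eq_quatChar hθ false 0 k.succ
  exact ⟨lam, α, fun t => ⟨θ t, hθ t, hlam t, fun k => hα k t⟩⟩

theorem label_hpGraph_neg (lam : Fin r → ℤ) (α : Fin n → Fin r → ℤ) (e : HPEdge n) :
    (hpGraph n (-lam) (-α)).label e = -(hpGraph n lam α).label e := by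
  rcases e with ⟨k, _ | _⟩ | ⟨k, l, h, _ | _⟩ <;> simp only [hpGraph, Pi.neg_apply] <;> abel

/-- A GKM action on `ℍPⁿ` through the diagonal torus: its graph and its quaternionic weights. -/
theorem hp_graph_of_isGKM (hn : 1 ≤ n) (φ : Torus r →ₜ* SpGroupMod n)
    (hφ : ∀ t, ∃ g ∈ spDiagonalTorus n, φ t = (g : SpGroupMod n)) (hG : (hpAction φ).IsGKM) :
    (∃ lam : Fin r → ℤ, IsHPQuatWeight φ 0 lam) ∧
      ∀ lam : Fin r → ℤ, IsHPQuatWeight φ 0 lam →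
        ∃ α : Fin n → Fin r → ℤ, (hpAction φ).HasGKMGraph (hpGraph n lam α) (hpPoint n) ∧
          ∀ k : Fin n, IsHPQuatWeight φ k.succ (lam - 2 • α k) := by
  obtain ⟨μ, β, h⟩ := exists_hpWeights hφ
  have hgraph : (hpAction φ).HasGKMGraph (hpGraph n μ β) (hpPoint n) :=
    have : Finite (hpGraph n μ β).Edge := inferInstanceAs (Finite (HPEdge n))
    (hpSpheres h).hasGKMGraph ((hpSpheres h).pairwiseIndependent hG)
  have hw := h.isHPQuatWeight_zero hn
  refine ⟨⟨μ, hw⟩, fun lam hlam => ?_⟩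
  -- For the opposite sign of `λ`, negate all `αₖ` as well; labels and weights change sign only.
  rcases TorusAction.IsQuatWeight.eq_or_eq_neg hlam hw with rfl | rfl
  · exact ⟨β, hgraph, h.isHPQuatWeight_succ hn⟩
  · refine ⟨-β, hgraph.congr_label _ fun e => Or.inr (label_hpGraph_neg μ β e), fun k => ?_⟩
    have := TorusAction.IsQuatWeight.neg (h.isHPQuatWeight_succ hn k)
    have e : -μ - 2 • (-β) k = -(μ - 2 • β k) := by rw [Pi.neg_apply]; module
    rw [e]
    exact this

theorem hpDiag_mul (θ θ' : Fin (n + 1) → Circle) : hpDiag θ * hpDiag θ' = hpDiag (θ * θ') := by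
  rw [Matrix.diagonal_mul_diagonal]
  congr 1
  ext1 i
  rw [Pi.mul_apply, Circle.coe_mul, Quaternion.coeComplex_mul]

theorem hpDiag_neg (θ : Fin (n + 1) → Circle) : hpDiag (fun i => -θ i) = -hpDiag θ := by
  unfold hpDiag
  rw [Matrix.diagonal_neg]
  congr 1
  ext1 i
  ext <;> simp

theorem mk_hpDiag_eq_of_eq_or_eq_neg {g g' : SpGroup n}
    (h : (g : HMat n) = g' ∨ (g : HMat n) = -(g' : HMat n)) :
    (g : SpGroupMod n) = (g' : SpGroupMod n) := by
  rw [QuotientGroup.eq]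
  change ((g⁻¹ * g' : SpGroup n) : HMat n) = 1 ∨ ((g⁻¹ * g' : SpGroup n) : HMat n) = -1
  rw [Submonoid.coe_mul, ← Unitary.star_eq_inv, Unitary.coe_star]
  have h1 := (Unitary.mem_iff.1 g'.2).1
  rcases h with h | h
  · left; rw [h, h1]
  · right; rw [h, star_neg, neg_mul, h1]

/-- A square root on the circle, continuous at `1`. -/
def circleSqrt (z : Circle) : Circle := Circle.exp (Complex.arg z / 2)

theorem circleSqrt_mul_self (z : Circle) : circleSqrt z * circleSqrt z = z := by
  rw [circleSqrt, ← Circle.exp_add, add_halves, Circle.exp_arg]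

theorem continuousAt_circleSqrt : ContinuousAt circleSqrt 1 := by
  have h1 : ContinuousAt (fun z : Circle => Complex.arg (z : ℂ)) 1 :=
    (Complex.continuousAt_arg (by simp)).comp continuous_subtype_val.continuousAt
  exact Circle.exp.continuous.continuousAt.comp (h1.div_const 2)

/-- The two candidates have the same square. The sign ambiguity disappears in the quotient by `±1`.
-/
theorem circleSqrt_mul (z w : Circle) : circleSqrt (z * w) = circleSqrt z * circleSqrt w ∨
    circleSqrt (z * w) = -(circleSqrt z * circleSqrt w) := by
  have h : circleSqrt (z * w) * circleSqrt (z * w) =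
      circleSqrt z * circleSqrt w * (circleSqrt z * circleSqrt w) := by
    rw [circleSqrt_mul_self, mul_mul_mul_comm, circleSqrt_mul_self, circleSqrt_mul_self]
  have h2 := congrArg (fun c : Circle => (c : ℂ)) h
  simp only [Circle.coe_mul] at h2
  rcases mul_self_eq_mul_self_iff.1 h2 with h3 | h3
  · exact Or.inl (Circle.ext (by rw [h3, Circle.coe_mul]))
  · exact Or.inr (Circle.ext (by rw [h3]; simp))

variable (lam : Fin r → ℤ) (α : Fin n → Fin r → ℤ)

/-- The diagonal entries of the action with prescribed weights. -/
def hpLift (t : Torus r) : Fin (n + 1) → Circle :=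
  Fin.cons (circleSqrt (weightChar lam t))
    fun k => circleSqrt (weightChar lam t) * (weightChar (α k) t)⁻¹

/-- All diagonal entries contain the same square root, so they fail to be multiplicative by one
common sign. -/
theorem hpLift_mul (s t : Torus r) : hpLift lam α (s * t) = hpLift lam α s * hpLift lam α t ∨
    hpLift lam α (s * t) = fun i => -((hpLift lam α s * hpLift lam α t) i) := by
  rcases circleSqrt_mul (weightChar lam s) (weightChar lam t) with h | h
  · left
    ext1 i
    refine Fin.cases ?_ (fun k => ?_) i
    · simp only [hpLift, Pi.mul_apply, Fin.cons_zero, weightChar_mul, h]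
    · simp only [hpLift, Pi.mul_apply, Fin.cons_succ, weightChar_mul, h, mul_inv]
      rw [mul_mul_mul_comm]
  · right
    ext1 i
    refine Fin.cases ?_ (fun k => ?_) i
    · simp only [hpLift, Pi.mul_apply, Fin.cons_zero, weightChar_mul, h]
    · simp only [hpLift, Pi.mul_apply, Fin.cons_succ, weightChar_mul, h, mul_inv]
      rw [neg_mul, mul_mul_mul_comm]

theorem continuousAt_hpLift : ContinuousAt (hpLift lam α) 1 := by
  have h0 : ContinuousAt (fun t : Torus r => circleSqrt (weightChar lam t)) 1 := by
    refine ContinuousAt.comp (g := circleSqrt) ?_ (continuous_weightChar lam).continuousAt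
    rw [weightChar_one]
    exact continuousAt_circleSqrt
  refine continuousAt_pi.2 fun i => ?_
  refine Fin.cases ?_ (fun k => ?_) i
  · simpa only [hpLift, Fin.cons_zero] using h0
  · simp only [hpLift, Fin.cons_succ]
    exact h0.mul (continuous_weightChar (α k)).continuousAt.inv

theorem continuous_hpDiag :
    Continuous fun θ : Fin (n + 1) → Circle => (⟨hpDiag θ, hpDiag_mem_unitary θ⟩ : SpGroup n) := by
  refine Continuous.subtype_mk ?_ _
  refine Continuous.matrix_diagonal (continuous_pi fun i => ?_)
  exact (LinearMap.continuous_of_finiteDimensional (quatEmb false)).comp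
    (continuous_subtype_val.comp (continuous_apply i))

/-- The homomorphism with prescribed weights, without its continuity. -/
def hpMonoidHom : Torus r →* SpGroupMod n :=
  MonoidHom.mk' (fun t => ((⟨hpDiag (hpLift lam α t), hpDiag_mem_unitary _⟩ :
    SpGroup n) : SpGroupMod n)) fun s t => by
      rw [← QuotientGroup.mk_mul]
      refine mk_hpDiag_eq_of_eq_or_eq_neg ?_
      change hpDiag (hpLift lam α (s * t)) =
        hpDiag (hpLift lam α s) * hpDiag (hpLift lam α t) ∨ hpDiag (hpLift lam α (s * t)) =
          -(hpDiag (hpLift lam α s) * hpDiag (hpLift lam α t))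
      rw [hpDiag_mul, ← hpDiag_neg]
      exact (hpLift_mul lam α s t).imp (congrArg _) (congrArg _)

/-- The homomorphism with prescribed weights. -/
def hpHom : Torus r →ₜ* SpGroupMod n where
  toMonoidHom := hpMonoidHom lam α
  continuous_toFun := by
    -- The square root jumps at `-1`, but for a homomorphism continuity at the identity suffices.
    refine continuous_of_continuousAt_one (hpMonoidHom lam α) ?_
    exact (QuotientGroup.continuous_mk.comp continuous_hpDiag).continuousAt.comp
      (continuousAt_hpLift lam α)

theorem hpWeights_hpHom : HPWeights (hpHom lam α) lam α := by
  refine fun t => ⟨hpLift lam α t, rfl, ?_, fun k => ?_⟩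
  · simp only [hpLift, Fin.cons_zero, circleSqrt_mul_self]
  · simp only [hpLift, Fin.cons_zero, Fin.cons_succ, mul_inv_rev, inv_inv]
    rw [mul_left_comm, mul_inv_cancel, mul_one]

/-- The complex structure `i · 1` is not central in the quaternionic matrices, but it commutes with
the real diagonal projections. -/
theorem quaternion_diagonal_I_mul_self : (Matrix.diagonal fun _ => quatEmb false Complex.I : HMat n) *
    Matrix.diagonal (fun _ => quatEmb false Complex.I) = -1 := by
  rw [Matrix.diagonal_mul_diagonal, ← Matrix.diagonal_one, Matrix.diagonal_neg]
  congr 1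
  ext1 i
  ext <;> simp

theorem quaternion_diagonal_I_mul_hpPoint (k : Fin (n + 1)) :
    (Matrix.diagonal fun _ => quatEmb false Complex.I : HMat n) * hpPoint n k =
      hpPoint n k * Matrix.diagonal fun _ => quatEmb false Complex.I := by
  ext1 i j
  rw [Matrix.diagonal_mul, Matrix.mul_diagonal, hpPoint]
  by_cases h : k = i ∧ k = j
  · obtain ⟨rfl, rfl⟩ := h
    rw [Matrix.single_apply_same, mul_one, one_mul]
  · rw [Matrix.single_apply_of_ne _ _ _ _ _ h, mul_zero, zero_mul]

theorem isOrientableSubmanifold_HP (n : ℕ) : IsOrientableSubmanifold (HP n) :=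
  isOrientableSubmanifold_of_complexStructure (star_hpPoint 0) (hpPoint_mul_self 0)
    quaternion_diagonal_I_mul_self (quaternion_diagonal_I_mul_hpPoint 0)

theorem oddBettiNumbersVanish_HP (n : ℕ) : OddBettiNumbersVanish (HP n) := by
  refine oddBettiNumbersVanish_of_complexStructure (star_hpPoint 0) (hpPoint_mul_self 0)
    quaternion_diagonal_I_mul_self ?_ (quaternion_diagonal_I_mul_hpPoint 0)
  rw [Matrix.star_eq_conjTranspose, Matrix.diagonal_conjTranspose, Matrix.diagonal_neg]
  congr 1
  ext1 i
  ext <;> simp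

/-- Every labelled graph of the form `hpGraph` with independent labels is realized. -/
theorem exists_hp_action (hn : 1 ≤ n) (h : (hpGraph n lam α).PairwiseIndependent) :
    ∃ φ : Torus r →ₜ* SpGroupMod n,
      (∀ t, ∃ g ∈ spDiagonalTorus n, φ t = (g : SpGroupMod n)) ∧ (hpAction φ).IsGKM ∧
      (hpAction φ).HasGKMGraph (hpGraph n lam α) (hpPoint n) ∧ IsHPQuatWeight φ 0 lam ∧
      ∀ k : Fin n, IsHPQuatWeight φ k.succ (lam - 2 • α k) := by
  have hw := hpWeights_hpHom lam α
  have _ : Finite (hpGraph n lam α).Edge := inferInstanceAs (Finite (HPEdge n))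
  have _ : Finite (hpGraph n lam α).Vertex := inferInstanceAs (Finite (Fin (n + 1)))
  exact ⟨hpHom lam α, fun t => ⟨⟨_, hpDiag_mem_unitary _⟩, ⟨hpLift lam α t, rfl⟩, rfl⟩,
    (hpSpheres hw).isGKM h (isOrientableSubmanifold_HP n) (oddBettiNumbersVanish_HP n),
    (hpSpheres hw).hasGKMGraph h, hw.isHPQuatWeight_zero hn, hw.isHPQuatWeight_succ hn⟩

end ProjectiveSpaceMain

end

noncomputable section

/-! ### Edges, coordinates and spheres in the Grassmannian -/

section Grassmannian

variable {r m : ℕ}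

theorem fin_eq_zero_or_one_or (i : Fin (m + 2)) :
    i = 0 ∨ i = 1 ∨ ∃ k : Fin m, i = k.succ.succ := by
  induction i using Fin.cases with
  | zero => exact Or.inl rfl
  | succ i =>
    induction i using Fin.cases with
    | zero => exact Or.inr (Or.inl rfl)
    | succ k => exact Or.inr (Or.inr ⟨k, rfl⟩)

theorem succ_succ_ne_one (k : Fin m) : k.succ.succ ≠ 1 := fun h =>
  Fin.succ_ne_zero k (Fin.succ_injective _ (show k.succ.succ = (0 : Fin (m + 1)).succ from h))

namespace GrEdge

/-- The common index of the two end points of an edge. -/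
def ctr : GrEdge m → Fin (m + 2)
  | .e12_1 _ => 0
  | .e12_2 _ => 1
  | .e1_2 k => k.succ.succ
  | .e3 k _ _ _ _ _ => k
  | .e4_1 k _ _ => k.succ.succ
  | .e4_2 k _ _ => k.succ.succ

/-- The row of the matrix entry that belongs to an edge. -/
def row : GrEdge m → Fin (m + 2)
  | .e12_1 k => k.succ.succ
  | .e12_2 _ => 0
  | .e1_2 _ => 0
  | .e3 _ l _ _ _ _ => l.succ.succ
  | .e4_1 _ _ _ => 0
  | .e4_2 _ l _ => l.succ.succ

/-- The column of the matrix entry that belongs to an edge. -/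
def col : GrEdge m → Fin (m + 2)
  | .e12_1 _ => 1
  | .e12_2 k => k.succ.succ
  | .e1_2 _ => 1
  | .e3 _ _ p _ _ _ => p.succ.succ
  | .e4_1 _ l _ => l.succ.succ
  | .e4_2 _ _ _ => 1

theorem row_ne_col (e : GrEdge m) : e.row ≠ e.col := by
  cases e <;> simp only [row, col]
  · exact succ_succ_ne_one _
  · exact (Fin.succ_ne_zero _).symm
  · exact zero_ne_one
  · rename_i h _ _
    exact fun h' => h.ne (Fin.succ_injective _ (Fin.succ_injective _ h'))
  · exact (Fin.succ_ne_zero _).symm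
  · exact succ_succ_ne_one _

theorem ctr_ne_row (e : GrEdge m) : e.ctr ≠ e.row := by
  cases e <;> simp only [row, ctr]
  · exact (Fin.succ_ne_zero _).symm
  · exact one_ne_zero
  · exact Fin.succ_ne_zero _
  · assumption
  · exact Fin.succ_ne_zero _
  · rename_i h
    exact fun h' => h (Fin.succ_injective _ (Fin.succ_injective _ h'))

theorem ctr_ne_col (e : GrEdge m) : e.ctr ≠ e.col := by
  cases e <;> simp only [col, ctr]
  · exact zero_ne_one
  · exact (succ_succ_ne_one _).symm
  · exact succ_succ_ne_one _
  · assumption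
  · rename_i h
    exact fun h' => h (Fin.succ_injective _ (Fin.succ_injective _ h'))
  · exact succ_succ_ne_one _

/-- Together with `exists_eq`: an edge is the same as a centre `c` and an unordered pair `{a, b}`
avoiding `c`, joining `v_{ca}` to `v_{cb}`. This replaces the six cases of the graph by one. -/
theorem ext' {e f : GrEdge m} (h1 : e.ctr = f.ctr)
    (h2 : e.row = f.row ∧ e.col = f.col ∨ e.row = f.col ∧ e.col = f.row) : e = f := by
  have hval : ∀ k : Fin m, (k.succ.succ : ℕ) = k + 2 := fun k => by simp
  have hone : ((1 : Fin (m + 2)) : ℕ) = 1 := rfl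
  have hzero : ((0 : Fin (m + 2)) : ℕ) = 0 := rfl
  rw [Fin.ext_iff] at h1
  rw [Fin.ext_iff, Fin.ext_iff, Fin.ext_iff, Fin.ext_iff] at h2
  cases e <;> cases f <;>
    (dsimp only [ctr, row, col] at h1 h2
     simp only [hval, hone, hzero] at h1 h2
     simp only [GrEdge.e12_1.injEq,
      GrEdge.e12_2.injEq, GrEdge.e1_2.injEq, GrEdge.e3.injEq, GrEdge.e4_1.injEq,
      GrEdge.e4_2.injEq, Fin.ext_iff, reduceCtorEq]
     try simp only [Fin.lt_def, hval, hone, hzero] at *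
     omega)

theorem exists_eq {c a b : Fin (m + 2)} (hca : c ≠ a) (hcb : c ≠ b) (hab : a ≠ b) :
    ∃ e : GrEdge m, e.ctr = c ∧ (e.row = a ∧ e.col = b ∨ e.row = b ∧ e.col = a) := by
  have hne : ∀ {k l : Fin m}, k.succ.succ ≠ l.succ.succ → k ≠ l := fun h h' => h (h' ▸ rfl)
  rcases fin_eq_zero_or_one_or a with rfl | rfl | ⟨k, rfl⟩ <;>
    rcases fin_eq_zero_or_one_or b with rfl | rfl | ⟨l, rfl⟩
  · exact absurd rfl hab
  · rcases fin_eq_zero_or_one_or c with rfl | rfl | ⟨p, rfl⟩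
    · exact absurd rfl hca
    · exact absurd rfl hcb
    · exact ⟨.e1_2 p, rfl, Or.inl ⟨rfl, rfl⟩⟩
  · rcases fin_eq_zero_or_one_or c with rfl | rfl | ⟨p, rfl⟩
    · exact absurd rfl hca
    · exact ⟨.e12_2 l, rfl, Or.inl ⟨rfl, rfl⟩⟩
    · exact ⟨.e4_1 p l (hne hcb), rfl, Or.inl ⟨rfl, rfl⟩⟩
  · rcases fin_eq_zero_or_one_or c with rfl | rfl | ⟨p, rfl⟩
    · exact absurd rfl hcb
    · exact absurd rfl hca
    · exact ⟨.e1_2 p, rfl, Or.inr ⟨rfl, rfl⟩⟩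
  · exact absurd rfl hab
  · rcases fin_eq_zero_or_one_or c with rfl | rfl | ⟨p, rfl⟩
    · exact ⟨.e12_1 l, rfl, Or.inr ⟨rfl, rfl⟩⟩
    · exact absurd rfl hca
    · exact ⟨.e4_2 p l (hne hcb), rfl, Or.inr ⟨rfl, rfl⟩⟩
  · rcases fin_eq_zero_or_one_or c with rfl | rfl | ⟨p, rfl⟩
    · exact absurd rfl hcb
    · exact ⟨.e12_2 k, rfl, Or.inr ⟨rfl, rfl⟩⟩
    · exact ⟨.e4_1 p k (hne hca), rfl, Or.inr ⟨rfl, rfl⟩⟩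
  · rcases fin_eq_zero_or_one_or c with rfl | rfl | ⟨p, rfl⟩
    · exact ⟨.e12_1 k, rfl, Or.inl ⟨rfl, rfl⟩⟩
    · exact absurd rfl hcb
    · exact ⟨.e4_2 p k (hne hca), rfl, Or.inl ⟨rfl, rfl⟩⟩
  · rcases lt_trichotomy k l with h | rfl | h
    · exact ⟨.e3 c k l h hca hcb, rfl, Or.inl ⟨rfl, rfl⟩⟩
    · exact absurd rfl hab
    · exact ⟨.e3 c l k h hcb hca, rfl, Or.inr ⟨rfl, rfl⟩⟩

instance : Finite (GrEdge m) :=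
  Finite.of_injective (fun e : GrEdge m => (e.ctr, e.row, e.col)) fun e f h => by
    simp only [Prod.mk.injEq] at h
    exact ext' h.1 (Or.inl h.2)

/-- The end point of an edge that contains its row. -/
def src (e : GrEdge m) : GrVertex m := grVertex e.ctr e.row e.ctr_ne_row

/-- The end point of an edge that contains its column. -/
def tgt (e : GrEdge m) : GrVertex m := grVertex e.ctr e.col e.ctr_ne_col

end GrEdge

theorem grVertex_comm (i j : Fin (m + 2)) (h : i ≠ j) : grVertex i j h = grVertex j i h.symm :=
  Subtype.ext (Finset.pair_comm i j)

theorem grVertex_eq_iff {i j k l : Fin (m + 2)} {h : i ≠ j} {h' : k ≠ l} :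
    grVertex i j h = grVertex k l h' ↔ i = k ∧ j = l ∨ i = l ∧ j = k := by
  have h1 : grVertex i j h = grVertex k l h' ↔
      ({i, j} : Finset (Fin (m + 2))) = {k, l} := Subtype.ext_iff
  rw [h1, ← Finset.coe_inj, Finset.coe_pair, Finset.coe_pair, Set.pair_eq_pair_iff]

theorem grGraph_ends (lam : Fin r → ℤ) (α : Fin m → Fin r → ℤ) (e : GrEdge m) :
    (grGraph m lam α).ends e = s(e.src, e.tgt) := by
  cases e with
  | e12_1 k => exact Sym2.eq_swap
  | e12_2 k => exact congrArg (fun v => s(v, v2 k)) (grVertex_comm _ _ _)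
  | e1_2 k =>
    exact congrArg₂ (fun v w => s(v, w)) (grVertex_comm _ _ _) (grVertex_comm _ _ _)
  | e3 k l p h hl hp => rfl
  | e4_1 k l h => exact congrArg (fun v => s(v, vv k l h)) (grVertex_comm _ _ _)
  | e4_2 k l h =>
    exact Sym2.eq_swap.trans (congrArg (fun v => s(vv k l h, v)) (grVertex_comm _ _ _))

theorem grGraph_mem_ends (lam : Fin r → ℤ) (α : Fin m → Fin r → ℤ) (e : GrEdge m)
    (v : GrVertex m) :
    (show (grGraph m lam α).Vertex from v) ∈ (grGraph m lam α).ends e ↔ v = e.src ∨ v = e.tgt := by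
  rw [grGraph_ends]
  exact Sym2.mem_iff

/-- The weights `λ, 0, α₃, …, αₙ` on `ℂⁿ`. -/
def grBeta (lam : Fin r → ℤ) (α : Fin m → Fin r → ℤ) : Fin (m + 2) → Fin r → ℤ :=
  Fin.cons lam (Fin.cons 0 α)

theorem grBeta_zero (lam : Fin r → ℤ) (α : Fin m → Fin r → ℤ) : grBeta lam α 0 = lam := rfl
theorem grBeta_one (lam : Fin r → ℤ) (α : Fin m → Fin r → ℤ) : grBeta lam α 1 = 0 := rfl
theorem grBeta_succ_succ (lam : Fin r → ℤ) (α : Fin m → Fin r → ℤ) (k : Fin m) :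
    grBeta lam α k.succ.succ = α k := rfl

theorem grGraph_label (lam : Fin r → ℤ) (α : Fin m → Fin r → ℤ) (e : GrEdge m) :
    (grGraph m lam α).label e = grBeta lam α e.row - grBeta lam α e.col := by
  cases e <;> simp only [grGraph, GrEdge.row, GrEdge.col, grBeta_zero, grBeta_one,
    grBeta_succ_succ, sub_zero]

theorem coordProjection_apply (s : Finset (Fin (m + 2))) (i j : Fin (m + 2)) :
    coordProjection m s i j = if i = j ∧ i ∈ s then 1 else 0 := by
  rw [coordProjection, Matrix.diagonal_apply]
  by_cases h1 : i = j <;> by_cases h2 : i ∈ s <;> simp [h1, h2]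

theorem star_coordProjection (s : Finset (Fin (m + 2))) :
    star (coordProjection m s) = coordProjection m s := by
  ext i j
  rw [Matrix.star_apply, coordProjection_apply, coordProjection_apply]
  by_cases h : i = j
  · subst h; split_ifs <;> simp
  · simp [h, Ne.symm h]

theorem coordProjection_mul_self (s : Finset (Fin (m + 2))) :
    coordProjection m s * coordProjection m s = coordProjection m s := by
  rw [coordProjection, Matrix.diagonal_mul_diagonal]
  congr 1
  ext1 i
  split_ifs <;> simp

theorem coordProjection_pair {i j : Fin (m + 2)} (h : i ≠ j) :
    coordProjection m {i, j} = Matrix.single i i 1 + Matrix.single j j 1 := by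
  ext1 k l
  rw [coordProjection_apply, Matrix.add_apply, Matrix.single_apply, Matrix.single_apply]
  by_cases hi : i = k
  · subst hi; by_cases hl : i = l <;> simp [hl, h.symm]
    subst hl; simp [h.symm]
  · by_cases hj : j = k
    · subst hj; by_cases hl : j = l <;> simp [hl, h]
      subst hl; exact h
    · simp [hi, hj, Ne.symm hi, Ne.symm hj]

theorem conj_mem_Gr2 {g x : CMat m} (hg : g ∈ unitary (CMat m)) (hx : x ∈ Gr2 m) :
    g * x * star g ∈ Gr2 m := by
  have := conjRep_mem_unitaryOrbit (coordProjection m {0, 1}) ⟨g, hg⟩ x hx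
  rwa [conjRep_apply] at this

theorem coordProjection_mem_Gr2 {i j : Fin (m + 2)} (h : i ≠ j) :
    coordProjection m {i, j} ∈ Gr2 m := by
  -- First send `i` to `0`, then the image of `j` to `1`; the second transposition leaves `0` alone.
  let σ : Equiv.Perm (Fin (m + 2)) := Equiv.swap 1 (Equiv.swap 0 i j) * Equiv.swap 0 i
  have h0 : σ i = 0 := by
    simp only [σ, Equiv.Perm.coe_mul, Function.comp_apply, Equiv.swap_apply_right]
    refine Equiv.swap_apply_of_ne_of_ne zero_ne_one fun h' => h ?_
    exact (Equiv.swap 0 i).injective ((Equiv.swap_apply_right 0 i).trans h')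
  have h1 : σ j = 1 := by
    simp only [σ, Equiv.Perm.coe_mul, Function.comp_apply, Equiv.swap_apply_right]
  have h2 : coordProjection m {i, j} = (permUnitary ℂ σ : CMat m) * coordProjection m {0, 1} *
      star (permUnitary ℂ σ : CMat m) := by
    rw [coordProjection, coordProjection, permUnitary_mul_diagonal_mul_star]
    congr 1
    ext1 k
    have h3 : σ k ∈ ({0, 1} : Finset (Fin (m + 2))) ↔ k ∈ ({i, j} : Finset (Fin (m + 2))) := by
      rw [Finset.mem_insert, Finset.mem_singleton, Finset.mem_insert, Finset.mem_singleton, ← h0,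
        ← h1, σ.injective.eq_iff, σ.injective.eq_iff]
    simp only [Function.comp_apply, h3]
  rw [h2]
  exact conj_mem_Gr2 (permUnitary ℂ σ).2 (mem_unitaryOrbit_self _)

theorem grPoint_mem_Gr2 (v : GrVertex m) : grPoint m v ∈ Gr2 m := by
  obtain ⟨s, hs⟩ := v
  obtain ⟨i, j, hij, rfl⟩ := Finset.card_eq_two.1 hs
  exact coordProjection_mem_Gr2 hij

/-- The off-diagonal Hermitian matrices with support in two entries. -/
def grZ (i j : Fin (m + 2)) : ℂ →ₗ[ℝ] CMat m where
  toFun z := Matrix.single i j ((1 / 2 : ℝ) • z) + Matrix.single j i (star ((1 / 2 : ℝ) • z))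
  map_add' z w := by
    simp only [smul_add, star_add, Matrix.single_add]; abel
  map_smul' c z := by
    simp only [smul_comm _ c, star_smul, star_trivial, smul_add, RingHom.id_apply]
    rw [Matrix.smul_single, Matrix.smul_single]

/-- Twice a matrix entry. -/
def grPi (i j : Fin (m + 2)) : CMat m →ₗ[ℝ] ℂ := (2 : ℝ) • Matrix.entryLinearMap ℝ ℂ i j

theorem grPi_apply (i j : Fin (m + 2)) (x : CMat m) : grPi i j x = (2 : ℝ) • x i j := rfl

theorem grPi_eq_zero_iff {i j : Fin (m + 2)} {x : CMat m} : grPi i j x = 0 ↔ x i j = 0 := by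
  rw [grPi_apply, smul_eq_zero]
  exact or_iff_right two_ne_zero

theorem grPi_grZ {i j : Fin (m + 2)} (h : i ≠ j) (z : ℂ) : grPi i j (grZ i j z) = z := by
  rw [grPi_apply]
  simp only [grZ, LinearMap.coe_mk, AddHom.coe_mk, Matrix.add_apply, Matrix.single_apply_same]
  rw [Matrix.single_apply_of_ne _ _ _ _ _ (fun h' => h h'.2), add_zero]
  module

theorem grPi_grZ_of_ne {i j k l : Fin (m + 2)} (h1 : ¬(i = k ∧ j = l)) (h2 : ¬(i = l ∧ j = k))
    (z : ℂ) : grPi k l (grZ i j z) = 0 := by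
  rw [grPi_apply]
  simp only [grZ, LinearMap.coe_mk, AddHom.coe_mk, Matrix.add_apply]
  rw [Matrix.single_apply_of_ne _ _ _ _ _ h1,
    Matrix.single_apply_of_ne _ _ _ _ _ (fun h' => h2 h'.symm), add_zero, smul_zero]

theorem grPi_grPoint {i j : Fin (m + 2)} (h : i ≠ j) (v : GrVertex m) :
    grPi i j (grPoint m v) = 0 := by
  rw [grPi_apply, grPoint, coordProjection_apply, if_neg (fun h' => h h'.1), smul_zero]

theorem spherePoint_gr {c i j : Fin (m + 2)} (hi : c ≠ i) (hj : c ≠ j) (s : ℝ) (z : ℂ) :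
    spherePoint (grPoint m (grVertex c i hi)) (grPoint m (grVertex c j hj)) (grZ i j) s z =
      Matrix.single c c 1 + (Matrix.single i i (algebraMap ℝ ℂ ((1 + s) / 2)) +
        Matrix.single j j (algebraMap ℝ ℂ ((1 - s) / 2)) +
          (Matrix.single i j ((1 / 2 : ℝ) • z) + Matrix.single j i (star ((1 / 2 : ℝ) • z)))) := by
  have h : ∀ (k : Fin (m + 2)) (a : ℝ), (Matrix.single k k (algebraMap ℝ ℂ a) : CMat m) =
      a • Matrix.single k k 1 := by
    intro k a
    rw [Matrix.smul_single, Algebra.algebraMap_eq_smul_one]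
  have h2 : ∀ (k : Fin (m + 2)) (hk : c ≠ k), grPoint m (grVertex c k hk) =
      Matrix.single c c 1 + Matrix.single k k 1 := fun k hk => coordProjection_pair hk
  rw [h, h, h2, h2]
  simp only [spherePoint, grZ, LinearMap.coe_mk, AddHom.coe_mk]
  module

/-- A unitary matrix in the coordinates `i, j` moves along the sphere of lines in that plane and
fixes the projection to the centre `c`. -/
theorem sphereSet_subset_Gr2 {c i j : Fin (m + 2)} (hi : c ≠ i) (hj : c ≠ j) (hij : i ≠ j) :
    sphereSet (grPoint m (grVertex c i hi)) (grPoint m (grVertex c j hj)) (grZ i j) ⊆ Gr2 m := by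
  rintro _ ⟨s, z, hs, rfl⟩
  set w := (1 / 2 : ℝ) • z with hw
  have hn : Complex.normSq z = 4 * Complex.normSq w := by
    rw [hw, Complex.real_smul, map_mul, Complex.normSq_ofReal]; ring
  obtain ⟨g, hg, h1, h2⟩ := exists_conj_single_eq (R := ℂ) hij (s := s) (w := w)
    (M := Complex.normSq w) (Complex.mul_conj w)
    (by rw [mul_comm]; exact Complex.mul_conj w) (Complex.normSq_nonneg w)
    (fun h => Complex.normSq_eq_zero.1 h) (by rw [← hn, hs])
  rw [spherePoint_gr, ← h1, ← h2 c hi hj, ← add_mul, ← mul_add, ← coordProjection_pair hi]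
  exact conj_mem_Gr2 hg (coordProjection_mem_Gr2 hi)

theorem star_eq_of_mem_Gr2 {x : CMat m} (hx : x ∈ Gr2 m) : star x = x :=
  star_eq_of_mem_unitaryOrbit (star_coordProjection _) hx

theorem mul_self_of_mem_Gr2 {x : CMat m} (hx : x ∈ Gr2 m) : x * x = x :=
  mul_self_of_mem_unitaryOrbit (coordProjection_mul_self _) hx

theorem trace_of_mem_Gr2 {x : CMat m} (hx : x ∈ Gr2 m) : x.trace = 2 := by
  obtain ⟨g, rfl⟩ := hx
  rw [conjRep_apply, Matrix.trace_mul_comm, ← mul_assoc, Unitary.star_mul_self_of_mem g.2, one_mul,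
    coordProjection_pair (zero_ne_one), Matrix.trace_add, Matrix.trace_single_eq_same,
    Matrix.trace_single_eq_same]
  norm_num

theorem tangent_gr_iff {v : GrVertex m} {w : CMat m} :
    w ∈ tangentSpaceAt (Gr2 m) (grPoint m v) ↔ star w = w ∧
      grPoint m v * w + w * grPoint m v = w := by
  have _ : CompleteSpace (CMat m) := FiniteDimensional.complete ℝ _
  exact mem_tangentSpaceAt_unitaryOrbit (star_coordProjection _) (coordProjection_mul_self _)
    (grPoint_mem_Gr2 v)

theorem tangent_gr_apply_eq_zero {v : GrVertex m} {w : CMat m}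
    (hw : w ∈ tangentSpaceAt (Gr2 m) (grPoint m v)) {i j : Fin (m + 2)} (h : i ∈ v.1 ↔ j ∈ v.1) :
    w i j = 0 := by
  have h1 := congrFun (congrFun (tangent_gr_iff.1 hw).2 i) j
  rw [Matrix.add_apply, grPoint, coordProjection, Matrix.diagonal_mul, Matrix.mul_diagonal] at h1
  by_cases hi : i ∈ v.1
  · rw [if_pos hi, if_pos (h.1 hi), one_mul, mul_one] at h1
    simpa using h1
  · rw [if_neg hi, if_neg (fun hj => hi (h.2 hj)), zero_mul, mul_zero, add_zero] at h1
    exact h1.symm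

theorem tangent_gr_ext {v : GrVertex m} {w : CMat m}
    (hw : w ∈ tangentSpaceAt (Gr2 m) (grPoint m v))
    (hall : ∀ e : GrEdge m, (v = e.src ∨ v = e.tgt) → grPi e.row e.col w = 0) : w = 0 := by
  have hstar : ∀ i j, w i j = star (w j i) := fun i j =>
    (congrFun (congrFun (tangent_gr_iff.1 hw).1 i) j).symm
  have key : ∀ i j, i ∈ v.1 → j ∉ v.1 → w i j = 0 := by
    intro i j hi hj
    -- The entry `(i, j)` belongs to the edge at `v` whose centre is the other index of `v`.
    obtain ⟨c, hc⟩ : ∃ c, v.1.erase i = {c} := by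
      rw [← Finset.card_eq_one, Finset.card_erase_of_mem hi, v.2]
    have hcm : c ∈ v.1.erase i := by rw [hc]; exact Finset.mem_singleton_self c
    have hci : c ≠ i := Finset.ne_of_mem_erase hcm
    have hcj : c ≠ j := fun h => hj (h ▸ Finset.mem_of_mem_erase hcm)
    have hij : i ≠ j := fun h => hj (h ▸ hi)
    have hv : v = grVertex c i hci := by
      refine Subtype.ext ?_
      change v.1 = {c, i}
      rw [← Finset.insert_erase hi, hc, Finset.pair_comm]
    obtain ⟨e, h1, ⟨h2, h3⟩ | ⟨h2, h3⟩⟩ := GrEdge.exists_eq hci hcj hij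
    · have := hall e (Or.inl (by subst h1 h2; exact hv))
      rw [grPi_eq_zero_iff, h2, h3] at this
      exact this
    · have := hall e (Or.inr (by subst h1 h3; exact hv))
      rw [grPi_eq_zero_iff, h2, h3] at this
      rw [hstar, this, star_zero]
  ext1 i j
  by_cases hi : i ∈ v.1
  · by_cases hj : j ∈ v.1
    · exact tangent_gr_apply_eq_zero hw (by simp [hi, hj])
    · exact key i j hi hj
  · by_cases hj : j ∈ v.1
    · rw [hstar, key j i hj hi, star_zero]; rfl
    · exact tangent_gr_apply_eq_zero hw (by simp [hi, hj])

theorem eq_or_eq_of_spherePoint_apply_ne_zero {e : GrEdge m} {s : ℝ} {z : ℂ} {i j : Fin (m + 2)}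
    (hij : i ≠ j) (h : spherePoint (grPoint m e.src) (grPoint m e.tgt) (grZ e.row e.col) s z i j ≠ 0) :
    e.row = i ∧ e.col = j ∨ e.row = j ∧ e.col = i := by
  by_contra! hne
  have h1 : grPi i j (spherePoint (grPoint m e.src) (grPoint m e.tgt) (grZ e.row e.col) s z) = 0 := by
    rw [spherePoint, map_add, map_add, map_smul, map_smul, map_add, map_sub, grPi_grPoint hij,
      grPi_grPoint hij, grPi_grZ_of_ne (fun h => hne.1 h.1 h.2) (fun h => hne.2 h.1 h.2)]
    simp
  exact h (grPi_eq_zero_iff.1 h1)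

theorem spherePoint_gr_apply_ctr (e : GrEdge m) (s : ℝ) (z : ℂ) :
    spherePoint (grPoint m e.src) (grPoint m e.tgt) (grZ e.row e.col) s z e.ctr e.ctr = 1 := by
  have h1 := e.ctr_ne_row
  have h2 := e.ctr_ne_col
  rw [GrEdge.src, GrEdge.tgt, spherePoint_gr]
  simp [h1.symm, h2.symm]

theorem spherePoint_gr_apply_of_ne (e : GrEdge m) (s : ℝ) (z : ℂ) {i : Fin (m + 2)}
    (h0 : i ≠ e.ctr) (h1 : i ≠ e.row) (h2 : i ≠ e.col) :
    spherePoint (grPoint m e.src) (grPoint m e.tgt) (grZ e.row e.col) s z i i = 0 := by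
  rw [GrEdge.src, GrEdge.tgt, spherePoint_gr]
  simp [h0.symm, h1.symm, h2.symm]

/-- Edges with different centres can share a matrix entry. They are separated by the diagonal entry
at the centre of `e`, which is `1` on one sphere and `0` on the other. -/
theorem disjoint_gr_spheres {e f : GrEdge m} (hne : e ≠ f) :
    Disjoint (sphereSet (grPoint m e.src) (grPoint m e.tgt) (grZ e.row e.col))
      (openSphereSet (grPoint m f.src) (grPoint m f.tgt) (grZ f.row f.col)) := by
  rw [Set.disjoint_left]
  rintro _ ⟨s, z, hs, rfl⟩ ⟨s', z', hs', hz', h'⟩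
  have h1 : spherePoint (grPoint m e.src) (grPoint m e.tgt) (grZ e.row e.col) s z f.row f.col ≠ 0 := by
    rw [h']
    refine grPi_eq_zero_iff.not.1 ?_
    rwa [proj_spherePoint (grPi_grZ f.row_ne_col) (grPi_grPoint f.row_ne_col _)
      (grPi_grPoint f.row_ne_col _)]
  have h2 := eq_or_eq_of_spherePoint_apply_ne_zero f.row_ne_col h1
  refine hne (GrEdge.ext' ?_ h2)
  by_contra hctr
  have h3 := spherePoint_gr_apply_ctr e s z
  rw [h', spherePoint_gr_apply_of_ne f s' z' hctr] at h3
  · exact zero_ne_one h3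
  · rcases h2 with h | h
    · exact h.1 ▸ e.ctr_ne_row
    · exact h.2 ▸ e.ctr_ne_col
  · rcases h2 with h | h
    · exact h.2 ▸ e.ctr_ne_col
    · exact h.1 ▸ e.ctr_ne_row

/-- At a common vertex, different centres would force the centre of `e` to be a row or column index
of `f`, hence of `e`. -/
theorem eq_of_common_vertex {e f : GrEdge m} {v : GrVertex m} (he : v = e.src ∨ v = e.tgt)
    (hf : v = f.src ∨ v = f.tgt)
    (h : e.row = f.row ∧ e.col = f.col ∨ e.row = f.col ∧ e.col = f.row) : e = f := by
  refine GrEdge.ext' ?_ h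
  have e1 := e.ctr_ne_row
  have e2 := e.ctr_ne_col
  have f1 := f.ctr_ne_row
  have f2 := f.ctr_ne_col
  have key : ∃ a b, (a = e.row ∨ a = e.col) ∧ (b = f.row ∨ b = f.col) ∧
      (e.ctr = f.ctr ∧ a = b ∨ e.ctr = b ∧ a = f.ctr) := by
    rcases he with rfl | rfl <;> rcases hf with hf | hf <;>
      exact ⟨_, _, by tauto, by tauto, grVertex_eq_iff.1 hf⟩
  obtain ⟨a, b, ha, hb, h1 | h1⟩ := key
  · exact h1.1
  · exfalso
    rcases h with h | h <;> rcases hb with rfl | rfl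
    · exact e1 (h1.1.trans h.1.symm)
    · exact e2 (h1.1.trans h.2.symm)
    · exact e2 (h1.1.trans h.2.symm)
    · exact e1 (h1.1.trans h.1.symm)

/-- At the vertex `{c, a}` of the edge with centre `c` and pair `{a, b}`, take the edge with centre
`a` and pair `{c, b}`. -/
theorem exists_other_gr (e : GrEdge m) {v : GrVertex m} (hv : v = e.src ∨ v = e.tgt) :
    ∃ f : GrEdge m, f ≠ e ∧ (v = f.src ∨ v = f.tgt) := by
  have key : ∀ a b, (ha : e.ctr ≠ a) → e.ctr ≠ b → a ≠ b → v = grVertex e.ctr a ha →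
      ∃ f : GrEdge m, f ≠ e ∧ (v = f.src ∨ v = f.tgt) := by
    intro a b ha hb hab hva
    obtain ⟨f, h1, h2⟩ := GrEdge.exists_eq ha.symm hab hb
    refine ⟨f, fun h => ha ?_, ?_⟩
    · rw [← h1, h]
    · rw [hva]
      rcases h2 with h2 | h2
      · left; rw [GrEdge.src, grVertex_eq_iff]; exact Or.inr ⟨h2.1.symm, h1.symm⟩
      · right; rw [GrEdge.tgt, grVertex_eq_iff]; exact Or.inr ⟨h2.2.symm, h1.symm⟩
  rcases hv with hv | hv
  · exact key e.row e.col e.ctr_ne_row e.ctr_ne_col e.row_ne_col hv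
  · exact key e.col e.row e.ctr_ne_col e.ctr_ne_row e.row_ne_col.symm hv

end Grassmannian

end

noncomputable section

/-! ### The one-skeleton of diagonal actions on the Grassmannian -/

section GrassmannianSpheres

variable {r m : ℕ}

theorem mem_ends_of_ctr_eq {e : GrEdge m} {a b c : Fin (m + 2)} (hca : c ≠ a) (hc : e.ctr = c)
    (h : e.row = a ∧ e.col = b ∨ e.row = b ∧ e.col = a) :
    grVertex c a hca = e.src ∨ grVertex c a hca = e.tgt := by
  subst hc
  rcases h with ⟨rfl, -⟩ | ⟨-, rfl⟩
  · exact Or.inl rfl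
  · exact Or.inr rfl

theorem apply_eq_star_of_mem_Gr2 {x : CMat m} (hx : x ∈ Gr2 m) (i j : Fin (m + 2)) :
    x i j = star (x j i) :=
  (congrFun (congrFun (star_eq_of_mem_Gr2 hx) i) j).symm

theorem apply_comm_ne_zero_of_mem_Gr2 {x : CMat m} (hx : x ∈ Gr2 m) {i j : Fin (m + 2)}
    (h : x i j ≠ 0) : x j i ≠ 0 := fun h' => h (by
  rw [apply_eq_star_of_mem_Gr2 hx, h', star_zero])

theorem grPi_row_col_ne_zero {x : CMat m} (hx : x ∈ Gr2 m) {e : GrEdge m} {a b : Fin (m + 2)}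
    (h0 : x a b ≠ 0) (h : e.row = a ∧ e.col = b ∨ e.row = b ∧ e.col = a) :
    grPi e.row e.col x ≠ 0 := by
  rw [Ne, grPi_eq_zero_iff]
  rcases h with ⟨h1, h2⟩ | ⟨h1, h2⟩ <;> rw [h1, h2]
  · exact h0
  · exact apply_comm_ne_zero_of_mem_Gr2 hx h0

/-- If any two weights of a point of the Grassmannian are dependent, then at most one pair of
matrix entries off the diagonal is nonzero. -/
theorem pair_eq_of_apply_ne_zero {lam : Fin r → ℤ} {α : Fin m → Fin r → ℤ}
    (hpi : (grGraph m lam α).PairwiseIndependent) {x : CMat m} (hx : x ∈ Gr2 m)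
    (hdep : ∀ e f : GrEdge m, grPi e.row e.col x ≠ 0 → grPi f.row f.col x ≠ 0 →
      ¬ LinearIndependent ℤ ![(grGraph m lam α).label e, (grGraph m lam α).label f])
    {a b c d : Fin (m + 2)} (hab : a ≠ b) (hcd : c ≠ d) (h1 : x a b ≠ 0) (h2 : x c d ≠ 0) :
    c = a ∧ d = b ∨ c = b ∧ d = a := by
  -- The edge with centre `q` and pair `{p, p'}` and the edge with centre `p` and pair `{q, q'}`
  -- meet in the vertex `{p, q}`. All remaining cases reduce to this by Hermitian symmetry.
  have key : ∀ p p' q q', p ≠ p' → q ≠ q' → p ≠ q → p ≠ q' → q ≠ p' → x p p' ≠ 0 →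
      x q q' ≠ 0 → False := by
    intro p p' q q' hp hq hpq hpq' hqp' h1 h2
    obtain ⟨e, he, he'⟩ := GrEdge.exists_eq hpq.symm hqp' hp
    obtain ⟨f, hf, hf'⟩ := GrEdge.exists_eq hpq hpq' hq
    refine hdep e f (grPi_row_col_ne_zero hx h1 he') (grPi_row_col_ne_zero hx h2 hf')
      (hpi (grVertex q p hpq.symm) e f ?_ ?_ fun hef => hpq ?_)
    · exact (grGraph_mem_ends lam α e _).2 (mem_ends_of_ctr_eq hpq.symm he he')
    · rw [grVertex_comm]
      exact (grGraph_mem_ends lam α f _).2 (mem_ends_of_ctr_eq hpq hf hf')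
    · rw [← he, ← hf, hef]
  have h1' := apply_comm_ne_zero_of_mem_Gr2 hx h1
  have h2' := apply_comm_ne_zero_of_mem_Gr2 hx h2
  by_cases hac : a = c
  · subst hac
    by_cases hbd : b = d
    · exact Or.inl ⟨rfl, hbd.symm⟩
    · exact (key b a d a hab.symm hcd.symm hbd hab.symm hcd.symm h1' h2').elim
  · by_cases had : a = d
    · subst had
      by_cases hbc : b = c
      · exact Or.inr ⟨hbc.symm, rfl⟩
      · exact (key b a c a hab.symm hcd hbc hab.symm (Ne.symm hac) h1' h2).elim
    · by_cases hbc : b = c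
      · subst hbc
        exact (key a b d b hab hcd.symm had hac hcd.symm h1 h2').elim
      · exact (key a b c d hab hcd hac had (Ne.symm hbc) h1 h2).elim

/-- The diagonal entries of a diagonal idempotent are `0` or `1`, and the trace `2` counts the ones.
-/
theorem mem_range_grPoint_of_diagonal {x : CMat m} (hx : x ∈ Gr2 m)
    (h0 : ∀ i j, i ≠ j → x i j = 0) : x ∈ Set.range (grPoint m) := by
  have hidem : ∀ i, x i i = 0 ∨ x i i = 1 := by
    intro i
    have h1 := congrFun (congrFun (mul_self_of_mem_Gr2 hx) i) i
    rw [Matrix.mul_apply, Finset.sum_eq_single i (fun k _ hk => by rw [h0 i k hk.symm, zero_mul])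
      (by simp)] at h1
    by_cases h : x i i = 0
    · exact Or.inl h
    · exact Or.inr (mul_left_cancel₀ h (h1.trans (mul_one _).symm))
  classical
  let s : Finset (Fin (m + 2)) := Finset.univ.filter fun i => x i i = 1
  have hval : ∀ i, x i i = if i ∈ s then 1 else 0 := by
    intro i
    by_cases h : x i i = 1
    · rw [if_pos (by simp [s, h]), h]
    · rw [if_neg (by simp [s, h]), (hidem i).resolve_right h]
  have hcard : s.card = 2 := by
    have h1 := trace_of_mem_Gr2 hx
    rw [Matrix.trace] at h1
    simp only [Matrix.diag_apply, hval] at h1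
    rw [Finset.sum_ite_mem, Finset.univ_inter, Finset.sum_const, nsmul_eq_mul, mul_one] at h1
    exact_mod_cast h1
  refine ⟨⟨s, hcard⟩, ?_⟩
  ext1 i j
  change coordProjection m s i j = x i j
  rw [coordProjection_apply]
  by_cases hij : i = j
  · subst hij
    rw [hval]; simp
  · rw [if_neg fun h => hij h.1, h0 i j hij]

/-- A point of the Grassmannian with a single pair of nonzero entries off the diagonal. -/
theorem exists_sphere_of_pair {x : CMat m} (hx : x ∈ Gr2 m) {a b : Fin (m + 2)} (hab : a ≠ b)
    (hne : x a b ≠ 0)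
    (h0 : ∀ i j, i ≠ j → x i j ≠ 0 → i = a ∧ j = b ∨ i = b ∧ j = a) :
    ∃ e : GrEdge m, x ∈ sphereSet (grPoint m e.src) (grPoint m e.tgt) (grZ e.row e.col) := by
  have hxx : ∀ i j, ∑ k, x i k * x k j = x i j := fun i j =>
    congrFun (congrFun (mul_self_of_mem_Gr2 hx) i) j
  have hz : ∀ i j, i ≠ j → ¬(i = a ∧ j = b ∨ i = b ∧ j = a) → x i j = 0 := fun i j hij h =>
    by_contra fun h' => h (h0 i j hij h')
  have hidem : ∀ i, i ≠ a → i ≠ b → x i i = 0 ∨ x i i = 1 := by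
    intro i hia hib
    have h1 := hxx i i
    rw [Finset.sum_eq_single i (fun k _ hk => by
      rw [hz i k hk.symm (by tauto), zero_mul]) (by simp)] at h1
    by_cases h : x i i = 0
    · exact Or.inl h
    · exact Or.inr (mul_left_cancel₀ h (h1.trans (mul_one _).symm))
  have hsum : ∀ i j, (∀ k, k ≠ a → k ≠ b → x i k * x k j = 0) →
      x i a * x a j + x i b * x b j = x i j := by
    intro i j h
    rw [← hxx i j, ← Finset.sum_pair (f := fun k => x i k * x k j) hab]
    refine Finset.sum_subset (Finset.subset_univ _) fun k _ hk => ?_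
    simp only [Finset.mem_insert, Finset.mem_singleton, not_or] at hk
    exact h k hk.1 hk.2
  -- The `(a, b)` entry of `x² = x`, divided by `x a b ≠ 0`.
  have hone : x a a + x b b = 1 := by
    have h1 := hsum a b fun k ha hb => by rw [hz a k ha.symm (by tauto), zero_mul]
    refine mul_left_cancel₀ hne ?_
    rw [mul_one]
    linear_combination h1
  have hsq : x a a * x a a + x a b * x b a = x a a :=
    hsum a a fun k ha hb => by rw [hz a k ha.symm (by tauto), zero_mul]
  classical
  let s : Finset (Fin (m + 2)) := Finset.univ.filter fun i => i ≠ a ∧ i ≠ b ∧ x i i = 1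
  -- The block in `a, b` contributes `1` to the trace `2`, leaving exactly one further diagonal
  -- entry `1`; its index is the centre of the edge.
  have hcard : s.card = 1 := by
    have h1 := trace_of_mem_Gr2 hx
    have h2 : ∀ i, x i i = (if i ∈ s then 1 else 0) +
        ((if i = a then x a a else 0) + if i = b then x b b else 0) := by
      intro i
      by_cases hia : i = a
      · subst hia; simp [s, hab]
      · by_cases hib : i = b
        · subst hib; simp [s, hia]
        · rcases hidem i hia hib with h | h <;> simp [s, hia, hib, h]
    rw [Matrix.trace] at h1
    simp only [Matrix.diag_apply] at h1
    rw [Finset.sum_congr rfl fun i _ => h2 i, Finset.sum_add_distrib, Finset.sum_add_distrib,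
      Finset.sum_ite_eq', Finset.sum_ite_eq', if_pos (Finset.mem_univ _),
      if_pos (Finset.mem_univ _), hone, Finset.sum_ite_mem, Finset.univ_inter, Finset.sum_const,
      nsmul_eq_mul, mul_one] at h1
    have h3 : (s.card : ℂ) = 1 := by linear_combination h1
    exact_mod_cast h3
  obtain ⟨c, hc⟩ := Finset.card_eq_one.1 hcard
  have hcs : c ≠ a ∧ c ≠ b ∧ x c c = 1 := by
    have : c ∈ s := hc ▸ Finset.mem_singleton_self c
    simpa [s] using this
  have hd : ∀ i, i ≠ a → i ≠ b → i ≠ c → x i i = 0 := by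
    intro i hia hib hic
    refine (hidem i hia hib).resolve_right fun h => hic ?_
    have : i ∈ s := by simp [s, hia, hib, h]
    rwa [hc, Finset.mem_singleton] at this
  have main : ∀ i j (hi : c ≠ i) (hj : c ≠ j), i ≠ j →
      (i = a ∧ j = b ∨ i = b ∧ j = a) →
      x ∈ sphereSet (grPoint m (grVertex c i hi)) (grPoint m (grVertex c j hj)) (grZ i j) := by
    intro i j hi hj hij h
    have hone' : x i i + x j j = 1 := by
      rcases h with ⟨rfl, rfl⟩ | ⟨rfl, rfl⟩
      · exact hone
      · rw [add_comm]; exact hone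
    have hsq' : x i i * x i i + x i j * x j i = x i i := by
      rcases h with ⟨rfl, rfl⟩ | ⟨rfl, rfl⟩
      · exact hsq
      · linear_combination hsq + (x i i - x j j) * hone
    have hri : ((x i i).re : ℂ) = x i i := Complex.conj_eq_iff_re.1
      (apply_eq_star_of_mem_Gr2 hx i i).symm
    have hn : (Complex.normSq (x i j) : ℂ) = x i j * x j i := by
      rw [← Complex.mul_conj, apply_eq_star_of_mem_Gr2 hx j i]; rfl
    -- Height and coordinate are forced by `(1 + s)/2 = xᵢᵢ` and `z/2 = xᵢⱼ`; the sphere equation is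
    -- the `(i, i)` entry of `x² = x`.
    refine ⟨2 * (x i i).re - 1, (2 : ℝ) • x i j, ?_, ?_⟩
    · have h1 : (((2 * (x i i).re - 1) ^ 2 + Complex.normSq ((2 : ℝ) • x i j) : ℝ) : ℂ) = 1 := by
        rw [Complex.real_smul, map_mul, Complex.normSq_ofReal]
        push_cast
        rw [hn, hri]
        linear_combination 4 * hsq'
      exact_mod_cast h1
    · rw [spherePoint_gr]
      have e1 : algebraMap ℝ ℂ ((1 + (2 * (x i i).re - 1)) / 2) = x i i := by
        rw [← hri, Complex.ofReal_re]
        exact congrArg _ (by ring)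
      have e2 : algebraMap ℝ ℂ ((1 - (2 * (x i i).re - 1)) / 2) = x j j := by
        change (((1 - (2 * (x i i).re - 1)) / 2 : ℝ) : ℂ) = _
        push_cast
        rw [hri]
        linear_combination -hone'
      have e3 : (1 / 2 : ℝ) • (2 : ℝ) • x i j = x i j := by rw [smul_smul]; norm_num
      rw [e1, e2, e3, ← apply_eq_star_of_mem_Gr2 hx j i]
      have hz' : ∀ k l, k ≠ l → ¬(k = i ∧ l = j ∨ k = j ∧ l = i) → x k l = 0 := by
        intro k l hkl h'
        refine hz k l hkl fun h'' => h' ?_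
        rcases h with ⟨rfl, rfl⟩ | ⟨rfl, rfl⟩ <;> tauto
      have hd' : ∀ k, k ≠ i → k ≠ j → k ≠ c → x k k = 0 := by
        intro k hki hkj hkc
        rcases h with ⟨rfl, rfl⟩ | ⟨rfl, rfl⟩
        · exact hd k hki hkj hkc
        · exact hd k hkj hki hkc
      ext1 k l
      simp only [Matrix.add_apply, Matrix.single_apply]
      by_cases hkl : k = l
      · subst hkl
        by_cases hki : k = i
        · subst hki; simp [hi, hij.symm]
        · by_cases hkj : k = j
          · subst hkj; simp [hj, hij]
          · by_cases hkc : k = c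
            · subst hkc; simp [hcs.2.2, hi.symm, hj.symm]
            · rw [hd' k hki hkj hkc]
              simp [Ne.symm hki, Ne.symm hkj, Ne.symm hkc]
      · by_cases h1 : k = i ∧ l = j ∨ k = j ∧ l = i
        · rcases h1 with ⟨rfl, rfl⟩ | ⟨rfl, rfl⟩
          · simp [hi, hij, hij.symm]
          · simp [hj, hij, hij.symm]
        · rw [hz' k l hkl h1]
          have g1 : ∀ p, ¬(p = k ∧ p = l) := fun p hp => hkl (hp.1.symm.trans hp.2)
          have g2 : ¬(i = k ∧ j = l) := fun hp => h1 (Or.inl ⟨hp.1.symm, hp.2.symm⟩)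
          have g3 : ¬(j = k ∧ i = l) := fun hp => h1 (Or.inr ⟨hp.1.symm, hp.2.symm⟩)
          rw [if_neg (g1 c), if_neg (g1 i), if_neg (g1 j), if_neg g2, if_neg g3]
          simp
  obtain ⟨e, he, he'⟩ := GrEdge.exists_eq hcs.1 hcs.2.1 hab
  subst he
  exact ⟨e, main e.row e.col e.ctr_ne_row e.ctr_ne_col e.row_ne_col he'⟩

/-- A point of the Grassmannian any two of whose weights are dependent lies on a sphere. -/
theorem exists_sphere_of_mem_Gr2 {lam : Fin r → ℤ} {α : Fin m → Fin r → ℤ}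
    (hpi : (grGraph m lam α).PairwiseIndependent) {x : CMat m} (hx : x ∈ Gr2 m)
    (hdep : ∀ e f : GrEdge m, grPi e.row e.col x ≠ 0 → grPi f.row f.col x ≠ 0 →
      ¬ LinearIndependent ℤ ![(grGraph m lam α).label e, (grGraph m lam α).label f]) :
    x ∈ Set.range (grPoint m) ∨ ∃ e : GrEdge m,
      x ∈ sphereSet (grPoint m e.src) (grPoint m e.tgt) (grZ e.row e.col) := by
  by_cases h0 : ∀ i j, i ≠ j → x i j = 0
  · exact Or.inl (mem_range_grPoint_of_diagonal hx h0)
  · push Not at h0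
    obtain ⟨a, b, hab, hne⟩ := h0
    exact Or.inr (exists_sphere_of_pair hx hab hne fun i j hij h =>
      pair_eq_of_apply_ne_zero hpi hx hdep hab hij hne h)

/-- The matrix `diag(θ₁, …, θₙ)`. -/
abbrev cDiag (θ : Fin (m + 2) → Circle) : CMat m := Matrix.diagonal fun i => (θ i : ℂ)

theorem star_cDiag (θ : Fin (m + 2) → Circle) : star (cDiag θ) = cDiag θ⁻¹ := by
  rw [Matrix.star_eq_conjTranspose, Matrix.diagonal_conjTranspose]
  congr 1
  ext1 i
  rw [Pi.inv_apply, Circle.coe_inv_eq_conj]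
  rfl

theorem cDiag_mul (θ θ' : Fin (m + 2) → Circle) : cDiag θ * cDiag θ' = cDiag (θ * θ') := by
  rw [Matrix.diagonal_mul_diagonal]
  congr 1

theorem cDiag_one : cDiag (1 : Fin (m + 2) → Circle) = 1 := by
  rw [← Matrix.diagonal_one]
  congr 1

theorem cDiag_mem_unitary (θ : Fin (m + 2) → Circle) : cDiag θ ∈ unitary (CMat m) := by
  rw [Unitary.mem_iff, star_cDiag, cDiag_mul, cDiag_mul, inv_mul_cancel, mul_inv_cancel]
  exact ⟨cDiag_one, cDiag_one⟩

theorem cDiag_mul_mul_star_apply (θ : Fin (m + 2) → Circle) (x : CMat m) (i j : Fin (m + 2)) :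
    (cDiag θ * x * star (cDiag θ)) i j = ((θ i * (θ j)⁻¹ : Circle) : ℂ) * x i j := by
  rw [star_cDiag, Matrix.mul_diagonal, Matrix.diagonal_mul, Circle.coe_mul, Pi.inv_apply]
  ring

theorem cDiag_mul_single_mul_star (θ : Fin (m + 2) → Circle) (i j : Fin (m + 2)) (z : ℂ) :
    cDiag θ * Matrix.single i j z * star (cDiag θ) =
      Matrix.single i j (((θ i * (θ j)⁻¹ : Circle) : ℂ) * z) := by
  ext1 k l
  rw [cDiag_mul_mul_star_apply]
  by_cases h : i = k ∧ j = l
  · obtain ⟨rfl, rfl⟩ := h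
    rw [Matrix.single_apply_same, Matrix.single_apply_same]
  · rw [Matrix.single_apply_of_ne _ _ _ _ _ h, Matrix.single_apply_of_ne _ _ _ _ _ h, mul_zero]

theorem grAction_rep {φ : Torus r →ₜ* UGroup m} {t : Torus r} {θ : Fin (m + 2) → Circle}
    (h : (φ t : CMat m) = cDiag θ) (x : CMat m) :
    (grAction φ).rep t x = cDiag θ * x * star (cDiag θ) := by
  change conjRep (CMat m) (φ t) x = _
  rw [conjRep_apply, h]

theorem grPoint_mem_fixedPoints {φ : Torus r →ₜ* UGroup m} (hφ : ∀ t, φ t ∈ uDiagonalTorus m)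
    (v : GrVertex m) : grPoint m v ∈ (grAction φ).fixedPoints := by
  refine ⟨grPoint_mem_Gr2 v, fun t => ?_⟩
  obtain ⟨θ, hθ⟩ := hφ t
  rw [grAction_rep hθ]
  ext1 i j
  rw [cDiag_mul_mul_star_apply, grPoint, coordProjection_apply]
  split_ifs with h
  · rw [h.1, mul_inv_cancel, Circle.coe_one, mul_one]
  · rw [mul_zero]

/-- The weights of a diagonal action in terms of `λ` and the `αₖ`. -/
def GrWeights (φ : Torus r →ₜ* UGroup m) (lam : Fin r → ℤ) (α : Fin m → Fin r → ℤ) : Prop :=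
  ∀ t, ∃ θ, (φ t : CMat m) = cDiag θ ∧
    ∀ i j, θ i * (θ j)⁻¹ = weightChar (grBeta lam α i - grBeta lam α j) t

theorem GrWeights.mem_uDiagonalTorus {φ : Torus r →ₜ* UGroup m} {lam : Fin r → ℤ}
    {α : Fin m → Fin r → ℤ} (h : GrWeights φ lam α) (t : Torus r) : φ t ∈ uDiagonalTorus m :=
  (h t).imp fun _ => And.left

theorem weightChar_label_grGraph {lam : Fin r → ℤ} {α : Fin m → Fin r → ℤ} {t : Torus r}
    {θ : Fin (m + 2) → Circle}
    (h : ∀ i j, θ i * (θ j)⁻¹ = weightChar (grBeta lam α i - grBeta lam α j) t) (e : GrEdge m) :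
    weightChar ((grGraph m lam α).label e) t = θ e.row * (θ e.col)⁻¹ := by
  rw [h, grGraph_label]

theorem grPi_conj (e : GrEdge m) (θ : Fin (m + 2) → Circle) (y : CMat m) :
    grPi e.row e.col (cDiag θ * y * star (cDiag θ)) =
      ((θ e.row * (θ e.col)⁻¹ : Circle) : ℂ) * grPi e.row e.col y := by
  rw [grPi_apply, grPi_apply, cDiag_mul_mul_star_apply, mul_smul_comm]

theorem conj_grZ (e : GrEdge m) (θ : Fin (m + 2) → Circle) (z : ℂ) :
    cDiag θ * grZ e.row e.col z * star (cDiag θ) =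
      grZ e.row e.col (((θ e.row * (θ e.col)⁻¹ : Circle) : ℂ) * z) := by
  simp only [grZ, LinearMap.coe_mk, AddHom.coe_mk, mul_add, add_mul]
  rw [cDiag_mul_single_mul_star, cDiag_mul_single_mul_star]
  have h : θ e.col * (θ e.row)⁻¹ = (θ e.row * (θ e.col)⁻¹)⁻¹ := by rw [mul_inv_rev, inv_inv]
  rw [mul_smul_comm, h, Circle.coe_inv_eq_conj, star_smul, star_smul, star_mul, mul_smul_comm,
    mul_comm (star z)]
  rfl

theorem grPoint_injective : Function.Injective (grPoint m) := by
  intro v w h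
  refine Subtype.ext (Finset.ext fun i => ?_)
  have h1 := congrFun (congrFun h i) i
  rw [grPoint, grPoint, coordProjection_apply, coordProjection_apply] at h1
  by_cases hv : i ∈ v.1 <;> by_cases hw : i ∈ w.1 <;> simp_all

theorem src_ne_tgt (e : GrEdge m) : e.src ≠ e.tgt := fun h => by
  rcases grVertex_eq_iff.1 h with h | h
  · exact e.row_ne_col h.2
  · exact e.ctr_ne_col h.1

theorem grPi_grZ_of_common_vertex {e f : GrEdge m} {v : GrVertex m} (he : v = e.src ∨ v = e.tgt)
    (hf : v = f.src ∨ v = f.tgt) (hne : e ≠ f) (z : ℂ) :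
    grPi f.row f.col (grZ e.row e.col z) = 0 :=
  grPi_grZ_of_ne (fun h => hne (eq_of_common_vertex he hf (Or.inl h)))
    (fun h => hne (eq_of_common_vertex he hf (Or.inr h))) z

/-- The invariant spheres of a diagonal action on the Grassmannian. -/
def grSpheres {φ : Torus r →ₜ* UGroup m} {lam : Fin r → ℤ} {α : Fin m → Fin r → ℤ}
    (h : GrWeights φ lam α) : EdgeSpheres (grAction φ) (grGraph m lam α) (grPoint m) where
  src := GrEdge.src
  tgt := GrEdge.tgt
  ends_eq := grGraph_ends lam α
  src_ne_tgt := src_ne_tgt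
  Z := fun e : GrEdge m => grZ e.row e.col
  π := fun e : GrEdge m => grPi e.row e.col
  π_Z := fun e : GrEdge m => grPi_grZ e.row_ne_col
  π_vertex := fun e : GrEdge m => grPi_grPoint e.row_ne_col
  π_rep e t y := by
    obtain ⟨θ, hθ, hw⟩ := h t
    rw [grAction_rep hθ, weightChar_label_grGraph hw e]
    exact grPi_conj e θ y
  rep_Z e t z := by
    obtain ⟨θ, hθ, hw⟩ := h t
    rw [grAction_rep hθ, weightChar_label_grGraph hw e]
    exact conj_grZ e θ z
  injective := grPoint_injective
  vertex_mem := grPoint_mem_fixedPoints h.mem_uDiagonalTorus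
  sphere_subset := fun e : GrEdge m => sphereSet_subset_Gr2 e.ctr_ne_row e.ctr_ne_col e.row_ne_col
  π_Z_of_ne v e f he hf hne := grPi_grZ_of_common_vertex ((grGraph_mem_ends lam α e v).1 he)
    ((grGraph_mem_ends lam α f v).1 hf) hne
  tangent_ext v w hw hall := tangent_gr_ext hw fun e he => hall e ((grGraph_mem_ends lam α e v).2 he)
  skeleton hpi _ hx hdep := exists_sphere_of_mem_Gr2 hpi hx hdep
  disjoint _ _ hne := disjoint_gr_spheres hne
  exists_other v e hv := by
    obtain ⟨f, h1, h2⟩ := exists_other_gr e ((grGraph_mem_ends lam α e v).1 hv)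
    exact ⟨f, h1, (grGraph_mem_ends lam α f v).2 h2⟩

end GrassmannianSpheres

end

noncomputable section

/-! ### Quaternionic weights on the Grassmannian -/

section GrassmannianWeights

variable {r m : ℕ}

theorem exists_ne_of_pair (hm : 1 ≤ m) (i j : Fin (m + 2)) : ∃ l, l ≠ i ∧ l ≠ j := by
  have h : ({i, j} : Finset (Fin (m + 2))).card < Fintype.card (Fin (m + 2)) := by
    rw [Fintype.card_fin]
    exact Finset.card_le_two.trans_lt (by omega)
  obtain ⟨l, hl⟩ : ∃ l, l ∉ ({i, j} : Finset (Fin (m + 2))) := by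
    by_contra! hall
    exact (Finset.card_lt_iff_ne_univ _).1 h (Finset.eq_univ_iff_forall.2 hall)
  simp only [Finset.mem_insert, Finset.mem_singleton, not_or] at hl
  exact ⟨l, hl⟩

/-- The diagonal element of the algebra `𝔰𝔲(2)` at `vᵢⱼ`. -/
def suDiag (i j : Fin (m + 2)) : CMat m :=
  Matrix.single i i Complex.I + Matrix.single j j (-Complex.I)

/-- The off-diagonal elements of the algebra `𝔰𝔲(2)` at `vᵢⱼ`. -/
def suOff (i j : Fin (m + 2)) (z : ℂ) : CMat m :=
  Matrix.single i j z + Matrix.single j i (-star z)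

theorem suOff_add (i j : Fin (m + 2)) (z w : ℂ) : suOff i j (z + w) = suOff i j z + suOff i j w := by
  simp only [suOff, star_add, neg_add, Matrix.single_add]
  abel

theorem suOff_smul (i j : Fin (m + 2)) (c : ℝ) (z : ℂ) : suOff i j (c • z) = c • suOff i j z := by
  simp only [suOff, star_smul, star_trivial, smul_add, Matrix.smul_single, smul_neg]

theorem grPoint_mul_apply (v : GrVertex m) (x : CMat m) (k l : Fin (m + 2)) :
    (grPoint m v * x) k l = if k ∈ v.1 then x k l else 0 := by
  rw [grPoint, coordProjection, Matrix.diagonal_mul]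
  split_ifs <;> simp

theorem mul_grPoint_apply (v : GrVertex m) (x : CMat m) (k l : Fin (m + 2)) :
    (x * grPoint m v) k l = if l ∈ v.1 then x k l else 0 := by
  rw [grPoint, coordProjection, Matrix.mul_diagonal]
  split_ifs <;> simp

theorem mem_grSp1_iff {i j : Fin (m + 2)} (h : i ≠ j) {X : CMat m} :
    X ∈ grSp1 m (grPoint m (grVertex i j h)) ↔
      ∃ a b c : ℝ, X = a • suDiag i j + (b • suOff i j 1 + c • suOff i j Complex.I) := by
  have hmem : ∀ k, k ∈ (grVertex i j h).1 ↔ k = i ∨ k = j := fun k => by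
    rw [grVertex, Finset.mem_insert, Finset.mem_singleton]
  constructor
  · rintro ⟨h1, h2, h3⟩
    have hs : ∀ k l, star (X l k) = -X k l := fun k l => congrFun (congrFun h1 k) l
    have hz : ∀ k l, ¬((k = i ∨ k = j) ∧ (l = i ∨ l = j)) → X k l = 0 := by
      intro k l hkl
      rw [← h2, mul_grPoint_apply, grPoint_mul_apply]
      simp only [hmem]
      split_ifs <;> tauto
    have htr : X i i + X j j = 0 := by
      refine Eq.trans (Finset.sum_pair (f := fun k => X k k) h).symm (Eq.trans ?_ h3)
      refine Finset.sum_subset (Finset.subset_univ _) fun k _ hk => ?_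
      simp only [Finset.mem_insert, Finset.mem_singleton] at hk
      exact hz k k fun h' => hk h'.1
    have hre : (X i i).re = 0 := by
      have := congrArg Complex.re (hs i i)
      simp only [Complex.star_def, Complex.conj_re, Complex.neg_re] at this
      linarith
    have hii : X i i = (X i i).im • Complex.I := by
      apply Complex.ext <;> simp [hre]
    have hjj : X j j = (X i i).im • -Complex.I := by
      rw [smul_neg, ← hii]; linear_combination htr
    have hji : X j i = -star (X i j) := by rw [hs, neg_neg]
    refine ⟨(X i i).im, (X i j).re, (X i j).im, ?_⟩
    rw [← suOff_smul, ← suOff_smul, ← suOff_add]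
    have hij : (X i j).re • (1 : ℂ) + (X i j).im • Complex.I = X i j := by
      rw [Complex.real_smul, Complex.real_smul, mul_one, Complex.re_add_im]
    rw [hij, suDiag, suOff, smul_add, Matrix.smul_single, Matrix.smul_single, ← hii, ← hjj, ← hji]
    ext1 k l
    simp only [Matrix.add_apply, Matrix.single_apply]
    by_cases hkl : (k = i ∨ k = j) ∧ (l = i ∨ l = j)
    · rcases hkl with ⟨rfl | rfl, rfl | rfl⟩ <;> simp [h, h.symm]
    · rw [hz k l hkl, if_neg, if_neg, if_neg, if_neg]
      · simp
      all_goals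
        rintro ⟨rfl, rfl⟩
        simp at hkl
  · rintro ⟨a, b, c, rfl⟩
    have hD : suDiag i j ∈ grSp1 m (grPoint m (grVertex i j h)) := by
      refine ⟨?_, ?_, ?_⟩
      · simp only [suDiag, star_add, Matrix.star_eq_conjTranspose, Matrix.conjTranspose_single,
          neg_add, Matrix.single_neg, Complex.star_def, map_neg, Complex.conj_I]
      · ext1 k l
        rw [mul_grPoint_apply, grPoint_mul_apply]
        simp only [hmem]
        split_ifs with h1 h2
        · rfl
        · rw [suDiag, Matrix.add_apply, Matrix.single_apply_of_ne _ _ _ _ _ (by tauto),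
            Matrix.single_apply_of_ne _ _ _ _ _ (by tauto), add_zero]
        · rw [suDiag, Matrix.add_apply, Matrix.single_apply_of_ne _ _ _ _ _ (by tauto),
            Matrix.single_apply_of_ne _ _ _ _ _ (by tauto), add_zero]
      · rw [suDiag, Matrix.trace_add, Matrix.trace_single_eq_same, Matrix.trace_single_eq_same,
          add_neg_cancel]
    have hO : ∀ z, suOff i j z ∈ grSp1 m (grPoint m (grVertex i j h)) := by
      intro z
      refine ⟨?_, ?_, ?_⟩
      · simp only [suOff, star_add, Matrix.star_eq_conjTranspose, Matrix.conjTranspose_single,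
          neg_add, Matrix.single_neg, star_neg, star_star, neg_neg]
        rw [add_comm]
      · ext1 k l
        rw [mul_grPoint_apply, grPoint_mul_apply]
        simp only [hmem]
        split_ifs with h1 h2
        · rfl
        · rw [suOff, Matrix.add_apply, Matrix.single_apply_of_ne _ _ _ _ _ (by tauto),
            Matrix.single_apply_of_ne _ _ _ _ _ (by tauto), add_zero]
        · rw [suOff, Matrix.add_apply, Matrix.single_apply_of_ne _ _ _ _ _ (by tauto),
            Matrix.single_apply_of_ne _ _ _ _ _ (by tauto), add_zero]
      · rw [suOff, Matrix.trace_add, Matrix.trace_single_eq_of_ne _ _ _ h,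
          Matrix.trace_single_eq_of_ne _ _ _ h.symm, add_zero]
    exact Submodule.add_mem _ (Submodule.smul_mem _ _ hD)
      (Submodule.add_mem _ (Submodule.smul_mem _ _ (hO 1)) (Submodule.smul_mem _ _ (hO Complex.I)))

theorem single_add_single_mem_tangent_gr {i j l : Fin (m + 2)} (h : i ≠ j) {k : Fin (m + 2)}
    (hk : k = i ∨ k = j) (hi : l ≠ i) (hj : l ≠ j) :
    (Matrix.single k l 1 + Matrix.single l k 1 : CMat m) ∈
      tangentSpaceAt (Gr2 m) (grPoint m (grVertex i j h)) := by
  have hmem : ∀ k, k ∈ (grVertex i j h).1 ↔ k = i ∨ k = j := fun k => by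
    rw [grVertex, Finset.mem_insert, Finset.mem_singleton]
  rw [tangent_gr_iff]
  constructor
  · rw [star_add, Matrix.star_eq_conjTranspose, Matrix.star_eq_conjTranspose,
      Matrix.conjTranspose_single, Matrix.conjTranspose_single, star_one, add_comm]
  · ext1 a b
    rw [Matrix.add_apply, mul_grPoint_apply, grPoint_mul_apply]
    simp only [hmem]
    have hlk : l ≠ k := by rcases hk with rfl | rfl <;> assumption
    have hx : ∀ a b, ((a = i ∨ a = j) ↔ (b = i ∨ b = j)) →
        (Matrix.single k l 1 + Matrix.single l k 1 : CMat m) a b = 0 := by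
      intro a b hab
      rw [Matrix.add_apply, Matrix.single_apply_of_ne, Matrix.single_apply_of_ne, add_zero]
      · rintro ⟨rfl, rfl⟩; tauto
      · rintro ⟨rfl, rfl⟩; tauto
    by_cases ha : a = i ∨ a = j <;> by_cases hb : b = i ∨ b = j
    · rw [if_pos ha, if_pos hb, hx a b (by tauto), add_zero]
    · rw [if_pos ha, if_neg hb, add_zero]
    · rw [if_neg ha, if_pos hb, zero_add]
    · rw [if_neg ha, if_neg hb, hx a b (by tauto), add_zero]

/-- The quaternionic weight at `vᵢⱼ` of a diagonal action is the difference of the weights at `i`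
and `j`. -/
theorem isGrQuatWeight_of_cDiag (hm : 1 ≤ m) {φ : Torus r →ₜ* UGroup m} {i j : Fin (m + 2)}
    (hij : i ≠ j) {w : Fin r → ℤ}
    (h : ∀ t, ∃ θ, (φ t : CMat m) = cDiag θ ∧ θ i * (θ j)⁻¹ = weightChar w t) :
    IsGrQuatWeight φ (grVertex i j hij) w := by
  have hoff : ∀ (t : Torus r) (z : ℂ),
      (grAction φ).rep t (suOff i j z) = suOff i j ((weightChar w t : ℂ) * z) := by
    intro t z
    obtain ⟨θ, hθ, hw⟩ := h t
    have h1 : θ j * (θ i)⁻¹ = (weightChar w t)⁻¹ := by rw [← hw, mul_inv_rev, inv_inv]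
    rw [grAction_rep hθ, suOff, suOff, mul_add, add_mul, cDiag_mul_single_mul_star,
      cDiag_mul_single_mul_star, hw, h1, Circle.coe_inv_eq_conj, star_mul, mul_neg, mul_comm (star z)]
    rfl
  have hcomb : ∀ (c : ℂ) (z : ℂ), suOff i j (c * z) =
      c.re • suOff i j z + c.im • suOff i j (Complex.I * z) := by
    intro c z
    rw [← suOff_smul, ← suOff_smul, ← suOff_add]
    congr 1
    rw [Complex.real_smul, Complex.real_smul, ← mul_assoc, ← add_mul, Complex.re_add_im]
  refine TorusAction.isQuatWeight_adEndomorphisms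
    (grPoint_mem_fixedPoints (fun t => (h t).imp fun _ => And.left) (grVertex i j hij))
    (suDiag i j) (suOff i j 1) (suOff i j Complex.I) (fun X => mem_grSp1_iff hij) ?_ ?_ ?_ ?_ ?_ ?_
  · rintro X ⟨hX1, hX2, -⟩ v hv
    have hv' := tangent_gr_iff.1 hv
    have hpp : grPoint m (grVertex i j hij) * grPoint m (grVertex i j hij) =
      grPoint m (grVertex i j hij) := coordProjection_mul_self _
    have hpX : grPoint m (grVertex i j hij) * X = X := by
      rw [← hX2, ← mul_assoc, ← mul_assoc, hpp]
    have hXp : X * grPoint m (grVertex i j hij) = X := by rw [← hX2, mul_assoc, hpp]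
    refine tangent_gr_iff.2 ⟨?_, ?_⟩
    · rw [star_sub, star_mul, star_mul, hX1, hv'.1]; noncomm_ring
    · exact commutator_add_eq (hpX.trans hXp.symm) hv'.2
  · intro a b c hall
    -- An index outside the plane exists since `m ≥ 1`. The commutator of `X` with `Eᵢₗ + Eₗᵢ` has
    -- the entries `Xᵢᵢ` at `(i, l)` and `Xⱼᵢ` at `(j, l)`, which determine `X`.
    obtain ⟨l, hli, hlj⟩ := exists_ne_of_pair hm i j
    have h1 := hall _ (single_add_single_mem_tangent_gr hij (Or.inl rfl) hli hlj)
    rw [← suOff_smul, ← suOff_smul, ← suOff_add] at h1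
    have e1 := congrFun (congrFun h1 i) l
    have e2 := congrFun (congrFun h1 j) l
    simp [suDiag, suOff, Matrix.add_mul, Matrix.mul_add, Matrix.single_mul_single_same,
      hij, hij.symm, hli, hlj, hli.symm, hlj.symm] at e1 e2
    exact ⟨e1, by simpa using congrArg Complex.re e2, by simpa using congrArg Complex.im e2⟩
  · intro t x y
    obtain ⟨θ, hθ, -⟩ := h t
    have hu := (Unitary.mem_iff.1 (cDiag_mem_unitary θ)).1
    rw [grAction_rep hθ, grAction_rep hθ, grAction_rep hθ]
    calc cDiag θ * (x * y) * star (cDiag θ)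
        = cDiag θ * x * 1 * y * star (cDiag θ) := by noncomm_ring
      _ = _ := by rw [← hu]; noncomm_ring
  · intro t
    obtain ⟨θ, hθ, -⟩ := h t
    rw [grAction_rep hθ, suDiag, mul_add, add_mul, cDiag_mul_single_mul_star,
      cDiag_mul_single_mul_star, mul_inv_cancel, mul_inv_cancel, Circle.coe_one, one_mul, one_mul]
  · intro t
    rw [hoff, hcomb, mul_one]
  · intro t
    rw [hoff, hcomb, Complex.I_mul_I]
    have : suOff i j (-1 : ℂ) = -suOff i j 1 := by
      have := suOff_smul i j (-1) 1
      simpa using this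
    rw [this]
    module

end GrassmannianWeights

end

noncomputable section

/-! ### Weights and realization for the Grassmannian -/

section GrassmannianMain

variable {r m : ℕ}

theorem GrWeights.isGrQuatWeight (hm : 1 ≤ m) {φ : Torus r →ₜ* UGroup m} {lam : Fin r → ℤ}
    {α : Fin m → Fin r → ℤ} (h : GrWeights φ lam α) {i j : Fin (m + 2)} (hij : i ≠ j) :
    IsGrQuatWeight φ (grVertex i j hij) (grBeta lam α i - grBeta lam α j) :=
  isGrQuatWeight_of_cDiag hm hij fun t => (h t).imp fun _ h1 => ⟨h1.1, h1.2 i j⟩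

theorem GrWeights.isGrQuatWeight_v12 (hm : 1 ≤ m) {φ : Torus r →ₜ* UGroup m} {lam : Fin r → ℤ}
    {α : Fin m → Fin r → ℤ} (h : GrWeights φ lam α) : IsGrQuatWeight φ (v12 m) lam := by
  have := h.isGrQuatWeight hm (zero_ne_one (α := Fin (m + 2)))
  rwa [grBeta_zero, grBeta_one, sub_zero] at this

theorem GrWeights.isGrQuatWeight_v1 (hm : 1 ≤ m) {φ : Torus r →ₜ* UGroup m} {lam : Fin r → ℤ}
    {α : Fin m → Fin r → ℤ} (h : GrWeights φ lam α) (k : Fin m) :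
    IsGrQuatWeight φ (v1 k) (lam - α k) :=
  h.isGrQuatWeight hm (Fin.succ_ne_zero k.succ).symm

theorem GrWeights.isGrQuatWeight_v2 (hm : 1 ≤ m) {φ : Torus r →ₜ* UGroup m} {lam : Fin r → ℤ}
    {α : Fin m → Fin r → ℤ} (h : GrWeights φ lam α) (k : Fin m) :
    IsGrQuatWeight φ (v2 k) (α k) := by
  have h1 := h.isGrQuatWeight hm (succ_succ_ne_one k)
  rwa [grVertex_comm, grBeta_one, sub_zero] at h1

theorem GrWeights.isGrQuatWeight_vv (hm : 1 ≤ m) {φ : Torus r →ₜ* UGroup m} {lam : Fin r → ℤ}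
    {α : Fin m → Fin r → ℤ} (h : GrWeights φ lam α) (k l : Fin m) (hkl : k ≠ l) :
    IsGrQuatWeight φ (vv k l hkl) (α k - α l) :=
  h.isGrQuatWeight hm _

theorem exists_grWeights {φ : Torus r →ₜ* UGroup m} (hφ : ∀ t, φ t ∈ uDiagonalTorus m) :
    ∃ lam α, GrWeights φ lam α := by
  choose θ hθ using hφ
  have hval : ∀ i t, ((θ t i : Circle) : ℂ) = (φ t : CMat m) i i := fun i t => by
    rw [hθ, Matrix.diagonal_apply_eq]
  have hchar : ∀ i, ∃ γ : Fin r → ℤ, ∀ t, θ t i = weightChar γ t := by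
    intro i
    refine exists_weightChar_eq ?_ fun s t => Circle.ext ?_
    · refine Continuous.subtype_mk (f := fun t => ((θ t i : Circle) : ℂ)) ?_ (fun t => (θ t i).2)
      simp_rw [hval]
      exact (continuous_subtype_val.comp φ.continuous_toFun).matrix_elem i i
    · rw [hval, map_mul, Submonoid.coe_mul, hθ, hθ, Matrix.diagonal_mul_diagonal,
        Matrix.diagonal_apply_eq, Circle.coe_mul]
  choose γ hγ using hchar
  -- Scalar matrices act trivially, so the weights on `ℂⁿ` may be shifted to make the second one
  -- zero.
  refine ⟨γ 0 - γ 1, fun k => γ k.succ.succ - γ 1, fun t => ⟨θ t, hθ t, fun i j => ?_⟩⟩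
  have hβ : ∀ i, grBeta (γ 0 - γ 1) (fun k => γ k.succ.succ - γ 1) i = γ i - γ 1 := by
    intro i
    rcases fin_eq_zero_or_one_or i with rfl | rfl | ⟨k, rfl⟩
    · rfl
    · rw [grBeta_one, sub_self]
    · rfl
  rw [hβ, hβ, sub_sub_sub_cancel_right, weightChar_sub, hγ, hγ]

theorem label_grGraph_neg (lam : Fin r → ℤ) (α : Fin m → Fin r → ℤ) (e : GrEdge m) :
    (grGraph m (-lam) (-α)).label e = -(grGraph m lam α).label e := by
  cases e <;> simp only [grGraph, Pi.neg_apply] <;> abel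

/-- A GKM action on the Grassmannian through the diagonal torus: its graph and its quaternionic
weights. -/
theorem gr_graph_of_isGKM (hm : 1 ≤ m) (φ : Torus r →ₜ* UGroup m)
    (hφ : ∀ t, φ t ∈ uDiagonalTorus m) (hG : (grAction φ).IsGKM) :
    (∃ lam : Fin r → ℤ, IsGrQuatWeight φ (v12 m) lam) ∧
      ∀ lam : Fin r → ℤ, IsGrQuatWeight φ (v12 m) lam →
        ∃ α : Fin m → Fin r → ℤ,
          (grAction φ).HasGKMGraph (grGraph m lam α) (grPoint m) ∧
          (∀ k, IsGrQuatWeight φ (v1 k) (lam - α k)) ∧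
          (∀ k, IsGrQuatWeight φ (v2 k) (α k)) ∧
          (∀ k l h, IsGrQuatWeight φ (vv k l h) (α k - α l)) := by
  obtain ⟨μ, β, h⟩ := exists_grWeights hφ
  have hgraph : (grAction φ).HasGKMGraph (grGraph m μ β) (grPoint m) :=
    have : Finite (grGraph m μ β).Edge := inferInstanceAs (Finite (GrEdge m))
    (grSpheres h).hasGKMGraph ((grSpheres h).pairwiseIndependent hG)
  have hw := h.isGrQuatWeight_v12 hm
  refine ⟨⟨μ, hw⟩, fun lam hlam => ?_⟩
  -- As for projective space, the opposite sign of `λ` is absorbed by negating every `αₖ`.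
  rcases TorusAction.IsQuatWeight.eq_or_eq_neg hlam hw with rfl | rfl
  · exact ⟨β, hgraph, h.isGrQuatWeight_v1 hm, h.isGrQuatWeight_v2 hm, h.isGrQuatWeight_vv hm⟩
  · refine ⟨-β, hgraph.congr_label _ fun e => Or.inr (label_grGraph_neg μ β e), fun k => ?_,
      fun k => ?_, fun k l hkl => ?_⟩
    · have e : -μ - (-β) k = -(μ - β k) := by rw [Pi.neg_apply]; abel
      rw [e]
      exact TorusAction.IsQuatWeight.neg (h.isGrQuatWeight_v1 hm k)
    · exact TorusAction.IsQuatWeight.neg (h.isGrQuatWeight_v2 hm k)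
    · have e : (-β) k - (-β) l = -(β k - β l) := by rw [Pi.neg_apply, Pi.neg_apply]; abel
      rw [e]
      exact TorusAction.IsQuatWeight.neg (h.isGrQuatWeight_vv hm k l hkl)

variable (lam : Fin r → ℤ) (α : Fin m → Fin r → ℤ)

/-- The diagonal entries of the action with prescribed weights. -/
def grLift (t : Torus r) : Fin (m + 2) → Circle := fun i => weightChar (grBeta lam α i) t

/-- The homomorphism with prescribed weights. -/
def grHom : Torus r →ₜ* UGroup m where
  toMonoidHom := MonoidHom.mk' (fun t => ⟨cDiag (grLift lam α t), cDiag_mem_unitary _⟩) fun s t => by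
    refine Subtype.ext ?_
    change cDiag (grLift lam α (s * t)) = cDiag (grLift lam α s) * cDiag (grLift lam α t)
    rw [cDiag_mul]
    exact congrArg _ (funext fun i => weightChar_mul _ s t)
  continuous_toFun := by
    refine Continuous.subtype_mk (f := fun t => cDiag (grLift lam α t)) ?_ _
    exact Continuous.matrix_diagonal (continuous_pi fun i =>
      continuous_subtype_val.comp (continuous_weightChar _))

theorem grWeights_grHom : GrWeights (grHom lam α) lam α := fun t =>
  ⟨grLift lam α t, rfl, fun _ _ => (weightChar_sub _ _ t).symm⟩

theorem complex_smul_one_mul_self : (Complex.I • (1 : CMat m)) * (Complex.I • 1) = -1 := by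
  rw [smul_mul_smul_comm, Complex.I_mul_I, one_mul, neg_one_smul]

theorem star_complex_smul_one : star (Complex.I • (1 : CMat m)) = -(Complex.I • (1 : CMat m)) := by
  rw [star_smul, star_one, Complex.star_def, Complex.conj_I, neg_smul]

theorem complex_smul_one_comm (p : CMat m) :
    (Complex.I • (1 : CMat m)) * p = p * (Complex.I • (1 : CMat m)) := by
  rw [smul_mul_assoc, mul_smul_comm, one_mul, mul_one]

theorem isOrientableSubmanifold_Gr2 (m : ℕ) : IsOrientableSubmanifold (Gr2 m) :=
  isOrientableSubmanifold_of_complexStructure (star_coordProjection _) (coordProjection_mul_self _)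
    complex_smul_one_mul_self (complex_smul_one_comm _)

theorem oddBettiNumbersVanish_Gr2 (m : ℕ) : OddBettiNumbersVanish (Gr2 m) :=
  oddBettiNumbersVanish_of_complexStructure (star_coordProjection _) (coordProjection_mul_self _)
    complex_smul_one_mul_self star_complex_smul_one (complex_smul_one_comm _)

/-- Every labelled graph of the form `grGraph` with independent labels is realized. -/
theorem exists_gr_action (hm : 1 ≤ m) (h : (grGraph m lam α).PairwiseIndependent) :
    ∃ φ : Torus r →ₜ* UGroup m,
      (∀ t, φ t ∈ uDiagonalTorus m) ∧ (grAction φ).IsGKM ∧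
      (grAction φ).HasGKMGraph (grGraph m lam α) (grPoint m) ∧
      IsGrQuatWeight φ (v12 m) lam ∧
      (∀ k, IsGrQuatWeight φ (v1 k) (lam - α k)) ∧
      (∀ k, IsGrQuatWeight φ (v2 k) (α k)) ∧
      (∀ k l h, IsGrQuatWeight φ (vv k l h) (α k - α l)) := by
  have hw := grWeights_grHom lam α
  have _ : Finite (grGraph m lam α).Edge := inferInstanceAs (Finite (GrEdge m))
  have _ : Finite (grGraph m lam α).Vertex := inferInstanceAs (Finite (GrVertex m))
  exact ⟨grHom lam α, hw.mem_uDiagonalTorus,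
    (grSpheres hw).isGKM h (isOrientableSubmanifold_Gr2 m) (oddBettiNumbersVanish_Gr2 m),
    (grSpheres hw).hasGKMGraph h, hw.isGrQuatWeight_v12 hm, hw.isGrQuatWeight_v1 hm,
    hw.isGrQuatWeight_v2 hm, hw.isGrQuatWeight_vv hm⟩

end GrassmannianMain

end

/-- The GKM graphs of torus actions on `ℍPⁿ`, `n ≥ 1`, and on `Gr₂(ℂᵐ⁺²)`, `m ≥ 1`. -/
theorem proposition6p1 (r : ℕ) :
    (∀ n : ℕ, 1 ≤ n →
      -- every GKM action on `ℍPⁿ` through the diagonal torus of `Sp(n+1)/ℤ₂`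
      (∀ φ : Torus r →ₜ* SpGroupMod n,
        (∀ t, ∃ g ∈ spDiagonalTorus n, φ t = (g : SpGroupMod n)) →
        (hpAction φ).IsGKM →
        (∃ lam : Fin r → ℤ, IsHPQuatWeight φ 0 lam) ∧
        ∀ lam : Fin r → ℤ,
          IsHPQuatWeight φ 0 lam →
          ∃ α : Fin n → Fin r → ℤ,
            (hpAction φ).HasGKMGraph (hpGraph n lam α) (hpPoint n) ∧
            ∀ k : Fin n, IsHPQuatWeight φ k.succ (lam - 2 • α k)) ∧
      -- realization of all labelled graphs of this form
      (∀ (lam : Fin r → ℤ) (α : Fin n → Fin r → ℤ),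
        (hpGraph n lam α).PairwiseIndependent →
        ∃ φ : Torus r →ₜ* SpGroupMod n,
          (∀ t, ∃ g ∈ spDiagonalTorus n, φ t = (g : SpGroupMod n)) ∧
          (hpAction φ).IsGKM ∧
          (hpAction φ).HasGKMGraph (hpGraph n lam α) (hpPoint n) ∧
          IsHPQuatWeight φ 0 lam ∧
          ∀ k : Fin n, IsHPQuatWeight φ k.succ (lam - 2 • α k))) ∧
    (∀ m : ℕ, 1 ≤ m →
      -- every GKM action on `Gr₂(ℂᵐ⁺²)` through the diagonal torus of `U(m+2)`
      (∀ φ : Torus r →ₜ* UGroup m,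
        (∀ t, φ t ∈ uDiagonalTorus m) →
        (grAction φ).IsGKM →
        (∃ lam : Fin r → ℤ,
          IsGrQuatWeight φ (v12 m) lam) ∧
        ∀ lam : Fin r → ℤ,
          IsGrQuatWeight φ (v12 m) lam →
          ∃ α : Fin m → Fin r → ℤ,
            (grAction φ).HasGKMGraph (grGraph m lam α) (grPoint m) ∧
            (∀ k, IsGrQuatWeight φ (v1 k) (lam - α k)) ∧
            (∀ k, IsGrQuatWeight φ (v2 k) (α k)) ∧
            (∀ k l h, IsGrQuatWeight φ (vv k l h) (α k - α l))) ∧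
      -- realization of all labelled graphs of this form
      (∀ (lam : Fin r → ℤ) (α : Fin m → Fin r → ℤ),
        (grGraph m lam α).PairwiseIndependent →
        ∃ φ : Torus r →ₜ* UGroup m,
          (∀ t, φ t ∈ uDiagonalTorus m) ∧
          (grAction φ).IsGKM ∧
          (grAction φ).HasGKMGraph (grGraph m lam α) (grPoint m) ∧
          IsGrQuatWeight φ (v12 m) lam ∧
          (∀ k, IsGrQuatWeight φ (v1 k) (lam - α k)) ∧
          (∀ k, IsGrQuatWeight φ (v2 k) (α k)) ∧
          (∀ k l h, IsGrQuatWeight φ (vv k l h) (α k - α l)))) := by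
  refine ⟨fun n hn => ⟨fun φ hφ hG => hp_graph_of_isGKM hn φ hφ hG,
    fun lam α h => exists_hp_action lam α hn h⟩,
    fun m hm => ⟨fun φ hφ hG => gr_graph_of_isGKM hm φ hφ hG,
      fun lam α h => exists_gr_action lam α hm h⟩⟩
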